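/- **Setting.** Let $T>0$, let $C_0[0,T]$ be the space of real continuous functions on $[0,T]$ vanishing at $0$, and let $\mathfrak m$ be Wiener measure on it. A property holds *s-a.e.* if for every $\rho>0$ it holds at $\rho x$ for $\mathfrak m$-a.e. $x$. Fix a complete orthonormal sequence $(\varphi_j)$ of functions of bounded variation in $L_2[0,T]$ (real-valued). For $u\in L_2[0,T]$ let $$\langle u,x\rangle=\lim_{n\to\infty}\int_0^T\sum_{j\le n}(u,\varphi_j)_2\,\varphi_j(t)\,dx(t)$$ be the Paley–Wiener–Zygmund integral (value $0$ where the limit does not exist), and for $h\in L_\infty[0,T]$ let $\mathcal Z_h(x,\cdot)$ be the version with continuous paths of the process $\mathcal Z_h(x,t)=\langle h\mathbf 1_{[0,t]},x\rangle$. The class $\mathcal S(L_2[0,T])$ consists of the functionals $F(x)=\int_{L_2[0,T]}e^{i\langle u,x\rangle}\,df(u)$, $x\in C_0[0,T]$, with $f$ a complex Borel measure on $L_2[0,T]$. Write $\mathbb C_+=\{\lambda:\operatorname{Re}\lambda>0\}$. If an integral $J(\lambda)$ over $C_0[0,T]$ of an expression in $\lambda^{-1/2}\mathcal Z$ exists for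 all $\lambda>0$ and extends analytically to $\mathbb C_+$, the extension is its analytic Wiener integral $\int^{\mathrm{anw}_\lambda}$; for real $q\neq0$ the limit as $\lambda\to -iq$, $\lambda\in\mathbb C_+$, is the analytic Feynman integral $\int^{\mathrm{anf}_q}$. Thus $T_{\lambda,h}(F)(y)$ is the analytic continuation of $\int F(y+\lambda^{-1/2}\mathcal Z_h(x,\cdot))\,d\mathfrak m(x)$. For $1<p\le 2$, $T^{(p)}_{q,h}(F)$ is the functional with $$\lim_{\lambda\to-iq,\ \lambda\in\mathbb C_+}\int|T_{\lambda,h}(F)(\rho y)-T^{(p)}_{q,h}(F)(\rho y)|^{p/(p-1)}\,d\mathfrak m(y)=0\quad\text{for every }\rho>0,$$ and $T^{(1)}_{q,h}(F)(y)=\lim_{\lambda\to-iq,\ \lambda\in\mathbb C_+}T_{\lambda,h}(F)(y)$ for s-a.e. $y$. The generalized convolution product is $$(F*G)_q^{(k_1,k_2)}(y)=\int^{\mathrm{anf}_q}F\Big(\tfrac{y+\mathcal Z_{k_1}(x,\cdot)}{\sqrt2}\Big)G\Big(\tfrac{y-\mathcal Z_{k_2}(x,\cdot)}{\sqrt2}\Big)d\mathfrak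 m(x).$$ Transforms occurring inside another transform or inside a convolution product are taken as elements of $\mathcal S(L_2[0,T])$. **Theorem 6.3.** Let $F,G\in\mathcal S(L_2[0,T])$, let $n,m\ge1$, and let $h$, $h_{11},\dots,h_{1n}$, $h_{21},\dots,h_{2m}$ be nonzero functions in $L_\infty[0,T]$. Let $q,q_1,q_{11},\dots,q_{1n},q_2,q_{21},\dots,q_{2m}$ be nonzero real numbers, all of the same sign. Put $$\alpha_{1n}=\Big(\sum_{j=1}^n\tfrac1{q_{1j}}\Big)^{-1},\quad \alpha_{2m}=\Big(\sum_{l=1}^m\tfrac1{q_{2l}}\Big)^{-1},\quad \beta_{1n}=\Big(\tfrac1{q_1}+\sum_{j=1}^n\tfrac1{q_{1j}}\Big)^{-1},\quad \beta_{2m}=\Big(\tfrac1{q_2}+\sum_{l=1}^m\tfrac1{q_{2l}}\Big)^{-1}.$$ Let $\mathbf s_1,\mathbf s_2,\mathbf v_1,\mathbf v_2\in L_\infty[0,T]$ satisfy, a.e. on $[0,T]$, $$\mathbf s_1^2=\sum_{j=1}^n\frac{\alpha_{1n}}{q_{1j}}h_{1j}^2,\qquad \mathbf s_2^2=\sum_{l=1}^m\frac{\alpha_{2m}}{q_{2l}}h_{2l}^2,\qquad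 \mathbf v_i^2=h^2+\mathbf s_i^2\ (i=1,2),$$ and assume that $h^2=\mathbf s_1\mathbf s_2$ a.e. on $[0,T]$. Put $$h_1'=\sqrt{\tfrac{q_1}{2q}}\,h,\quad h_{1j}'=\sqrt{\tfrac{\alpha_{1n}}{2q}}\,h_{1j},\quad h_2'=\sqrt{\tfrac{q_2}{2q}}\,h,\quad h_{2l}'=\sqrt{\tfrac{\alpha_{2m}}{2q}}\,h_{2l}.$$ Then for every $p\in[1,2]$ all the transforms below exist, the convolution products below exist for s-a.e. $y$, and $$\begin{aligned} &\Big(T^{(p)}_{q_1,h_1'}\big(T^{(p)}_{q_{1n},h_{1n}'}(\cdots(T^{(p)}_{q_{11},h_{11}'}(F))\cdots)\big)*T^{(p)}_{q_2,h_2'}\big(T^{(p)}_{q_{2m},h_{2m}'}(\cdots(T^{(p)}_{q_{21},h_{21}'}(G))\cdots)\big)\Big)_{-q}^{(\mathbf s_1,\mathbf s_2)}(y)\\ &=\Big(T^{(p)}_{q_1,h_1'}\big(T^{(p)}_{\alpha_{1n},\sqrt{\alpha_{1n}/(2q)}\,\mathbf s_1}(F)\big)*T^{(p)}_{q_2,h_2'}\big(T^{(p)}_{\alpha_{2m},\sqrt{\alpha_{2m}/(2q)}\,\mathbf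 s_2}(G)\big)\Big)_{-q}^{(\mathbf s_1,\mathbf s_2)}(y)\\ &=\Big(T^{(p)}_{\beta_{1n},\sqrt{\beta_{1n}/(2q)}\,\mathbf v_1}(F)*T^{(p)}_{\beta_{2m},\sqrt{\beta_{2m}/(2q)}\,\mathbf v_2}(G)\Big)_{-q}^{(\mathbf s_1,\mathbf s_2)}(y)\\ &=T^{(p)}_{q,h}\Big(F\big(\tfrac{\cdot}{\sqrt2}\big)G\big(\tfrac{\cdot}{\sqrt2}\big)\Big)(y) \end{aligned}$$ for s-a.e. $y\in C_0[0,T]$. -/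

import Mathlib

open MeasureTheory ProbabilityTheory Filter Topology

noncomputable section

namespace WienerFeynman

/-- Lebesgue measure on `[0,T]`. -/
abbrev leb (T : ℝ) : Measure ℝ := volume.restrict (Set.Icc 0 T)

/-- The real Hilbert space `L_2[0,T]`, with its Borel sigma-algebra. -/
abbrev L2 (T : ℝ) : Type := Lp ℝ 2 (leb T)

instance instMeasurableSpaceL2 (T : ℝ) : MeasurableSpace (L2 T) := borel _

instance instBorelSpaceL2 (T : ℝ) : BorelSpace (L2 T) := ⟨rfl⟩

/-- The space of continuous real functions on `[0,T]` vanishing at `0`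
(a normed space under the supremum norm). -/
def C0 (T : ℝ) : Submodule ℝ C(Set.Icc (0 : ℝ) T, ℝ) where
  carrier := {x | ∀ t : Set.Icc (0 : ℝ) T, (t : ℝ) = 0 → x t = 0}
  add_mem' := by
    intro x y hx hy t ht
    simp [hx t ht, hy t ht]
  zero_mem' := by
    intro t _
    simp
  smul_mem' := by
    intro c x hx t ht
    simp [hx t ht]

instance instMeasurableSpaceC0 (T : ℝ) : MeasurableSpace (C0 T) := borel _

instance instBorelSpaceC0 (T : ℝ) : BorelSpace (C0 T) := ⟨rfl⟩

/-- Wiener measure on `C_0[0,T]`: the law under which the coordinate process is a centred Gaussian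
process with covariance `min s t`. (It is the unique Borel measure with these properties.) -/
structure IsWienerMeasure {T : ℝ} (W : Measure (C0 T)) : Prop where
  prob : IsProbabilityMeasure W
  gaussian : IsGaussianProcess (fun (t : Set.Icc (0 : ℝ) T) (x : C0 T) => x.1 t) W
  mean : ∀ t : Set.Icc (0 : ℝ) T, ∫ x : C0 T, x.1 t ∂W = 0
  cov : ∀ s t : Set.Icc (0 : ℝ) T, ∫ x : C0 T, x.1 s * x.1 t ∂W = min (s : ℝ) (t : ℝ)

/-- The property `P` holds scale-invariant almost everywhere. -/
def SAE {T : ℝ} (W : Measure (C0 T)) (P : C0 T → Prop) : Prop :=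
  ∀ ρ : ℝ, 0 < ρ → ∀ᵐ x ∂W, P (ρ • x)

/-- Scale-invariant measurability; measurability is with respect to the completion of `W`. -/
def ScaleInvMeasurable {T : ℝ} (W : Measure (C0 T)) (F : C0 T → ℂ) : Prop :=
  ∀ ρ : ℝ, 0 < ρ → AEStronglyMeasurable (fun x => F (ρ • x)) W

/-- A complete orthonormal sequence in `L_2[0,T]` of functions of bounded variation. -/
structure IsBVBasis (T : ℝ) (φ : ℕ → ℝ → ℝ) : Prop where
  bv : ∀ j, BoundedVariationOn (φ j) (Set.Icc 0 T)
  orthonormal : ∀ i j, ∫ t, φ i t * φ j t ∂(leb T) = if i = j then 1 else 0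
  complete : ∀ u : ℝ → ℝ, MemLp u 2 (leb T) → (∀ j, ∫ t, u t * φ j t ∂(leb T) = 0) →
    u =ᵐ[leb T] 0

open Classical in
/-- The value of the path `x` at the real time `t` (used for `t ∈ [0,T]` only). -/
def pathAt {T : ℝ} (x : C0 T) (t : ℝ) : ℝ :=
  if ht : t ∈ Set.Icc (0 : ℝ) T then x.1 ⟨t, ht⟩ else 0

/-- The Riemann-Stieltjes integral of `g` with respect to the path `x` over `[0,T]`.
For `g` of bounded variation and `x` continuous it exists, so that it may be
computed along the uniform partitions of `[0,T]`. -/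
def rsIntegral {T : ℝ} (g : ℝ → ℝ) (x : C0 T) : ℝ :=
  limUnder atTop (fun n : ℕ => ∑ k ∈ Finset.range n,
    g (k * T / n) * (pathAt x ((k + 1) * T / n) - pathAt x (k * T / n)))

/-- The partial sums `∫_0^T ∑_{j < n} (u, φ_j) φ_j(t) dx(t)`. -/
def pwzSum {T : ℝ} (φ : ℕ → ℝ → ℝ) (u : ℝ → ℝ) (x : C0 T) (n : ℕ) : ℝ :=
  ∑ j ∈ Finset.range n, (∫ t, u t * φ j t ∂(leb T)) * rsIntegral (φ j) x

open Classical in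
/-- The Paley-Wiener-Zygmund stochastic integral `⟨u, x⟩`, the limit of the partial sums above;
it is given the value `0` at the exceptional `x` for which the limit does not exist. -/
def pwz {T : ℝ} (φ : ℕ → ℝ → ℝ) (u : ℝ → ℝ) (x : C0 T) : ℝ :=
  if h : ∃ l : ℝ, Tendsto (pwzSum φ u x) atTop (𝓝 l) then h.choose else 0

/-- `Z` is a measurable version with paths in `C_0[0,T]` of the Gaussian process
`(x, t) ↦ ∫_0^t h d̃x`, the stochastic integral being that of Paley, Wiener and Zygmund. -/
def IsGaussianPath {T : ℝ} (W : Measure (C0 T)) (φ : ℕ → ℝ → ℝ) (h : ℝ → ℝ)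
    (Z : C0 T → C0 T) : Prop :=
  Measurable Z ∧ ∀ t : Set.Icc (0 : ℝ) T,
    ∀ᵐ x ∂W, (Z x).1 t = pwz φ (Set.indicator (Set.Icc 0 (t : ℝ)) h) x

open Classical in
/-- The Gaussian process `Z_h`, as a map from paths to paths (two versions with continuous paths
agree almost surely). -/
def gaussianPath {T : ℝ} (W : Measure (C0 T)) (φ : ℕ → ℝ → ℝ) (h : ℝ → ℝ) : C0 T → C0 T :=
  if H : ∃ Z, IsGaussianPath W φ h Z then H.choose else fun _ => 0

/-- The open right half-plane `ℂ_+`. -/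
def rightHalf : Set ℂ := {z | 0 < z.re}

/-- The filter `λ → -iq`, `λ ∈ ℂ_+`. -/
def feynmanFilter (q : ℝ) : Filter ℂ := 𝓝[rightHalf] (-(Complex.I * (q : ℂ)))

/-- `J` is the generalized analytic Wiener integral, as a function of the parameter `λ ∈ ℂ_+`.
The integrand is given as `Φ s x`, where `s = λ^{-1/2}` is the factor that
multiplies the Gaussian process; `J` is analytic on `ℂ_+` and is the Wiener integral
for every `λ > 0`. -/
def IsAnalyticWienerIntegral {T : ℝ} (W : Measure (C0 T)) (Φ : ℝ → C0 T → ℂ) (J : ℂ → ℂ) : Prop :=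
  DifferentiableOn ℂ J rightHalf ∧
    ∀ l : ℝ, 0 < l → Integrable (Φ (√l)⁻¹) W ∧ J (l : ℂ) = ∫ x, Φ (√l)⁻¹ x ∂W

/-- `G` is (a version of) the `L_p` analytic generalized Fourier-Feynman transform
`T_{q,h}^{(p)}(F)`; the function `Tl l y` is `T_{λ,h}(F)(y)` at `λ = l`. -/
def IsGFFT {T : ℝ} (W : Measure (C0 T)) (φ : ℕ → ℝ → ℝ) (p q : ℝ) (h : ℝ → ℝ)
    (F G : C0 T → ℂ) : Prop :=
  ScaleInvMeasurable W F ∧ ScaleInvMeasurable W G ∧ ∃ Tl : ℂ → C0 T → ℂ,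
    SAE W (fun y => IsAnalyticWienerIntegral W
      (fun s x => F (y + s • gaussianPath W φ h x)) (fun l => Tl l y)) ∧
    (p = 1 → SAE W (fun y => Tendsto (fun l => Tl l y) (feynmanFilter q) (𝓝 (G y)))) ∧
    (p ≠ 1 → ∀ ρ : ℝ, 0 < ρ →
      Tendsto (fun l => ∫⁻ y, ‖Tl l (ρ • y) - G (ρ • y)‖ₑ ^ (p / (p - 1)) ∂W)
        (feynmanFilter q) (𝓝 0))

/-- The generalized convolution product `(F * G)_q^{(k₁,k₂)}` exists at `y` and has the value `c`:
the analytic Feynman integral with parameter `q` of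
`F ((y + Z_{k₁}(x)) / √2) G ((y - Z_{k₂}(x)) / √2)` is `c`. -/
def IsGCPAt {T : ℝ} (W : Measure (C0 T)) (φ : ℕ → ℝ → ℝ) (q : ℝ) (k₁ k₂ : ℝ → ℝ)
    (F G : C0 T → ℂ) (y : C0 T) (c : ℂ) : Prop :=
  ∃ J : ℂ → ℂ, IsAnalyticWienerIntegral W
      (fun s x => F ((√2)⁻¹ • (y + s • gaussianPath W φ k₁ x)) *
        G ((√2)⁻¹ • (y - s • gaussianPath W φ k₂ x))) J ∧
    Tendsto J (feynmanFilter q) (𝓝 c)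

/-- The class `𝒮(L_2[0,T])`: functionals `F(x) = ∫ exp(i⟨u,x⟩) df(u)` with `f` a complex Borel
measure on `L_2[0,T]`. Such a functional is the one given by the formula, at every path. -/
def InS {T : ℝ} (φ : ℕ → ℝ → ℝ) (F : C0 T → ℂ) : Prop :=
  ∃ f : ComplexMeasure (L2 T), ∀ x, F x =
    VectorMeasure.integral f (fun u : L2 T => Complex.exp (Complex.I * (pwz φ u x : ℂ)))
      (ContinuousLinearMap.mul ℝ ℂ)

/-- `G` is the iterated transform of `F` along a list of pairs (parameter, kernel); the pair at
the head of the list is applied first. Each transform is taken as an element of `𝒮(L_2[0,T])`. -/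
def IsIterGFFT {T : ℝ} (W : Measure (C0 T)) (φ : ℕ → ℝ → ℝ) (p : ℝ) :
    List (ℝ × (ℝ → ℝ)) → (C0 T → ℂ) → (C0 T → ℂ) → Prop
  | [], F, G => G = F
  | (q, h) :: L, F, G => ∃ F' : C0 T → ℂ,
      InS φ F' ∧ IsGFFT W φ p q h F F' ∧ IsIterGFFT W φ p L F' G

/-- A nonzero element of `L_∞[0,T]`. -/
def IsKernel (T : ℝ) (h : ℝ → ℝ) : Prop :=
  MemLp h ⊤ (leb T) ∧ ¬ h =ᵐ[leb T] 0

end WienerFeynman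

end

open WienerFeynman

open MeasureTheory ProbabilityTheory Filter Topology

noncomputable section

namespace WienerFeynman

/-! On the class `InS` every operation in the theorem becomes multiplication of a density. A
functional of the class is F(x) = ∫ κ(u) exp(i⟨u,x⟩) dμ(u) with μ a finite positive measure and κ
integrable (`InS.exists_phaseInt_eq`). Almost surely ⟨u, Z_h(x)⟩ = ⟨hu, x⟩ (`ae_pwz_gaussianPath`),
a centred normal variable of variance ‖hu‖². Averaging over λ^{-1/2} Z_h therefore multiplies κ(u)
by exp(-‖hu‖²/(2λ)). This factor is analytic in λ, bounded by 1 on the right half-plane, and tends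
to exp(-i‖hu‖²/(2q)) as λ → -iq. So a transform multiplies the density by a unimodular factor, and
successive transforms add the quadratic forms ‖hu‖²/q (`listVar`).

With the kernels of the theorem, the three lists of transforms applied to F all carry the form
(‖s₁u‖² + ‖hu‖²)/(2q), and those applied to G carry the same form with s₂. The convolution with
parameter -q contributes exp(i‖s₁u - s₂v‖²/(4q)) at the pair (u, v). Its square terms cancel those
of s₁ and s₂ in the lists. Since s₁s₂ = h², its cross term is that of h, and exp(-i‖h(u+v)‖²/(4q))
remains. This is the factor by which the transform with parameter q and kernel h acts on
F(·/√2)G(·/√2) (`rotate_convVar_rotateList`).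

Two points need real work. First, the almost sure convergence of the Paley-Wiener-Zygmund sums and
the continuous version of Z_h both come from one fourth-moment chaining argument,
`ae_exists_modulus`. Second, a transform is determined only s-a.e., while the next operation takes
it as an element of the class. No ambiguity results, because an element of the class is determined
by its values almost everywhere (`phaseInt_eq_of_ae_eq`): integrating against exp(-i⟨v,x⟩) yields
the Gaussian averages of its density around every v, and these determine the density. Hence iterated
transforms have exactly one value (`IsIterGFFT.eq_phaseInt`). -/

/-! ### Analytic dependence of integrals on a complex parameter. -/

lemma differentiableOn_integral_of_bound {E : Type*} [MeasurableSpace E] {μ : Measure E}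
    {U : Set ℂ} (hU : IsOpen U) {g : ℂ → E → ℂ} {bound : E → ℝ} (hb : Integrable bound μ)
    (hm : ∀ z ∈ U, AEStronglyMeasurable (g z) μ)
    (hd : ∀ w, DifferentiableOn ℂ (fun z => g z w) U)
    (hle : ∀ w, ∀ z ∈ U, ‖g z w‖ ≤ bound w) :
    DifferentiableOn ℂ (fun z => ∫ w, g z w ∂μ) U := by
  intro z₀ hz₀
  obtain ⟨ε, hε, hball⟩ := Metric.isOpen_iff.1 hU z₀ hz₀
  set δ := ε / 2 with hδ
  have hδ0 : 0 < δ := by positivity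
  have hmem : ∀ z ∈ Metric.ball z₀ δ, Metric.closedBall z (δ / 2) ⊆ Metric.ball z₀ ε := by
    intro z hz y hy
    have h1 := Metric.mem_ball.1 hz
    have h2 := Metric.mem_closedBall.1 hy
    refine Metric.mem_ball.2 ?_
    have := dist_triangle y z z₀
    linarith
  have hdat : ∀ w, ∀ z ∈ U, HasDerivAt (fun z => g z w) (deriv (fun z => g z w) z) z :=
    fun w z hz => ((hd w).differentiableAt (hU.mem_nhds hz)).hasDerivAt
  have hint : Integrable (g z₀) μ :=
    hb.mono' (hm z₀ hz₀) (ae_of_all _ fun w => hle w z₀ hz₀)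
  -- The bound on the derivative is Cauchy's estimate on circles of radius δ/2, which stay inside
  -- the ball of radius ε = 2δ.
  refine (hasDerivAt_integral_of_dominated_loc_of_deriv_le (bound := fun w => bound w / (δ / 2))
    (F' := fun z w => deriv (fun z => g z w) z) (Metric.ball_mem_nhds z₀ hδ0) ?_ hint ?_ ?_
    (hb.div_const _) ?_).2.differentiableAt.differentiableWithinAt
  · filter_upwards [hU.mem_nhds hz₀] with z hz using hm z hz
  -- The derivative at z₀ is measurable in w as the limit of difference quotients along z₀ +
  -- δ/(n+1).
  · have hseq : ∀ n : ℕ, z₀ + ((δ / (n + 1) : ℝ) : ℂ) ∈ U := by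
      intro n
      apply hball
      rw [Metric.mem_ball, dist_eq_norm]
      simp only [add_sub_cancel_left, Complex.norm_real, Real.norm_eq_abs]
      rw [abs_of_pos (by positivity)]
      calc δ / (n + 1) ≤ δ := div_le_self hδ0.le (by linarith [Nat.cast_nonneg (α := ℝ) n])
        _ < ε := by rw [hδ]; linarith
    have hmn : ∀ n : ℕ, AEStronglyMeasurable (fun w => ((δ / (n + 1) : ℝ) : ℂ)⁻¹ •
        (g (z₀ + ((δ / (n + 1) : ℝ) : ℂ)) w - g z₀ w)) μ := fun n =>
      ((hm _ (hseq n)).sub (hm z₀ hz₀)).const_smul (((δ / (n + 1) : ℝ) : ℂ)⁻¹)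
    refine aestronglyMeasurable_of_tendsto_ae atTop hmn ?_
    · refine ae_of_all _ fun w => ?_
      have h1 := (hdat w z₀ hz₀).tendsto_slope_zero
      refine h1.comp ?_
      refine tendsto_nhdsWithin_iff.2 ⟨?_, ?_⟩
      · have : Tendsto (fun n : ℕ => δ / ((n : ℝ) + 1)) atTop (𝓝 0) := by
          have := (tendsto_one_div_add_atTop_nhds_zero_nat (𝕜 := ℝ)).const_mul δ
          simpa [mul_one_div, div_eq_mul_inv] using this
        have h3 := (Complex.continuous_ofReal.tendsto 0).comp this
        rw [Complex.ofReal_zero] at h3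
        exact h3
      · refine Eventually.of_forall fun n => ?_
        simp only [Set.mem_compl_iff, Set.mem_singleton_iff, Complex.ofReal_eq_zero]
        positivity
  · refine ae_of_all _ fun w z hz => ?_
    refine Complex.norm_deriv_le_of_forall_mem_sphere_norm_le (by positivity) ?_ ?_
    · refine DifferentiableOn.diffContOnCl ?_
      refine (hd w).mono ?_
      exact (Metric.closure_ball_subset_closedBall).trans ((hmem z hz).trans hball)
    · intro y hy
      exact hle w y (hball (hmem z hz (Metric.sphere_subset_closedBall hy)))
  · refine ae_of_all _ fun w z hz => hdat w z (hball ?_)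
    exact Metric.ball_subset_ball (by rw [hδ]; linarith) hz

/-! ### Complex measures as densities, and Fourier and Gaussian uniqueness on a Hilbert space. -/

section ComplexMeasure

variable {X : Type*} [MeasurableSpace X]

/-- Real and imaginary parts are both absolutely continuous with respect to the sum of their total
variations, so Radon-Nikodym applies to each. Afterwards only scalar integrals against a finite
positive measure occur. -/
lemma exists_withDensity_eq (f : ComplexMeasure X) :
    ∃ (μ : Measure X) (κ : X → ℂ), IsFiniteMeasure μ ∧ Integrable κ μ ∧ f = μ.withDensityᵥ κ := by
  set a := ComplexMeasure.re f with ha_def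
  set b := ComplexMeasure.im f with hb_def
  set μ : Measure X := a.totalVariation + b.totalVariation with hμ
  have : IsFiniteMeasure a.totalVariation := by
    unfold SignedMeasure.totalVariation; infer_instance
  have : IsFiniteMeasure b.totalVariation := by
    unfold SignedMeasure.totalVariation; infer_instance
  have ha : μ.withDensityᵥ (a.rnDeriv μ) = a := by
    refine SignedMeasure.withDensityᵥ_rnDeriv_eq a μ
      (VectorMeasure.AbsolutelyContinuous.mk fun S hS h => ?_)
    rw [Measure.toENNRealVectorMeasure_apply_measurable hS, hμ, Measure.add_apply,
      add_eq_zero] at h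
    exact a.null_of_totalVariation_zero h.1
  have hb : μ.withDensityᵥ (b.rnDeriv μ) = b := by
    refine SignedMeasure.withDensityᵥ_rnDeriv_eq b μ
      (VectorMeasure.AbsolutelyContinuous.mk fun S hS h => ?_)
    rw [Measure.toENNRealVectorMeasure_apply_measurable hS, hμ, Measure.add_apply,
      add_eq_zero] at h
    exact b.null_of_totalVariation_zero h.2
  have hia := (SignedMeasure.integrable_rnDeriv a μ)
  have hib := (SignedMeasure.integrable_rnDeriv b μ)
  have hint : Integrable (fun x => (a.rnDeriv μ x : ℂ) + (b.rnDeriv μ x : ℂ) * Complex.I) μ :=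
    hia.ofReal.add (hib.ofReal.mul_const _)
  refine ⟨μ, _, inferInstance, hint, ?_⟩
  ext S hS
  have hadd : ∫ x in S, ((a.rnDeriv μ x : ℂ) + (b.rnDeriv μ x : ℂ) * Complex.I) ∂μ =
      ∫ x in S, (a.rnDeriv μ x : ℂ) ∂μ + ∫ x in S, (b.rnDeriv μ x : ℂ) * Complex.I ∂μ :=
    integral_add hia.ofReal.integrableOn (hib.ofReal.mul_const Complex.I).integrableOn
  rw [withDensityᵥ_apply hint hS, hadd, integral_mul_const, integral_complex_ofReal, integral_complex_ofReal,
    ← withDensityᵥ_apply hia hS, ← withDensityᵥ_apply hib hS, ha, hb]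
  simp only [ha_def, hb_def, ComplexMeasure.re_apply, ComplexMeasure.im_apply]
  exact (Complex.re_add_im _).symm

lemma integral_withDensityᵥ {μ : Measure X} [IsFiniteMeasure μ] {κ : X → ℂ} (hκ : Integrable κ μ)
    {g : X → ℂ} (hg : Measurable g) {C : ℝ} (hC : ∀ x, ‖g x‖ ≤ C) :
    VectorMeasure.integral (μ.withDensityᵥ κ) g (ContinuousLinearMap.mul ℝ ℂ) =
      ∫ x, κ x * g x ∂μ := by
  have : IsFiniteMeasure (μ.withDensityᵥ κ).variation := by
    rw [Measure.variation_withDensityᵥ hκ]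
    exact isFiniteMeasure_withDensity hκ.2.ne
  have hsimple : ∀ s : SimpleFunc X ℂ,
      VectorMeasure.integral (μ.withDensityᵥ κ) s (ContinuousLinearMap.mul ℝ ℂ) =
        ∫ x, κ x * s x ∂μ := by
    intro s
    induction s using SimpleFunc.induction with
    | @const c S hS =>
      have hind : ⇑(SimpleFunc.piecewise S hS (SimpleFunc.const X c) (SimpleFunc.const X 0)) =
          S.indicator fun _ => c := by
        ext x
        by_cases hx : x ∈ S <;> simp [hx]
      rw [hind, VectorMeasure.integral_eq_setToFun,
        setToFun_indicator_const _ hS (measure_ne_top _ _)]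
      have h2 : (fun x => κ x * S.indicator (fun _ => c) x) = S.indicator fun x => κ x * c := by
        ext x
        by_cases hx : x ∈ S <;> simp [hx]
      rw [h2, integral_indicator hS, integral_mul_const, ← withDensityᵥ_apply hκ hS, mul_comm]
      rfl
    | @add s t _ hs ht =>
      have hi : ∀ s : SimpleFunc X ℂ, Integrable s (μ.withDensityᵥ κ).variation :=
        fun s => SimpleFunc.integrable_of_isFiniteMeasure s
      have hi' : ∀ s : SimpleFunc X ℂ, Integrable (fun x => κ x * s x) μ := fun s => by
        obtain ⟨C, hC⟩ := s.exists_forall_norm_le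
        exact hκ.mul_bdd (c := C) s.aestronglyMeasurable (ae_of_all _ hC)
      rw [SimpleFunc.coe_add, VectorMeasure.integral_add (hi s) (hi t), hs, ht,
        ← integral_add (hi' s) (hi' t)]
      simp [mul_add]
  have hsm := hg.stronglyMeasurable
  have hb : ∀ n x, ‖hsm.approxBounded C n x‖ ≤ C := fun n x =>
    hsm.norm_approxBounded_le (((norm_nonneg _).trans (hC x))) n x
  have hlim : ∀ x, Tendsto (fun n => hsm.approxBounded C n x) atTop (𝓝 (g x)) := fun x =>
    hsm.tendsto_approxBounded_of_norm_le (hC x)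
  have h1 : Tendsto (fun n => VectorMeasure.integral (μ.withDensityᵥ κ) (hsm.approxBounded C n)
      (ContinuousLinearMap.mul ℝ ℂ)) atTop
      (𝓝 (VectorMeasure.integral (μ.withDensityᵥ κ) g (ContinuousLinearMap.mul ℝ ℂ))) :=
    VectorMeasure.tendsto_integral_filter_of_norm_le_const
      (Eventually.of_forall fun n => SimpleFunc.aestronglyMeasurable _)
      ⟨C, Eventually.of_forall fun n => ae_of_all _ (hb n)⟩ (ae_of_all _ hlim)
  have h2 : Tendsto (fun n => ∫ x, κ x * hsm.approxBounded C n x ∂μ) atTop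
      (𝓝 (∫ x, κ x * g x ∂μ)) := by
    refine tendsto_integral_of_dominated_convergence (fun x => ‖κ x‖ * C)
      (fun n => hκ.1.mul (SimpleFunc.aestronglyMeasurable _)) (hκ.norm.mul_const C)
      (fun n => ae_of_all _ fun x => ?_) (ae_of_all _ fun x => (hlim x).const_mul _)
    rw [norm_mul]
    exact mul_le_mul_of_nonneg_left (hb n x) (norm_nonneg _)
  refine tendsto_nhds_unique h1 ?_
  simp_rw [hsimple]
  exact h2

/-- The positive and negative parts of r are densities of two finite measures with the same
characteristic function, which are therefore equal. -/
lemma ae_eq_zero_of_charFun_eq_zero_real {H : Type*} [NormedAddCommGroup H]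
    [InnerProductSpace ℝ H]
    [CompleteSpace H] [SecondCountableTopology H] [MeasurableSpace H] [BorelSpace H]
    {μ : Measure H} [IsFiniteMeasure μ] {r : H → ℝ} (hr : Integrable r μ)
    (h0 : ∀ v : H, ∫ u, (r u : ℂ) * Complex.exp (inner ℝ u v * Complex.I) ∂μ = 0) :
    r =ᵐ[μ] 0 := by
  set p : H → NNReal := fun u => (r u).toNNReal
  set n : H → NNReal := fun u => (-r u).toNNReal
  have hpm : AEMeasurable p μ := hr.1.aemeasurable.real_toNNReal
  have hnm : AEMeasurable n μ := hr.1.aemeasurable.neg.real_toNNReal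
  have hpf : IsFiniteMeasure (μ.withDensity fun u => (p u : ENNReal)) :=
    isFiniteMeasure_withDensity_ofReal hr.2
  have hnf : IsFiniteMeasure (μ.withDensity fun u => (n u : ENNReal)) :=
    isFiniteMeasure_withDensity_ofReal hr.neg.2
  have hexp : ∀ v u : H, ‖Complex.exp ((inner ℝ u v : ℝ) * Complex.I)‖ ≤ 1 := fun v u =>
    (Complex.norm_exp_ofReal_mul_I _).le
  have hem : ∀ v : H, AEStronglyMeasurable
      (fun u : H => Complex.exp ((inner ℝ u v : ℝ) * Complex.I)) μ := fun v =>
    Continuous.aestronglyMeasurable (by fun_prop)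
  have heq : (μ.withDensity fun u => (p u : ENNReal)) = μ.withDensity fun u => (n u : ENNReal) := by
    refine Measure.ext_of_charFun ?_
    ext v
    rw [charFun_apply, charFun_apply, integral_withDensity_eq_integral_smul₀ hpm,
      integral_withDensity_eq_integral_smul₀ hnm, ← sub_eq_zero, ← integral_sub]
    · rw [← h0 v]
      congr 1 with u
      have : ((p u : ℝ) : ℂ) - ((n u : ℝ) : ℂ) = (r u : ℂ) := by
        rw [← Complex.ofReal_sub]
        congr 1
        simp only [p, n, Real.coe_toNNReal']
        exact max_zero_sub_eq_self (r u)
      rw [← this]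
      simp only [NNReal.smul_def, Complex.real_smul]
      ring
    · simpa only [NNReal.smul_def, Complex.real_smul, p, n] using!
        (hr.real_toNNReal.ofReal (𝕜 := ℂ)).mul_bdd (c := 1) (hem v) (ae_of_all _ (hexp v))
    · simpa only [NNReal.smul_def, Complex.real_smul, p, n] using!
        (hr.neg.real_toNNReal.ofReal (𝕜 := ℂ)).mul_bdd (c := 1) (hem v) (ae_of_all _ (hexp v))
  have hpn := (withDensity_eq_iff_of_sigmaFinite (μ := μ) hpm.coe_nnreal_ennreal
    hnm.coe_nnreal_ennreal).1 heq
  filter_upwards [hpn] with u hu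
  have hu' : p u = n u := by exact_mod_cast hu
  have hu'' := congrArg NNReal.toReal hu'
  simp only [p, n, Real.coe_toNNReal'] at hu''
  have := max_zero_sub_eq_self (r u)
  simp only [Pi.zero_apply]
  linarith

/-- Conjugating the hypothesis at -v shows that the conjugate of κ has vanishing transform too,
which separates real and imaginary parts. -/
lemma ae_eq_zero_of_charFun_eq_zero {H : Type*} [NormedAddCommGroup H] [InnerProductSpace ℝ H]
    [CompleteSpace H] [SecondCountableTopology H] [MeasurableSpace H] [BorelSpace H]
    {μ : Measure H} [IsFiniteMeasure μ] {κ : H → ℂ} (hκ : Integrable κ μ)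
    (h0 : ∀ v : H, ∫ u, κ u * Complex.exp (inner ℝ u v * Complex.I) ∂μ = 0) :
    κ =ᵐ[μ] 0 := by
  have hconj : ∀ v : H,
      ∫ u, (starRingEnd ℂ) (κ u) * Complex.exp (inner ℝ u v * Complex.I) ∂μ = 0 := by
    intro v
    have := congrArg (starRingEnd ℂ) (h0 (-v))
    rw [← integral_conj, map_zero] at this
    rw [← this]
    congr 1 with u
    rw [map_mul, ← Complex.exp_conj]
    simp
  have hi : ∀ (κ : H → ℂ), Integrable κ μ → ∀ v : H,
      Integrable (fun u => κ u * Complex.exp (inner ℝ u v * Complex.I)) μ := fun κ hκ v =>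
    hκ.mul_bdd (c := 1) (Continuous.aestronglyMeasurable (by fun_prop))
      (ae_of_all _ fun u => (Complex.norm_exp_ofReal_mul_I _).le)
  have hκc : Integrable (fun u => (starRingEnd ℂ) (κ u)) μ := by
    exact hκ.mono (Complex.continuous_conj.comp_aestronglyMeasurable hκ.1)
      (ae_of_all _ fun u => by simp)
  have hre := ae_eq_zero_of_charFun_eq_zero_real (r := fun u => (κ u).re) hκ.re fun v => by
    have : ∀ u, (((κ u).re : ℝ) : ℂ) * Complex.exp (inner ℝ u v * Complex.I) =
        (1 / 2) * (κ u * Complex.exp (inner ℝ u v * Complex.I) +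
        (starRingEnd ℂ) (κ u) * Complex.exp (inner ℝ u v * Complex.I)) := fun u => by
      rw [Complex.re_eq_add_conj]; ring
    simp_rw [this]
    rw [integral_const_mul, integral_add (hi _ hκ v) (hi _ hκc v), h0, hconj]
    simp
  have him := ae_eq_zero_of_charFun_eq_zero_real (r := fun u => (κ u).im) hκ.im fun v => by
    have : ∀ u, (((κ u).im : ℝ) : ℂ) * Complex.exp (inner ℝ u v * Complex.I) =
        (1 / (2 * Complex.I)) * (κ u * Complex.exp (inner ℝ u v * Complex.I) -
        (starRingEnd ℂ) (κ u) * Complex.exp (inner ℝ u v * Complex.I)) := fun u => by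
      rw [Complex.im_eq_sub_conj]; ring
    simp_rw [this]
    rw [integral_const_mul, integral_sub (hi _ hκ v) (hi _ hκc v), h0, hconj]
    simp
  filter_upwards [hre, him] with u h1 h2
  exact Complex.ext h1 h2

/-- Expanding ‖u - v‖² shows that z ↦ ∫ κ(u) exp(-‖u‖²/2 + z⟨u,v⟩) dμ vanishes for real z. It is
analytic, so it vanishes at z = i as well, and there it is the Fourier transform of κ exp(-‖·‖²/2).
-/
lemma ae_eq_zero_of_integral_gaussian_eq_zero {H : Type*} [NormedAddCommGroup H]
    [InnerProductSpace ℝ H]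
    [CompleteSpace H] [SecondCountableTopology H] [MeasurableSpace H] [BorelSpace H]
    {μ : Measure H} [IsFiniteMeasure μ] {κ : H → ℂ} (hκ : Integrable κ μ)
    (h0 : ∀ v : H, ∫ u, κ u * Complex.exp ((-(‖u - v‖ ^ 2 / 2) : ℝ) : ℂ) ∂μ = 0) :
    κ =ᵐ[μ] 0 := by
  have hnorm : ∀ (v u : H) (z : ℂ), ‖Complex.exp ((-(‖u‖ ^ 2 / 2) : ℝ) + z * (inner ℝ u v : ℝ))‖ ≤
      Real.exp (‖z‖ ^ 2 * ‖v‖ ^ 2 / 2) := by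
    intro v u z
    rw [Complex.norm_exp]
    refine Real.exp_le_exp.2 ?_
    have h1 : (((-(‖u‖ ^ 2 / 2) : ℝ) : ℂ) + z * (inner ℝ u v : ℝ)).re =
        -(‖u‖ ^ 2 / 2) + z.re * inner ℝ u v := by simp [-Complex.ofReal_pow]
    have h2 : z.re * inner ℝ u v ≤ ‖z‖ * (‖u‖ * ‖v‖) := by
      refine (le_abs_self _).trans ?_
      rw [abs_mul]
      exact mul_le_mul (Complex.abs_re_le_norm z) (abs_real_inner_le_norm u v) (abs_nonneg _)
        (norm_nonneg _)
    rw [h1]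
    nlinarith [sq_nonneg (‖u‖ - ‖z‖ * ‖v‖)]
  have hmeas : ∀ (v : H) (z : ℂ), AEStronglyMeasurable (fun u : H =>
      Complex.exp ((-(‖u‖ ^ 2 / 2) : ℝ) + z * (inner ℝ u v : ℝ))) μ := fun v z =>
    Continuous.aestronglyMeasurable (by fun_prop)
  have hreal : ∀ (v : H) (t : ℝ), ∫ u, κ u *
      Complex.exp ((-(‖u‖ ^ 2 / 2) : ℝ) + (t : ℂ) * (inner ℝ u v : ℝ)) ∂μ = 0 := by
    intro v t
    have h1 : ∀ u, κ u * Complex.exp ((-(‖u‖ ^ 2 / 2) : ℝ) + (t : ℂ) * (inner ℝ u v : ℝ)) =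
        Complex.exp ((‖t • v‖ ^ 2 / 2 : ℝ) : ℂ) *
          (κ u * Complex.exp ((-(‖u - t • v‖ ^ 2 / 2) : ℝ) : ℂ)) := by
      intro u
      rw [mul_left_comm, ← Complex.exp_add]
      congr 2
      rw [norm_sub_sq_real, inner_smul_right]
      push_cast
      ring
    simp_rw [h1]
    rw [integral_const_mul, h0, mul_zero]
  set κ' : H → ℂ := fun u => κ u * Complex.exp ((-(‖u‖ ^ 2 / 2) : ℝ) : ℂ) with hκ'
  have hκ'i : Integrable κ' μ := by
    refine hκ.mul_bdd (c := 1) (Continuous.aestronglyMeasurable (by fun_prop))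
      (ae_of_all _ fun u => ?_)
    simpa using hnorm 0 u 0
  have hz : κ' =ᵐ[μ] 0 := by
    refine ae_eq_zero_of_charFun_eq_zero hκ'i fun v => ?_
    -- Radius 2 only has to make the ball contain both 0, where the zeros accumulate, and i.
    have hd : DifferentiableOn ℂ (fun z => ∫ u, κ u *
        Complex.exp ((-(‖u‖ ^ 2 / 2) : ℝ) + z * (inner ℝ u v : ℝ)) ∂μ) (Metric.ball 0 2) := by
      refine differentiableOn_integral_of_bound Metric.isOpen_ball
        (bound := fun u => ‖κ u‖ * Real.exp (2 ^ 2 * ‖v‖ ^ 2 / 2)) (hκ.norm.mul_const _)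
        (fun z _ => hκ.1.mul (hmeas v z)) (fun u => by fun_prop) (fun u z hz => ?_)
      rw [norm_mul]
      refine mul_le_mul_of_nonneg_left ((hnorm v u z).trans ?_) (norm_nonneg _)
      have hz2 : ‖z‖ ≤ 2 := by simpa using (Metric.mem_ball.1 hz).le
      gcongr
    have hfreq : ∃ᶠ z in 𝓝[≠] (0 : ℂ), (fun z => ∫ u, κ u *
        Complex.exp ((-(‖u‖ ^ 2 / 2) : ℝ) + z * (inner ℝ u v : ℝ)) ∂μ) z = 0 := by
      have ht : Tendsto (fun n : ℕ => (((1 / ((n : ℝ) + 1)) : ℝ) : ℂ)) atTop (𝓝[≠] 0) := by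
        refine tendsto_nhdsWithin_iff.2 ⟨?_, Eventually.of_forall fun n => ?_⟩
        · have h3 := (Complex.continuous_ofReal.tendsto 0).comp
            (tendsto_one_div_add_atTop_nhds_zero_nat (𝕜 := ℝ))
          rw [Complex.ofReal_zero] at h3
          exact h3
        · simp only [Set.mem_compl_iff, Set.mem_singleton_iff, Complex.ofReal_eq_zero]
          positivity
      exact ht.frequently (Frequently.of_forall fun n => hreal v _)
    have hzero := (hd.analyticOnNhd Metric.isOpen_ball).eqOn_zero_of_preconnected_of_frequently_eq_zero
      (convex_ball (0 : ℂ) 2).isPreconnected (Metric.mem_ball_self two_pos) hfreq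
    have hI := hzero (x := Complex.I) (by simp)
    simp only [Pi.zero_apply] at hI
    rw [← hI]
    congr 1 with u
    rw [hκ', mul_assoc, ← Complex.exp_add, mul_comm Complex.I]
  filter_upwards [hz] with u hu
  simpa [hκ', Complex.exp_ne_zero] using hu

end ComplexMeasure

/-! ### Chaining: a modulus of continuity from fourth moments. -/

section Chaining

variable {Ω : Type*} [MeasurableSpace Ω] {P : Measure Ω}

lemma ae_tendsto_zero_of_tsum_lintegral_ne_top {f : ℕ → Ω → ENNReal}
    (hf : ∀ r, AEMeasurable (f r) P) (h : ∑' r, ∫⁻ ω, f r ω ∂P ≠ ⊤) :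
    ∀ᵐ ω ∂P, Tendsto (fun r => f r ω) atTop (𝓝 0) := by
  rw [← lintegral_tsum hf] at h
  filter_upwards [ae_lt_top' (AEMeasurable.tsum hf) h] with ω hω
  exact ENNReal.tendsto_atTop_zero_of_tsum_ne_top hω.ne

/-- With weights (3/2)^r the expectations are still at most a multiple of (3/4)^r. The weighted
series is thus almost surely finite, and its sum serves as A. -/
lemma ae_le_geometric_of_lintegral_le {f : ℕ → Ω → ℝ} (hf : ∀ r, AEMeasurable (f r) P)
    {C : ℝ} (h : ∀ r, ∫⁻ ω, ENNReal.ofReal (f r ω) ∂P ≤ ENNReal.ofReal (C * (1 / 2) ^ r)) :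
    ∀ᵐ ω ∂P, ∃ A : ℝ, 0 ≤ A ∧ ∀ r, f r ω ≤ A * (2 / 3 : ℝ) ^ r := by
  have hsum : ∑' r : ℕ, ∫⁻ ω, ENNReal.ofReal ((3 / 2 : ℝ) ^ r) * ENNReal.ofReal (f r ω) ∂P ≠ ⊤ := by
    have hle : ∀ r : ℕ, ∫⁻ ω, ENNReal.ofReal ((3 / 2 : ℝ) ^ r) * ENNReal.ofReal (f r ω) ∂P ≤
        ENNReal.ofReal (C * (3 / 4 : ℝ) ^ r) := by
      intro r
      rw [lintegral_const_mul' _ _ ENNReal.ofReal_ne_top]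
      refine (mul_le_mul_right (h r) _).trans ?_
      rw [← ENNReal.ofReal_mul (by positivity)]
      refine ENNReal.ofReal_le_ofReal (le_of_eq ?_)
      rw [mul_left_comm, ← mul_pow]
      norm_num
    refine ne_top_of_le_ne_top ?_ (ENNReal.tsum_le_tsum hle)
    have hs : Summable fun r : ℕ => |C| * (3 / 4 : ℝ) ^ r :=
      (summable_geometric_of_lt_one (by norm_num) (by norm_num)).mul_left _
    refine ne_top_of_le_ne_top hs.tsum_ofReal_ne_top (ENNReal.tsum_le_tsum fun r => ?_)
    exact ENNReal.ofReal_le_ofReal (mul_le_mul_of_nonneg_right (le_abs_self C) (by positivity))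
  have hm : ∀ r : ℕ, AEMeasurable
      (fun ω => ENNReal.ofReal ((3 / 2 : ℝ) ^ r) * ENNReal.ofReal (f r ω)) P :=
    fun r => (hf r).ennreal_ofReal.const_mul _
  rw [← lintegral_tsum hm] at hsum
  filter_upwards [ae_lt_top' (AEMeasurable.tsum hm) hsum] with ω hω
  refine ⟨(∑' r : ℕ, ENNReal.ofReal ((3 / 2 : ℝ) ^ r) * ENNReal.ofReal (f r ω)).toReal,
    ENNReal.toReal_nonneg, fun r => ?_⟩
  have h1 := ENNReal.le_tsum (f := fun r : ℕ =>
    ENNReal.ofReal ((3 / 2 : ℝ) ^ r) * ENNReal.ofReal (f r ω)) r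
  have h2 := ENNReal.toReal_mono hω.ne h1
  rw [← ENNReal.ofReal_mul (by positivity)] at h2
  have h3 := (Real.le_coe_toNNReal _).trans h2
  have h4 : (2 / 3 : ℝ) ^ r * ((3 / 2 : ℝ) ^ r * f r ω) = f r ω := by
    rw [← mul_assoc, ← mul_pow]; norm_num
  rw [← h4, mul_comm]
  exact mul_le_mul_of_nonneg_right h3 (by positivity)

/-- The deterministic half of chaining. `rep r c` is a chosen index in the dyadic cell c of level r.
Telescoping over the levels reaches y i from its representative at level r at geometric cost, and
two indices with |τ i - τ j| < 2^{-r} lie in equal or adjacent cells. -/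
lemma exists_modulus_of_geometric {ι : Type*} {τ : ι → ℝ} (hτ : ∀ i, τ i ∈ Set.Icc (0 : ℝ) 1)
    {y : ι → ℝ} {rep : ℕ → ℕ → ι}
    (hrep : ∀ r i, ⌊(2 : ℝ) ^ r * τ (rep r ⌊(2 : ℝ) ^ r * τ i⌋₊)⌋₊ = ⌊(2 : ℝ) ^ r * τ i⌋₊)
    {A x : ℝ} (hx0 : 0 ≤ x) (hx1 : x < 1)
    (hstep : ∀ r i, |y (rep r ⌊(2 : ℝ) ^ r * τ i⌋₊) - y (rep (r + 1) ⌊(2 : ℝ) ^ (r + 1) * τ i⌋₊)|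
      ≤ A * x ^ r)
    (hadj : ∀ r c, |τ (rep r c) - τ (rep r (c + 1))| ≤ 2 / 2 ^ r →
      |y (rep r c) - y (rep r (c + 1))| ≤ A * x ^ r)
    (hlim : ∀ i, Tendsto (fun r => y (rep r ⌊(2 : ℝ) ^ r * τ i⌋₊)) atTop (𝓝 (y i))) :
    ∀ ε > 0, ∃ δ > 0, ∀ i j, |τ i - τ j| < δ → |y i - y j| < ε := by
  have hx1' : 0 < 1 - x := by linarith
  have hdist : ∀ r i, |y (rep r ⌊(2 : ℝ) ^ r * τ i⌋₊) - y i| ≤ A * x ^ r / (1 - x) := by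
    intro r i
    exact dist_le_of_le_geometric_of_tendsto (r := x) (C := A) hx1
      (fun n => by rw [Real.dist_eq]; exact hstep n i) (hlim i) r
  have hA : ∀ r, 0 ≤ A * x ^ r ∨ IsEmpty ι := fun r => by
    rcases isEmpty_or_nonempty ι with h | ⟨⟨i⟩⟩
    · exact Or.inr h
    · exact Or.inl ((abs_nonneg _).trans (hstep r i))
  have hkey : ∀ r i j, ⌊(2 : ℝ) ^ r * τ i⌋₊ ≤ ⌊(2 : ℝ) ^ r * τ j⌋₊ → |τ i - τ j| < 1 / 2 ^ r →
      |y i - y j| ≤ 2 * (A * x ^ r / (1 - x)) + A * x ^ r := by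
    intro r i j hle hij
    have h2 : (0 : ℝ) < 2 ^ r := by positivity
    have hi0 : 0 ≤ (2 : ℝ) ^ r * τ i := mul_nonneg h2.le (hτ i).1
    have hj0 : 0 ≤ (2 : ℝ) ^ r * τ j := mul_nonneg h2.le (hτ j).1
    have h3 : |y (rep r ⌊(2 : ℝ) ^ r * τ i⌋₊) - y (rep r ⌊(2 : ℝ) ^ r * τ j⌋₊)| ≤ A * x ^ r := by
      rcases hle.eq_or_lt with h | h
      · rw [h, sub_self, abs_zero]
        rcases hA r with h' | h'
        · exact h'
        · exact h'.elim i
      · have h4 : ⌊(2 : ℝ) ^ r * τ j⌋₊ = ⌊(2 : ℝ) ^ r * τ i⌋₊ + 1 := by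
          refine le_antisymm ?_ h
          have h5 := Nat.floor_le hj0
          have h6 := Nat.lt_floor_add_one ((2 : ℝ) ^ r * τ i)
          have h7 : (2 : ℝ) ^ r * τ j - 2 ^ r * τ i < 1 := by
            rw [← mul_sub, ← lt_div_iff₀' h2]
            exact (le_abs_self _).trans_lt (by rwa [abs_sub_comm])
          have h8 : (⌊(2 : ℝ) ^ r * τ j⌋₊ : ℝ) < ((⌊(2 : ℝ) ^ r * τ i⌋₊ + 2 : ℕ) : ℝ) := by
            push_cast; linarith
          have h9 : ⌊(2 : ℝ) ^ r * τ j⌋₊ < ⌊(2 : ℝ) ^ r * τ i⌋₊ + 2 := by exact_mod_cast h8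
          omega
        have h5 := hrep r i
        have h6 := hrep r j
        rw [h4] at h6 ⊢
        refine hadj r _ ?_
        have h7 := (Nat.floor_eq_iff (mul_nonneg h2.le (hτ _).1)).1 h5
        have h8 := (Nat.floor_eq_iff (mul_nonneg h2.le (hτ _).1)).1 h6
        push_cast at h8
        rw [le_div_iff₀ h2, ← abs_of_pos h2, ← abs_mul, abs_of_pos h2, sub_mul, abs_le]
        constructor <;> linarith [h7.1, h7.2, h8.1, h8.2]
    have h7 := hdist r i
    have h8 := hdist r j
    rw [abs_le] at *
    constructor <;> linarith
  intro ε hε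
  have ht : Tendsto (fun r : ℕ => 2 * (A * x ^ r / (1 - x)) + A * x ^ r) atTop (𝓝 0) := by
    have h1 := (tendsto_pow_atTop_nhds_zero_of_lt_one hx0 hx1).const_mul A
    have h2 := ((h1.div_const (1 - x)).const_mul 2).add h1
    simpa using h2
  obtain ⟨r, hr⟩ := (ht.eventually (gt_mem_nhds hε)).exists
  refine ⟨1 / 2 ^ r, by positivity, fun i j hij => lt_of_le_of_lt ?_ hr⟩
  rcases le_total ⌊(2 : ℝ) ^ r * τ i⌋₊ ⌊(2 : ℝ) ^ r * τ j⌋₊ with h | h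
  · exact hkey r i j h hij
  · rw [abs_sub_comm] at hij ⊢
    exact hkey r j i h hij

/-- The Kolmogorov-Chentsov argument. Level r has of order 2^r increments, each with fourth moment
of order 4^{-r}, so the sum of their fourth powers has expectation of order 2^{-r}. The index set is
countable with an arbitrary clock τ, so that the result covers continuity of paths as well as
convergence of sequences. -/
theorem ae_exists_modulus {ι : Type*} [Countable ι] {τ : ι → ℝ}
    (hτ : ∀ i, τ i ∈ Set.Icc (0 : ℝ) 1) {Y : ι → Ω → ℝ} (hY : ∀ i, AEMeasurable (Y i) P) {K : ℝ}
    (hK : ∀ i j, ∫⁻ ω, ENNReal.ofReal ((Y i ω - Y j ω) ^ 4) ∂P ≤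
      ENNReal.ofReal (K * (τ i - τ j) ^ 2)) :
    ∀ᵐ ω ∂P, ∀ ε > 0, ∃ δ > 0, ∀ i j, |τ i - τ j| < δ → |Y i ω - Y j ω| < ε := by
  rcases isEmpty_or_nonempty ι with hι | ⟨⟨i₀⟩⟩
  · exact ae_of_all _ fun ω ε hε => ⟨1, one_pos, fun i => hι.elim i⟩
  -- For negative K the truncation in `ENNReal.ofReal` makes the bound 0, so K = 0 is admissible
  -- too.
  wlog hK0 : 0 ≤ K generalizing K
  · refine this (K := 0) (fun i j => (hK i j).trans (ENNReal.ofReal_le_ofReal ?_)) le_rfl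
    rw [zero_mul]
    exact mul_nonpos_of_nonpos_of_nonneg (not_le.1 hK0).le (sq_nonneg _)
  classical
  set rep : ℕ → ℕ → ι := fun r c =>
    if h : ∃ i, ⌊(2 : ℝ) ^ r * τ i⌋₊ = c then h.choose else i₀ with hrep_def
  have hrep : ∀ r i, ⌊(2 : ℝ) ^ r * τ (rep r ⌊(2 : ℝ) ^ r * τ i⌋₊)⌋₊ = ⌊(2 : ℝ) ^ r * τ i⌋₊ := by
    intro r i
    have h : ∃ j, ⌊(2 : ℝ) ^ r * τ j⌋₊ = ⌊(2 : ℝ) ^ r * τ i⌋₊ := ⟨i, rfl⟩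
    simp only [hrep_def, dif_pos h]
    exact h.choose_spec
  have hclose : ∀ r i j, ⌊(2 : ℝ) ^ r * τ i⌋₊ = ⌊(2 : ℝ) ^ r * τ j⌋₊ →
      |τ i - τ j| ≤ 1 / 2 ^ r := by
    intro r i j h
    have h2 : (0 : ℝ) < 2 ^ r := by positivity
    have h7 := (Nat.floor_eq_iff (mul_nonneg h2.le (hτ i).1)).1 h
    have h8 := (Nat.floor_eq_iff (mul_nonneg h2.le (hτ j).1)).1 rfl
    rw [le_div_iff₀ h2, ← abs_of_pos h2, ← abs_mul, sub_mul, abs_le]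
    constructor <;> linarith [h7.1, h7.2, h8.1, h8.2]
  have hmom : ∀ r i j (c : ℝ), 0 ≤ c → |τ i - τ j| ≤ c / 2 ^ r →
      ∫⁻ ω, ENNReal.ofReal ((Y i ω - Y j ω) ^ 4) ∂P ≤ ENNReal.ofReal (K * c ^ 2 * (1 / 4) ^ r) := by
    intro r i j c hc h
    refine (hK i j).trans (ENNReal.ofReal_le_ofReal ?_)
    rw [mul_assoc]
    refine mul_le_mul_of_nonneg_left ?_ hK0
    have h1 : (c / 2 ^ r) ^ 2 = c ^ 2 * (1 / 4 : ℝ) ^ r := by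
      rw [div_pow, ← pow_mul, mul_comm r, pow_mul, one_div, inv_pow]
      norm_num
      rfl
    rw [← h1, ← sq_abs (τ i - τ j)]
    exact pow_le_pow_left₀ (abs_nonneg _) h 2
  have hhalf : ∀ r i, ⌊(2 : ℝ) ^ r * τ i⌋₊ = ⌊(2 : ℝ) ^ (r + 1) * τ i⌋₊ / 2 := by
    intro r i
    have h : (2 : ℝ) ^ r * τ i = (2 : ℝ) ^ (r + 1) * τ i / 2 := by rw [pow_succ]; ring
    rw [h, Nat.floor_div_ofNat]
  -- the maximal increments at level `r`
  set V : ℕ → Ω → ℝ := fun r ω =>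
    ∑ d ∈ Finset.range (2 ^ (r + 1) + 1),
      ((Y (rep r ⌊(2 : ℝ) ^ r * τ (rep (r + 1) d)⌋₊) ω - Y (rep (r + 1) d) ω) ^ 4 +
        if |τ (rep r d) - τ (rep r (d + 1))| ≤ 2 / 2 ^ r then
          (Y (rep r d) ω - Y (rep r (d + 1)) ω) ^ 4 else 0) with hV
  have hVm : ∀ r, AEMeasurable (V r) P := by
    intro r
    refine Finset.aemeasurable_fun_sum _ fun d _ => ?_
    refine (((hY _).sub (hY _)).pow_const 4).add ?_
    split_ifs
    · exact ((hY _).sub (hY _)).pow_const 4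
    · exact aemeasurable_const
  -- 15 = 3 · (1² + 2²): there are at most 3 · 2^r terms, each with one increment over clock
  -- distance 1/2^r and one over 2/2^r.
  have hVle : ∀ r, ∫⁻ ω, ENNReal.ofReal (V r ω) ∂P ≤ ENNReal.ofReal (15 * K * (1 / 2) ^ r) := by
    intro r
    have h4 : ∀ z : ℝ, 0 ≤ z ^ 4 := fun z => by positivity
    have hterm : ∀ d, ∫⁻ ω, ENNReal.ofReal
        ((Y (rep r ⌊(2 : ℝ) ^ r * τ (rep (r + 1) d)⌋₊) ω - Y (rep (r + 1) d) ω) ^ 4 +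
        if |τ (rep r d) - τ (rep r (d + 1))| ≤ 2 / 2 ^ r then
          (Y (rep r d) ω - Y (rep r (d + 1)) ω) ^ 4 else 0) ∂P ≤
        ENNReal.ofReal (5 * K * (1 / 4) ^ r) := by
      intro d
      have e1 : ∫⁻ ω, ENNReal.ofReal
          ((Y (rep r ⌊(2 : ℝ) ^ r * τ (rep (r + 1) d)⌋₊) ω - Y (rep (r + 1) d) ω) ^ 4) ∂P ≤
          ENNReal.ofReal (K * 1 ^ 2 * (1 / 4) ^ r) :=
        hmom r _ _ 1 zero_le_one (hclose r _ _ (hrep r _))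
      have e2 : ∫⁻ ω, ENNReal.ofReal (if |τ (rep r d) - τ (rep r (d + 1))| ≤ 2 / 2 ^ r then
          (Y (rep r d) ω - Y (rep r (d + 1)) ω) ^ 4 else 0) ∂P ≤
          ENNReal.ofReal (K * 2 ^ 2 * (1 / 4) ^ r) := by
        split_ifs with h
        · exact hmom r _ _ 2 zero_le_two h
        · simp
      refine (lintegral_mono fun ω => ENNReal.ofReal_add_le).trans ?_
      have hm : AEMeasurable (fun ω => ENNReal.ofReal
          ((Y (rep r ⌊(2 : ℝ) ^ r * τ (rep (r + 1) d)⌋₊) ω - Y (rep (r + 1) d) ω) ^ 4)) P :=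
        (((hY _).sub (hY _)).pow_const 4).ennreal_ofReal
      rw [lintegral_add_left' hm]
      refine (add_le_add e1 e2).trans ?_
      rw [← ENNReal.ofReal_add (by positivity) (by positivity)]
      exact ENNReal.ofReal_le_ofReal (le_of_eq (by ring))
    have hnn : ∀ d ω, 0 ≤
        ((Y (rep r ⌊(2 : ℝ) ^ r * τ (rep (r + 1) d)⌋₊) ω - Y (rep (r + 1) d) ω) ^ 4 +
        if |τ (rep r d) - τ (rep r (d + 1))| ≤ 2 / 2 ^ r then
          (Y (rep r d) ω - Y (rep r (d + 1)) ω) ^ 4 else 0) := by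
      intro d ω
      split_ifs <;> positivity
    simp only [hV]
    simp_rw [ENNReal.ofReal_sum_of_nonneg fun d _ => hnn d _]
    rw [lintegral_finsetSum']
    · refine (Finset.sum_le_sum fun d _ => hterm d).trans ?_
      rw [Finset.sum_const, Finset.card_range, nsmul_eq_mul, ← ENNReal.ofReal_natCast,
        ← ENNReal.ofReal_mul (by positivity)]
      refine ENNReal.ofReal_le_ofReal ?_
      have h1 : (1 : ℝ) ≤ 2 ^ r := one_le_pow₀ one_le_two
      have h2 : ((2 ^ (r + 1) + 1 : ℕ) : ℝ) ≤ 3 * 2 ^ r := by push_cast; rw [pow_succ]; linarith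
      have h3 : (1 / 2 : ℝ) ^ r = 2 ^ r * (1 / 4) ^ r := by rw [← mul_pow]; norm_num
      rw [h3]
      calc ((2 ^ (r + 1) + 1 : ℕ) : ℝ) * (5 * K * (1 / 4) ^ r)
          ≤ 3 * 2 ^ r * (5 * K * (1 / 4) ^ r) :=
            mul_le_mul_of_nonneg_right h2 (by positivity)
        _ = 15 * K * (2 ^ r * (1 / 4) ^ r) := by ring
    · intro d _
      refine AEMeasurable.ennreal_ofReal ?_
      refine (((hY _).sub (hY _)).pow_const 4).add ?_
      split_ifs
      · exact ((hY _).sub (hY _)).pow_const 4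
      · exact aemeasurable_const
  have hlim : ∀ i, ∀ᵐ ω ∂P, Tendsto (fun r => Y (rep r ⌊(2 : ℝ) ^ r * τ i⌋₊) ω) atTop
      (𝓝 (Y i ω)) := by
    intro i
    have h := ae_tendsto_zero_of_tsum_lintegral_ne_top (P := P)
      (f := fun r ω => ENNReal.ofReal ((Y (rep r ⌊(2 : ℝ) ^ r * τ i⌋₊) ω - Y i ω) ^ 4))
      (fun r => (((hY _).sub (hY _)).pow_const 4).ennreal_ofReal) ?_
    · filter_upwards [h] with ω hω
      rw [Metric.tendsto_atTop]
      intro ε hε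
      have h1 := hω.eventually (gt_mem_nhds (ENNReal.ofReal_pos.2 (pow_pos hε 4)))
      obtain ⟨N, hN⟩ := eventually_atTop.1 h1
      refine ⟨N, fun n hn => ?_⟩
      have h2 := (ENNReal.ofReal_lt_ofReal_iff (pow_pos hε 4)).1 (hN n hn)
      rw [Real.dist_eq]
      refine lt_of_pow_lt_pow_left₀ 4 hε.le ?_
      rwa [(show Even 4 by decide).pow_abs]
    · have hs : Summable fun r : ℕ => K * 1 ^ 2 * (1 / 4 : ℝ) ^ r :=
        (summable_geometric_of_lt_one (by norm_num) (by norm_num)).mul_left _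
      exact ne_top_of_le_ne_top hs.tsum_ofReal_ne_top
        (ENNReal.tsum_le_tsum fun r => hmom r _ _ 1 zero_le_one (hclose r _ _ (hrep r i)))
  filter_upwards [ae_le_geometric_of_lintegral_le hVm hVle, ae_all_iff.2 hlim] with ω hω hl
  obtain ⟨A, hA0, hA⟩ := hω
  have hroot : ∀ r (z : ℝ), z ^ 4 ≤ V r ω → |z| ≤ A ^ (1 / 4 : ℝ) * ((2 / 3 : ℝ) ^ (1 / 4 : ℝ)) ^ r := by
    intro r z hz
    have h1 := hz.trans (hA r)
    refine le_of_pow_le_pow_left₀ (n := 4) (by norm_num) (by positivity) ?_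
    have hr : ∀ B : ℝ, 0 ≤ B → (B ^ (1 / 4 : ℝ)) ^ 4 = B := fun B hB => by
      rw [← Real.rpow_natCast, ← Real.rpow_mul hB]; norm_num
    rw [(show Even 4 by decide).pow_abs, mul_pow, ← pow_mul, mul_comm r, pow_mul, hr A hA0,
      hr _ (by norm_num)]
    exact h1
  have hbound : ∀ r d (i : ι), ⌊(2 : ℝ) ^ r * τ i⌋₊ = d → d ∈ Finset.range (2 ^ r + 1) := by
    intro r d i h
    rw [Finset.mem_range, Nat.lt_succ_iff, ← h]
    refine Nat.floor_le_of_le ?_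
    push_cast
    exact mul_le_of_le_one_right (by positivity) (hτ i).2
  have h4 : ∀ z : ℝ, 0 ≤ z ^ 4 := fun z => by positivity
  have hVd : ∀ r, ∀ d ∈ Finset.range (2 ^ (r + 1) + 1),
      ((Y (rep r ⌊(2 : ℝ) ^ r * τ (rep (r + 1) d)⌋₊) ω - Y (rep (r + 1) d) ω) ^ 4 +
        if |τ (rep r d) - τ (rep r (d + 1))| ≤ 2 / 2 ^ r then
          (Y (rep r d) ω - Y (rep r (d + 1)) ω) ^ 4 else 0) ≤ V r ω := by
    intro r d hd
    refine Finset.single_le_sum (f := fun d =>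
      ((Y (rep r ⌊(2 : ℝ) ^ r * τ (rep (r + 1) d)⌋₊) ω - Y (rep (r + 1) d) ω) ^ 4 +
        if |τ (rep r d) - τ (rep r (d + 1))| ≤ 2 / 2 ^ r then
          (Y (rep r d) ω - Y (rep r (d + 1)) ω) ^ 4 else 0)) (fun d _ => ?_) hd
    split_ifs <;> positivity
  refine exists_modulus_of_geometric hτ hrep (by positivity)
    (Real.rpow_lt_one (by norm_num) (by norm_num) (by norm_num)) (fun r i => hroot r _ ?_)
    (fun r c hc => hroot r _ ?_) hl
  · have h1 := hVd r _ (hbound (r + 1) _ i rfl)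
    -- A cell of level r+1 lies inside one cell of level r, obtained by halving its number, so the
    -- representative and i have the same parent cell.
    have h2 : ⌊(2 : ℝ) ^ r * τ (rep (r + 1) ⌊(2 : ℝ) ^ (r + 1) * τ i⌋₊)⌋₊ =
        ⌊(2 : ℝ) ^ r * τ i⌋₊ := by
      rw [hhalf, hrep, ← hhalf]
    rw [h2] at h1
    refine le_trans ?_ h1
    refine le_add_of_nonneg_right ?_
    split_ifs <;> positivity
  · by_cases hcr : c ∈ Finset.range (2 ^ (r + 1) + 1)
    · have h1 := hVd r c hcr
      rw [if_pos hc] at h1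
      exact (le_add_of_nonneg_left (h4 _)).trans h1
    -- No index falls in cells this far right. Both representatives are then the default i₀ and the
    -- increment is 0.
    · have hdef : ∀ d, c ≤ d → rep r d = i₀ := by
        intro d hd
        simp only [hrep_def]
        rw [dif_neg]
        rintro ⟨i, hi⟩
        have h1 := hbound r d i hi
        rw [Finset.mem_range] at h1 hcr
        rw [pow_succ] at hcr
        omega
      rw [hdef c le_rfl, hdef (c + 1) (Nat.le_succ c), sub_self]
      refine le_trans (b := 0) (by norm_num) (le_trans ?_ (hVd r 0 (by simp)))
      split_ifs <;> positivity

end Chaining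

/-! ### Centred normal variables: moments, limits and convergence of sequences. -/

section Gaussian

variable {Ω : Type*} [MeasurableSpace Ω] {P : Measure Ω}

/-- `Y` is a centred normal random variable of variance `v`. -/
def CentredNormal (P : Measure Ω) (Y : Ω → ℝ) (v : ℝ) : Prop :=
  HasLaw Y (gaussianReal 0 v.toNNReal) P

lemma CentredNormal.congr {Y Z : Ω → ℝ} {v w : ℝ} (h : CentredNormal P Y v) (hYZ : Z =ᵐ[P] Y)
    (hvw : v = w) : CentredNormal P Z w := by
  subst hvw
  exact HasLaw.congr h hYZ

lemma CentredNormal.aemeasurable {Y : Ω → ℝ} {v : ℝ} (h : CentredNormal P Y v) :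
    AEMeasurable Y P := HasLaw.aemeasurable h

lemma CentredNormal.const_mul {Y : Ω → ℝ} {v : ℝ} (h : CentredNormal P Y v) (c : ℝ) :
    CentredNormal P (fun ω => c * Y ω) (c ^ 2 * v) := by
  have h1 := gaussianReal_const_mul (X := Y) h c
  unfold CentredNormal
  convert h1 using 2
  · simp
  · rw [Real.toNNReal_mul (sq_nonneg c)]
    congr 1
    exact Real.toNNReal_of_nonneg (sq_nonneg c)

lemma CentredNormal.integral_exp {Y : Ω → ℝ} {v : ℝ} (hv : 0 ≤ v) (h : CentredNormal P Y v)
    (t : ℝ) : ∫ ω, Complex.exp (Complex.I * ((t * Y ω : ℝ) : ℂ)) ∂P =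
      Complex.exp ((-(t ^ 2 * v / 2) : ℝ) : ℂ) := by
  have h1 := charFun_gaussianReal (μ := 0) (v := v.toNNReal) t
  have h2 : P.map Y = gaussianReal 0 v.toNNReal := HasLaw.map_eq h
  rw [← h2, charFun_apply_real, integral_map h.aemeasurable
    (Continuous.aestronglyMeasurable (by fun_prop))] at h1
  rw [Real.coe_toNNReal v hv] at h1
  convert h1 using 1
  · congr 1 with ω
    push_cast
    ring_nf
  · push_cast
    ring_nf

lemma centredNormal_of_integral_exp [IsProbabilityMeasure P] {Y : Ω → ℝ} {v : ℝ} (hv : 0 ≤ v)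
    (hY : AEMeasurable Y P)
    (h : ∀ t : ℝ, ∫ ω, Complex.exp (Complex.I * ((t * Y ω : ℝ) : ℂ)) ∂P =
      Complex.exp ((-(t ^ 2 * v / 2) : ℝ) : ℂ)) : CentredNormal P Y v := by
  refine ⟨hY, ?_⟩
  have : IsProbabilityMeasure (P.map Y) := Measure.isProbabilityMeasure_map hY
  refine Measure.ext_of_charFun ?_
  ext t
  rw [charFun_gaussianReal, charFun_apply_real, integral_map hY
    (Continuous.aestronglyMeasurable (by fun_prop))]
  rw [Real.coe_toNNReal v hv]
  convert h t using 1
  · congr 1 with ω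
    push_cast
    ring_nf
  · push_cast
    ring_nf

lemma CentredNormal.lintegral_sq {Y : Ω → ℝ} {v : ℝ} (hv : 0 ≤ v) (h : CentredNormal P Y v) :
    ∫⁻ ω, ENNReal.ofReal (Y ω ^ 2) ∂P = ENNReal.ofReal v := by
  have h2 : P.map Y = gaussianReal 0 v.toNNReal := HasLaw.map_eq h
  have h3 : ∫⁻ y, ENNReal.ofReal (y ^ 2) ∂(P.map Y) = ∫⁻ ω, ENNReal.ofReal (Y ω ^ 2) ∂P :=
    lintegral_map' (Measurable.aemeasurable (by fun_prop)) h.aemeasurable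
  have h8 : Integrable (fun y : ℝ => y ^ 2) (gaussianReal 0 v.toNNReal) :=
    (memLp_id_gaussianReal 2).integrable_sq
  rw [← h3, h2, ← ofReal_integral_eq_lintegral_ofReal h8 (ae_of_all _ fun y => sq_nonneg _)]
  congr 1
  have h4 := variance_fun_id_gaussianReal (μ := 0) (v := v.toNNReal)
  rw [variance_of_integral_eq_zero (X := fun x : ℝ => x) measurable_id.aemeasurable
    (integral_id_gaussianReal (μ := 0) (v := v.toNNReal))] at h4
  rw [Real.coe_toNNReal v hv] at h4
  exact h4

/-- The fourth moment of the standard normal distribution. -/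
def fourthMoment : ℝ := ∫ y, y ^ 4 ∂(gaussianReal 0 1)

lemma CentredNormal.lintegral_pow_four {Y : Ω → ℝ} {v : ℝ} (hv : 0 ≤ v)
    (h : CentredNormal P Y v) :
    ∫⁻ ω, ENNReal.ofReal (Y ω ^ 4) ∂P = ENNReal.ofReal (fourthMoment * v ^ 2) := by
  have h2 : P.map Y = gaussianReal 0 v.toNNReal := HasLaw.map_eq h
  have h3 : ∫⁻ y, ENNReal.ofReal (y ^ 4) ∂(P.map Y) = ∫⁻ ω, ENNReal.ofReal (Y ω ^ 4) ∂P :=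
    lintegral_map' (Measurable.aemeasurable (by fun_prop)) h.aemeasurable
  have h5 : gaussianReal 0 v.toNNReal = (gaussianReal 0 1).map (fun y => √v * y) := by
    rw [gaussianReal_map_const_mul]
    congr 1
    · simp
    · rw [mul_one]
      ext
      simp [Real.sq_sqrt hv, hv]
  have h6 : ∫⁻ y, ENNReal.ofReal (y ^ 4) ∂((gaussianReal 0 1).map (fun y => √v * y)) =
      ∫⁻ y, ENNReal.ofReal ((√v * y) ^ 4) ∂(gaussianReal 0 1) :=
    lintegral_map' (Measurable.aemeasurable (by fun_prop)) (Measurable.aemeasurable (by fun_prop))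
  have h7 : ∀ y : ℝ, (√v * y) ^ 4 = v ^ 2 * y ^ 4 := fun y => by
    rw [mul_pow, show (√v) ^ 4 = ((√v) ^ 2) ^ 2 by ring, Real.sq_sqrt hv]
  have h8 : Integrable (fun y : ℝ => y ^ 4) (gaussianReal 0 1) := by
    have := (memLp_id_gaussianReal (μ := 0) (v := 1) 4).integrable_norm_pow (by norm_num)
    refine this.congr (ae_of_all _ fun y => ?_)
    simp only [id, Real.norm_eq_abs]
    exact (show Even 4 by decide).pow_abs y
  rw [← h3, h2, h5, h6]
  simp_rw [h7]
  rw [← ofReal_integral_eq_lintegral_ofReal (h8.const_mul _) (ae_of_all _ fun y => by positivity),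
    integral_const_mul, mul_comm]
  rfl

/-- Characteristic functions converge by bounded convergence, and the limit is again that of a
centred normal law. -/
lemma centredNormal_of_tendsto_ae [IsProbabilityMeasure P] {Y : ℕ → Ω → ℝ} {Z : Ω → ℝ}
    {v : ℕ → ℝ} {w : ℝ} (hv : ∀ n, 0 ≤ v n) (hY : ∀ n, CentredNormal P (Y n) (v n))
    (hYZ : ∀ᵐ ω ∂P, Tendsto (fun n => Y n ω) atTop (𝓝 (Z ω))) (hvw : Tendsto v atTop (𝓝 w)) :
    CentredNormal P Z w := by
  have hw : 0 ≤ w := ge_of_tendsto' hvw hv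
  refine centredNormal_of_integral_exp hw
    (aemeasurable_of_tendsto_metrizable_ae atTop (fun n => (hY n).aemeasurable) hYZ) fun t => ?_
  have h1 : Tendsto (fun n => ∫ ω, Complex.exp (Complex.I * ((t * Y n ω : ℝ) : ℂ)) ∂P) atTop
      (𝓝 (∫ ω, Complex.exp (Complex.I * ((t * Z ω : ℝ) : ℂ)) ∂P)) := by
    refine tendsto_integral_of_dominated_convergence (fun _ => 1) (fun n => ?_)
      (integrable_const _) (fun n => ae_of_all _ fun ω => ?_) ?_
    · have hc : Continuous fun y : ℝ => Complex.exp (Complex.I * ((t * y : ℝ) : ℂ)) := by fun_prop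
      exact hc.comp_aestronglyMeasurable (hY n).aemeasurable.aestronglyMeasurable
    · rw [mul_comm, Complex.norm_exp_ofReal_mul_I]
    · filter_upwards [hYZ] with ω hω
      have hc : Continuous fun y : ℝ => Complex.exp (Complex.I * ((t * y : ℝ) : ℂ)) := by fun_prop
      exact (hc.tendsto _).comp hω
  refine tendsto_nhds_unique h1 ?_
  simp_rw [fun n => (hY n).integral_exp (hv n) t]
  have hc : Continuous fun v : ℝ => Complex.exp ((-(t ^ 2 * v / 2) : ℝ) : ℂ) := by fun_prop
  exact (hc.tendsto w).comp hvw

lemma tendstoInMeasure_of_centredNormal {Y : ℕ → Ω → ℝ} {Z : Ω → ℝ}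
    {v : ℕ → ℝ} (hv : ∀ n, 0 ≤ v n) (hY : ∀ n, CentredNormal P (fun ω => Y n ω - Z ω) (v n))
    (hv0 : Tendsto v atTop (𝓝 0)) (hm : ∀ n, AEStronglyMeasurable (Y n) P)
    (hZ : AEStronglyMeasurable Z P) : TendstoInMeasure P Y atTop Z := by
  refine tendstoInMeasure_of_tendsto_eLpNorm two_ne_zero hm hZ ?_
  have h1 : ∀ n, eLpNorm (Y n - Z) 2 P = ENNReal.ofReal (v n) ^ (1 / 2 : ℝ) := by
    intro n
    rw [eLpNorm_eq_lintegral_rpow_enorm_toReal two_ne_zero ENNReal.ofNat_ne_top,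
      ← (hY n).lintegral_sq (hv n)]
    simp only [ENNReal.toReal_ofNat]
    congr 1
    refine lintegral_congr fun ω => ?_
    rw [← sq_abs, ENNReal.ofReal_pow (abs_nonneg _), ← Real.enorm_eq_ofReal_abs]
    norm_cast
  simp_rw [h1]
  have h2 : Tendsto (fun n => ENNReal.ofReal (v n)) atTop (𝓝 0) := by
    simpa using ENNReal.tendsto_ofReal hv0
  have h3 := (ENNReal.continuous_rpow_const (y := (1 / 2 : ℝ))).tendsto 0
  rw [ENNReal.zero_rpow_of_pos (by norm_num)] at h3
  exact h3.comp h2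

/-- The chaining theorem is applied with the normalized partial sums of a as clock. The clock is a
Cauchy sequence, so the modulus of continuity makes S Cauchy almost surely. Only the laws of the
increments enter, not their independence. -/
lemma ae_exists_tendsto_of_centredNormal {S : ℕ → Ω → ℝ} (hS : ∀ n, AEMeasurable (S n) P)
    {a : ℕ → ℝ} (ha : ∀ n, 0 ≤ a n) (hsum : Summable a) {C : ℝ} {v : ℕ → ℕ → ℝ}
    (hv : ∀ n m, 0 ≤ v n m)
    (hvle : ∀ n m, n ≤ m → v n m ≤ C * ∑ j ∈ Finset.Ico n m, a j)
    (h : ∀ n m, n ≤ m → CentredNormal P (fun ω => S m ω - S n ω) (v n m)) :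
    ∀ᵐ ω ∂P, ∃ l, Tendsto (fun n => S n ω) atTop (𝓝 l) := by
  -- The summand 1 keeps A positive even when all a n vanish.
  set A := 1 + ∑' n, a n with hA
  have hA0 : 0 < A := add_pos_of_pos_of_nonneg one_pos (tsum_nonneg ha)
  set τ : ℕ → ℝ := fun n => (∑ j ∈ Finset.range n, a j) / A with hτ
  have hf : 0 ≤ fourthMoment := integral_nonneg fun y => by positivity
  have hdiff : ∀ n m, n ≤ m → τ m - τ n = (∑ j ∈ Finset.Ico n m, a j) / A := by
    intro n m hnm
    rw [hτ, Finset.sum_Ico_eq_sub _ hnm]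
    ring
  have hmain : ∀ n m, n ≤ m → ∫⁻ ω, ENNReal.ofReal ((S m ω - S n ω) ^ 4) ∂P ≤
      ENNReal.ofReal (fourthMoment * (C * A) ^ 2 * (τ m - τ n) ^ 2) := by
    intro n m hnm
    rw [(h n m hnm).lintegral_pow_four (hv n m)]
    refine ENNReal.ofReal_le_ofReal ?_
    rw [mul_assoc, ← mul_pow, hdiff n m hnm]
    refine mul_le_mul_of_nonneg_left (pow_le_pow_left₀ (hv n m) ?_ 2) hf
    refine (hvle n m hnm).trans (le_of_eq ?_)
    field_simp
  have hK : ∀ i j, ∫⁻ ω, ENNReal.ofReal ((S i ω - S j ω) ^ 4) ∂P ≤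
      ENNReal.ofReal (fourthMoment * (C * A) ^ 2 * (τ i - τ j) ^ 2) := by
    intro i j
    rcases le_total j i with hij | hij
    · exact hmain j i hij
    · have e1 : ∀ ω, (S i ω - S j ω) ^ 4 = (S j ω - S i ω) ^ 4 := fun ω => by ring
      have e2 : (τ i - τ j) ^ 2 = (τ j - τ i) ^ 2 := by ring
      simp_rw [e1]
      rw [e2]
      exact hmain i j hij
  have hτI : ∀ n, τ n ∈ Set.Icc (0 : ℝ) 1 := by
    intro n
    refine ⟨div_nonneg (Finset.sum_nonneg fun j _ => ha j) hA0.le, ?_⟩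
    rw [hτ, div_le_one hA0]
    have := hsum.sum_le_tsum (Finset.range n) fun j _ => ha j
    linarith
  have hτc : CauchySeq τ := (hsum.hasSum.tendsto_sum_nat.div_const A).cauchySeq
  filter_upwards [ae_exists_modulus hτI hS hK] with ω hω
  refine cauchySeq_tendsto_of_complete (Metric.cauchySeq_iff.2 fun ε hε => ?_)
  obtain ⟨δ, hδ, hmod⟩ := hω ε hε
  obtain ⟨N, hN⟩ := Metric.cauchySeq_iff.1 hτc δ hδ
  exact ⟨N, fun m hm n hn => hmod m n (hN m hm n hn)⟩

end Gaussian

/-! ### Riemann-Stieltjes integrals against continuous paths. -/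

section RiemannStieltjes

variable {T : ℝ}

/-- The Riemann-Stieltjes sums of `g` against the path `x` along the uniform partitions. -/
def rsSum (g : ℝ → ℝ) (x : C0 T) (n : ℕ) : ℝ :=
  ∑ k ∈ Finset.range n, g (k * T / n) * (pathAt x ((k + 1) * T / n) - pathAt x (k * T / n))

lemma grid_mem (hT : 0 < T) {n k : ℕ} (hk : k ≤ n) : (k * T / n : ℝ) ∈ Set.Icc 0 T := by
  rcases Nat.eq_zero_or_pos n with rfl | hn
  · simp [hT.le]
  · have hn' : (0 : ℝ) < n := Nat.cast_pos.2 hn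
    refine ⟨by positivity, ?_⟩
    rw [div_le_iff₀ hn', mul_comm T]
    exact mul_le_mul_of_nonneg_right (Nat.cast_le.2 hk) hT.le

lemma grid_succ_mem (hT : 0 < T) {n k : ℕ} (hk : k < n) :
    (((k : ℝ) + 1) * T / n : ℝ) ∈ Set.Icc 0 T := by
  have := grid_mem hT (Nat.succ_le_of_lt hk)
  push_cast at this
  exact this

lemma pathAt_of_mem (x : C0 T) {t : ℝ} (ht : t ∈ Set.Icc 0 T) : pathAt x t = x.1 ⟨t, ht⟩ :=
  dif_pos ht

lemma pathAt_zero (hT : 0 < T) (x : C0 T) : pathAt x 0 = 0 := by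
  rw [pathAt_of_mem x ⟨le_rfl, hT.le⟩]
  exact x.2 _ rfl

lemma pathAt_add (x y : C0 T) (t : ℝ) : pathAt (x + y) t = pathAt x t + pathAt y t := by
  unfold pathAt; split_ifs <;> simp

lemma pathAt_smul (c : ℝ) (x : C0 T) (t : ℝ) : pathAt (c • x) t = c * pathAt x t := by
  unfold pathAt; split_ifs <;> simp

lemma measurable_eval (t : Set.Icc (0 : ℝ) T) : Measurable fun x : C0 T => x.1 t :=
  Continuous.measurable ((continuous_eval_const (F := C(Set.Icc (0 : ℝ) T, ℝ)) t).comp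
    continuous_subtype_val)

lemma measurable_pathAt (t : ℝ) : Measurable fun x : C0 T => pathAt x t := by
  unfold pathAt
  split_ifs
  · exact measurable_eval _
  · exact measurable_const

lemma measurable_rsSum (g : ℝ → ℝ) (n : ℕ) : Measurable fun x : C0 T => rsSum g x n :=
  Finset.measurable_fun_sum _ fun _ _ =>
    ((measurable_pathAt _).sub (measurable_pathAt _)).const_mul _

lemma measurable_rsIntegral (g : ℝ → ℝ) : Measurable fun x : C0 T => rsIntegral g x :=
  (StronglyMeasurable.limUnder fun n => (measurable_rsSum g n).stronglyMeasurable).measurable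

lemma rsSum_add (g : ℝ → ℝ) (x y : C0 T) (n : ℕ) :
    rsSum g (x + y) n = rsSum g x n + rsSum g y n := by
  simp only [rsSum, pathAt_add, ← Finset.sum_add_distrib]
  exact Finset.sum_congr rfl fun k _ => by ring

lemma rsSum_smul (g : ℝ → ℝ) (c : ℝ) (x : C0 T) (n : ℕ) :
    rsSum g (c • x) n = c * rsSum g x n := by
  simp only [rsSum, pathAt_smul, Finset.mul_sum]
  exact Finset.sum_congr rfl fun k _ => by ring

lemma rsSum_sub_fun (hT : 0 < T) {g g₁ g₂ : ℝ → ℝ}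
    (h : ∀ t ∈ Set.Icc 0 T, g t = g₁ t - g₂ t) (x : C0 T) (n : ℕ) :
    rsSum g x n = rsSum g₁ x n - rsSum g₂ x n := by
  simp only [rsSum, ← Finset.sum_sub_distrib]
  refine Finset.sum_congr rfl fun k hk => ?_
  rw [h _ (grid_mem hT (Finset.mem_range.1 hk).le)]
  ring

lemma rsSum_sum_fun (s : Finset ℕ) (c : ℕ → ℝ) (g : ℕ → ℝ → ℝ) (x : C0 T) (n : ℕ) :
    rsSum (fun t => ∑ j ∈ s, c j * g j t) x n = ∑ j ∈ s, c j * rsSum (g j) x n := by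
  simp only [rsSum, Finset.mul_sum, Finset.sum_mul]
  rw [Finset.sum_comm]
  exact Finset.sum_congr rfl fun j _ => Finset.sum_congr rfl fun k _ => by ring

/-- Summation by parts moves the increments from the path to g, where monotonicity controls them.
The boundary term at 0 is absent because the path vanishes there. -/
lemma rsSum_eq_by_parts (hT : 0 < T) (g : ℝ → ℝ) (x : C0 T) {n : ℕ} (hn : 0 < n) :
    rsSum g x n = g T * pathAt x T - ∑ k ∈ Finset.range n,
      pathAt x ((k + 1) * T / n) * (g ((k + 1) * T / n) - g (k * T / n)) := by
  have h := Finset.sum_range_sub (fun k : ℕ => g (k * T / n) * pathAt x (k * T / n)) n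
  have hn' : (n : ℝ) ≠ 0 := Nat.cast_ne_zero.2 hn.ne'
  have hT' : (n : ℝ) * T / n = T := by field_simp
  simp only [hT', Nat.cast_zero, zero_mul, zero_div, pathAt_zero hT, mul_zero, sub_zero] at h
  rw [← h, rsSum, ← Finset.sum_sub_distrib]
  refine Finset.sum_congr rfl fun k _ => ?_
  push_cast
  ring

lemma sum_range_mul_eq (f : ℕ → ℝ) (n m : ℕ) :
    ∑ j ∈ Finset.range (n * m), f j =
      ∑ k ∈ Finset.range n, ∑ i ∈ Finset.range m, f (k * m + i) := by
  induction n with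
  | zero => simp
  | succ n ih => rw [Nat.succ_mul, Finset.sum_range_add, ih, Finset.sum_range_succ]

lemma pathAt_uniformContinuous (x : C0 T) {ε : ℝ} (hε : 0 < ε) :
    ∃ δ > 0, ∀ s ∈ Set.Icc 0 T, ∀ t ∈ Set.Icc 0 T, |s - t| < δ →
      |pathAt x s - pathAt x t| < ε := by
  have h := CompactSpace.uniformContinuous_of_continuous x.1.continuous
  obtain ⟨δ, hδ, h'⟩ := Metric.uniformContinuous_iff.1 h ε hε
  refine ⟨δ, hδ, fun s hs t ht hst => ?_⟩
  rw [pathAt_of_mem x hs, pathAt_of_mem x ht]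
  exact h' (a := ⟨s, hs⟩) (b := ⟨t, ht⟩) hst

/-- After summation by parts the weights are the increments of g, nonnegative with total g T - g 0.
Refining the partition changes the sum by at most the oscillation of the path over one cell times
this total. The partitions into m and n cells are compared through their common refinement into mn
cells. -/
lemma cauchySeq_rsSum_of_monotoneOn (hT : 0 < T) {g : ℝ → ℝ} (hg : MonotoneOn g (Set.Icc 0 T))
    (x : C0 T) : CauchySeq fun n => rsSum g x n := by
  have hV0 : 0 ≤ g T - g 0 := sub_nonneg.2 (hg ⟨le_rfl, hT.le⟩ ⟨hT.le, le_rfl⟩ hT.le)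
  have hinc : ∀ n k : ℕ, k < n → 0 ≤ g (((k : ℝ) + 1) * T / n) - g (k * T / n) := by
    intro n k hk
    refine sub_nonneg.2 (hg (grid_mem hT hk.le) (grid_succ_mem hT hk) ?_)
    gcongr
    linarith
  have hrefine : ∀ (ε δ : ℝ), 0 < ε → (∀ s ∈ Set.Icc 0 T, ∀ t ∈ Set.Icc 0 T, |s - t| < δ →
      |pathAt x s - pathAt x t| < ε) → ∀ n m : ℕ, 0 < n → 0 < m → T / n < δ →
      |rsSum g x n - rsSum g x (n * m)| ≤ ε * (g T - g 0) := by
    intro ε δ hε hδ n m hn hm hnδ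
    have hn' : (0 : ℝ) < n := Nat.cast_pos.2 hn
    have hm' : (0 : ℝ) < m := Nat.cast_pos.2 hm
    set t : ℕ → ℝ := fun j => j * T / (n * m : ℕ) with ht
    have htk : ∀ k : ℕ, t (k * m) = k * T / n := by
      intro k; simp only [ht]; push_cast; field_simp
    have h1 : ∑ k ∈ Finset.range n,
        pathAt x ((k + 1) * T / n) * (g ((k + 1) * T / n) - g (k * T / n)) =
        ∑ k ∈ Finset.range n, ∑ i ∈ Finset.range m,
          pathAt x ((k + 1) * T / n) * (g (t (k * m + i + 1)) - g (t (k * m + i))) := by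
      refine Finset.sum_congr rfl fun k _ => ?_
      rw [← Finset.mul_sum]
      congr 1
      have := Finset.sum_range_sub (fun i => g (t (k * m + i))) m
      simp only [add_zero] at this
      simp only [add_assoc]
      rw [this, htk k, show k * m + m = (k + 1) * m by ring, htk (k + 1)]
      push_cast; rfl
    have h2 : ∑ k ∈ Finset.range (n * m), pathAt x ((k + 1) * T / (n * m : ℕ)) *
        (g ((k + 1) * T / (n * m : ℕ)) - g (k * T / (n * m : ℕ))) =
        ∑ k ∈ Finset.range n, ∑ i ∈ Finset.range m,
          pathAt x (t (k * m + i + 1)) * (g (t (k * m + i + 1)) - g (t (k * m + i))) := by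
      rw [← sum_range_mul_eq (fun j => pathAt x (t (j + 1)) * (g (t (j + 1)) - g (t j)))]
      refine Finset.sum_congr rfl fun k _ => ?_
      simp only [ht]
      push_cast; rfl
    have hnm : 0 < n * m := Nat.mul_pos hn hm
    rw [rsSum_eq_by_parts hT g x hn, rsSum_eq_by_parts hT g x hnm, h1, h2]
    have h3 : g T - g 0 = ∑ k ∈ Finset.range n, ∑ i ∈ Finset.range m,
        (g (t (k * m + i + 1)) - g (t (k * m + i))) := by
      rw [← sum_range_mul_eq (fun j => g (t (j + 1)) - g (t j)),
        Finset.sum_range_sub (fun j => g (t j)), htk n]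
      have : t 0 = 0 := by simp [ht]
      rw [this, mul_comm, mul_div_cancel_right₀ _ hn'.ne']
    have h4 : ∀ a b c : ℝ, a - b - (a - c) = c - b := fun a b c => by ring
    rw [h4, ← Finset.sum_sub_distrib, h3, Finset.mul_sum]
    refine (Finset.abs_sum_le_sum_abs _ _).trans (Finset.sum_le_sum fun k hk => ?_)
    rw [← Finset.sum_sub_distrib, Finset.mul_sum]
    refine (Finset.abs_sum_le_sum_abs _ _).trans (Finset.sum_le_sum fun i hi => ?_)
    rw [Finset.mem_range] at hk hi
    have hlt : k * m + i < n * m := by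
      calc k * m + i < k * m + m := by omega
        _ = (k + 1) * m := by ring
        _ ≤ n * m := Nat.mul_le_mul_right m hk
    rw [← sub_mul, abs_mul]
    have h5 : 0 ≤ g (t (k * m + i + 1)) - g (t (k * m + i)) := by
      have := hinc (n * m) (k * m + i) hlt
      simp only [ht]
      push_cast at this ⊢
      exact this
    rw [abs_of_nonneg h5]
    refine mul_le_mul_of_nonneg_right (hδ _ (grid_mem hT hlt) _ (grid_succ_mem hT hk) ?_).le h5
    refine lt_of_le_of_lt ?_ hnδ
    have hi1 : ((i : ℝ) + 1) ≤ m := by exact_mod_cast hi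
    have h6 : t (k * m + i + 1) - ((k : ℝ) + 1) * T / n = (((i : ℝ) + 1) / m - 1) * (T / n) := by
      simp only [ht]; push_cast; field_simp; ring
    rw [h6, abs_mul, abs_of_nonneg (a := T / n) (by positivity)]
    refine mul_le_of_le_one_left (by positivity) ?_
    rw [abs_le]
    have h7 : ((i : ℝ) + 1) / m ≤ 1 := (div_le_one hm').2 hi1
    have h8 : 0 ≤ ((i : ℝ) + 1) / m := by positivity
    constructor <;> linarith
  refine Metric.cauchySeq_iff.2 fun ε hε => ?_
  -- With this tolerance each of the two refinements costs at most ε/3. The added 1 avoids division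
  -- by 0 for constant g.
  obtain ⟨δ, hδ, hx⟩ := pathAt_uniformContinuous x
    (ε := ε / (3 * (g T - g 0 + 1))) (by positivity)
  obtain ⟨N, hN⟩ := exists_nat_gt (T / δ)
  have hNp : (0 : ℝ) < N := (div_pos hT hδ).trans hN
  refine ⟨N, fun m hm n hn => ?_⟩
  have hfine : ∀ n : ℕ, N ≤ n → 0 < n ∧ T / n < δ := by
    intro n hn
    have h1 : (N : ℝ) ≤ n := Nat.cast_le.2 hn
    refine ⟨Nat.cast_pos.1 (hNp.trans_le h1), ?_⟩
    rw [div_lt_iff₀ (hNp.trans_le h1)]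
    rw [div_lt_iff₀ hδ] at hN
    nlinarith
  obtain ⟨hm0, hmδ⟩ := hfine m hm
  obtain ⟨hn0, hnδ⟩ := hfine n hn
  have e1 := hrefine _ δ (by positivity) hx m n hm0 hn0 hmδ
  have e2 := hrefine _ δ (by positivity) hx n m hn0 hm0 hnδ
  rw [mul_comm n m] at e2
  have e3 : ε / (3 * (g T - g 0 + 1)) * (g T - g 0) ≤ ε / 3 := by
    rw [div_mul_eq_mul_div, div_le_div_iff₀ (by positivity) (by norm_num)]
    nlinarith
  rw [Real.dist_eq]
  rw [abs_le] at e1 e2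
  rw [abs_lt]
  constructor <;> linarith [e1.1, e1.2, e2.1, e2.2]

/-- By the Jordan decomposition the `limUnder` in `rsIntegral` is a genuine limit, hence linear in
the path. -/
lemma tendsto_rsSum (hT : 0 < T) {g : ℝ → ℝ} (hg : BoundedVariationOn g (Set.Icc 0 T))
    (x : C0 T) : Tendsto (fun n => rsSum g x n) atTop (𝓝 (rsIntegral g x)) := by
  obtain ⟨p, q, hp, hq, hpq⟩ :=
    hg.locallyBoundedVariationOn.exists_monotoneOn_sub_monotoneOn
  obtain ⟨a, ha⟩ := cauchySeq_tendsto_of_complete (cauchySeq_rsSum_of_monotoneOn hT hp x)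
  obtain ⟨b, hb⟩ := cauchySeq_tendsto_of_complete (cauchySeq_rsSum_of_monotoneOn hT hq x)
  refine tendsto_nhds_limUnder ⟨a - b, ?_⟩
  refine (ha.sub hb).congr fun n => ?_
  exact (rsSum_sub_fun hT (fun t _ => by rw [hpq]; rfl) x n).symm

lemma rsIntegral_add (hT : 0 < T) {g : ℝ → ℝ} (hg : BoundedVariationOn g (Set.Icc 0 T))
    (x y : C0 T) : rsIntegral g (x + y) = rsIntegral g x + rsIntegral g y := by
  refine tendsto_nhds_unique (tendsto_rsSum hT hg (x + y)) ?_
  simp_rw [rsSum_add]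
  exact (tendsto_rsSum hT hg x).add (tendsto_rsSum hT hg y)

lemma rsIntegral_smul (hT : 0 < T) {g : ℝ → ℝ} (hg : BoundedVariationOn g (Set.Icc 0 T))
    (c : ℝ) (x : C0 T) : rsIntegral g (c • x) = c * rsIntegral g x := by
  refine tendsto_nhds_unique (tendsto_rsSum hT hg (c • x)) ?_
  simp_rw [rsSum_smul]
  exact (tendsto_rsSum hT hg x).const_mul c

end RiemannStieltjes

/-! ### Step functions on uniform partitions. -/

section Grid

variable {T : ℝ}

/-- The step function on the uniform partition with the values of `g` at the left end points. -/
def gridApprox (T : ℝ) (g : ℝ → ℝ) (n : ℕ) (t : ℝ) : ℝ :=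
  ∑ k ∈ Finset.range n,
    (Set.Ioc (k * T / n : ℝ) ((k + 1) * T / n)).indicator (fun _ => g (k * T / n)) t

lemma exists_gridApprox_eq (hT : 0 < T) {n : ℕ} (hn : 0 < n) {t : ℝ} (ht : t ∈ Set.Ioc 0 T) :
    ∃ k < n, |k * T / n - t| ≤ T / n ∧ ∀ f, gridApprox T f n t = f (k * T / n) := by
  have hn' : (0 : ℝ) < n := Nat.cast_pos.2 hn
  have hpos : 0 < t * n / T := div_pos (mul_pos ht.1 hn') hT
  -- Cells are open on the left, so t lies in the cell numbered ⌈tn/T⌉ - 1. The point 0 is in no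
  -- cell, but it is a null set.
  obtain ⟨k, hk⟩ : ∃ k, ⌈t * n / T⌉₊ = k + 1 :=
    ⟨⌈t * n / T⌉₊ - 1, (Nat.succ_pred_eq_of_pos (Nat.ceil_pos.2 hpos)).symm⟩
  obtain ⟨h1, h2⟩ := (Nat.ceil_eq_iff (Nat.succ_ne_zero k)).1 hk
  simp only [Nat.succ_sub_one] at h1
  rw [lt_div_iff₀ hT, ← div_lt_iff₀ hn'] at h1
  rw [div_le_iff₀ hT, ← le_div_iff₀ hn'] at h2
  push_cast at h2
  have hkn : k < n := by
    have h3 : (k : ℝ) * T / n < T := h1.trans_le ht.2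
    rw [div_lt_iff₀ hn', mul_comm T] at h3
    exact_mod_cast lt_of_mul_lt_mul_right h3 hT.le
  have hstep : ((k : ℝ) + 1) * T / n = k * T / n + T / n := by ring
  refine ⟨k, hkn, ?_, fun f => ?_⟩
  · rw [abs_le]
    constructor <;> linarith [div_pos hT hn']
  · rw [gridApprox, Finset.sum_eq_single k]
    · exact Set.indicator_of_mem (Set.mem_Ioc.2 ⟨h1, h2⟩) _
    · intro j _ hjk
      refine Set.indicator_of_notMem (fun hmem => ?_) _
      rcases lt_or_gt_of_ne hjk with h | h
      · have h4 : ((j : ℝ) + 1) * T / n ≤ k * T / n := by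
          have : ((j : ℝ) + 1) ≤ k := by exact_mod_cast h
          gcongr
        linarith [hmem.2]
      · have h4 : ((k : ℝ) + 1) * T / n ≤ j * T / n := by
          have : ((k : ℝ) + 1) ≤ j := by exact_mod_cast h
          gcongr
        linarith [hmem.1]
    · intro h
      exact absurd (Finset.mem_range.2 hkn) h

lemma tendsto_gridApprox (hT : 0 < T) {f : ℝ → ℝ} {t : ℝ} (ht : t ∈ Set.Ioc 0 T)
    (hf : ContinuousWithinAt f (Set.Icc 0 T) t) :
    Tendsto (fun n => gridApprox T f n t) atTop (𝓝 (f t)) := by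
  rw [Metric.tendsto_atTop]
  intro ε hε
  obtain ⟨δ, hδ, h⟩ := Metric.continuousWithinAt_iff.1 hf ε hε
  obtain ⟨N, hN⟩ := exists_nat_gt (T / δ)
  have hNp : (0 : ℝ) < N := (div_pos hT hδ).trans hN
  refine ⟨N, fun n hn => ?_⟩
  have h1 : (N : ℝ) ≤ n := Nat.cast_le.2 hn
  have hn0 : (0 : ℝ) < n := hNp.trans_le h1
  obtain ⟨k, hk, hkt, hfk⟩ := exists_gridApprox_eq hT (Nat.cast_pos.1 hn0) ht
  rw [hfk f]
  refine h (grid_mem hT hk.le) (lt_of_le_of_lt hkt ?_)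
  rw [div_lt_iff₀ hn0]
  rw [div_lt_iff₀ hδ] at hN
  nlinarith

lemma abs_gridApprox_le (hT : 0 < T) {f : ℝ → ℝ} {C : ℝ} (hC : ∀ t ∈ Set.Icc 0 T, |f t| ≤ C)
    (n : ℕ) {t : ℝ} (ht : t ∈ Set.Ioc 0 T) : |gridApprox T f n t| ≤ C := by
  rcases Nat.eq_zero_or_pos n with rfl | hn
  · simpa [gridApprox] using (abs_nonneg _).trans (hC t ⟨ht.1.le, ht.2⟩)
  · obtain ⟨k, hk, -, hfk⟩ := exists_gridApprox_eq hT hn ht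
    rw [hfk f]
    exact hC _ (grid_mem hT hk.le)

lemma measurable_gridApprox (f : ℝ → ℝ) (n : ℕ) : Measurable (gridApprox T f n) :=
  Finset.measurable_fun_sum _ fun _ _ => measurable_const.indicator measurableSet_Ioc

lemma ae_leb_mem_Ioc : ∀ᵐ t ∂(leb T), t ∈ Set.Ioc 0 T := by
  have h1 : ∀ᵐ t ∂(leb T), t ∈ Set.Icc 0 T := ae_restrict_mem measurableSet_Icc
  have h2 : ∀ᵐ t ∂(leb T), t ≠ 0 := ae_restrict_of_ae (by simp [ae_iff])
  filter_upwards [h1, h2] with t h3 h4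
  exact ⟨lt_of_le_of_ne h3.1 (Ne.symm h4), h3.2⟩

lemma ae_continuousWithinAt_of_bv {g : ℝ → ℝ} (hg : BoundedVariationOn g (Set.Icc 0 T)) :
    ∀ᵐ t ∂(leb T), ContinuousWithinAt g (Set.Icc 0 T) t := by
  obtain ⟨p, q, hp, hq, hpq⟩ :=
    hg.locallyBoundedVariationOn.exists_monotoneOn_sub_monotoneOn
  have h1 : ∀ᵐ t ∂(leb T), t ∈ Set.Icc 0 T := ae_restrict_mem measurableSet_Icc
  have h2 : ∀ᵐ t ∂(leb T), ¬ (t ∈ Set.Icc 0 T ∧ ¬ ContinuousWithinAt p (Set.Icc 0 T) t) :=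
    ae_restrict_of_ae (by
      simpa [ae_iff, and_assoc] using hp.countable_not_continuousWithinAt.measure_zero volume)
  have h3 : ∀ᵐ t ∂(leb T), ¬ (t ∈ Set.Icc 0 T ∧ ¬ ContinuousWithinAt q (Set.Icc 0 T) t) :=
    ae_restrict_of_ae (by
      simpa [ae_iff, and_assoc] using hq.countable_not_continuousWithinAt.measure_zero volume)
  filter_upwards [h1, h2, h3] with t h4 h5 h6
  rw [hpq]
  push Not at h5 h6
  exact (h5 h4).sub (h6 h4)

lemma exists_bound_of_bv (hT : 0 < T) {g : ℝ → ℝ} (hg : BoundedVariationOn g (Set.Icc 0 T)) :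
    ∃ C, ∀ t ∈ Set.Icc 0 T, |g t| ≤ C := by
  refine ⟨|g 0| + (eVariationOn g (Set.Icc 0 T)).toReal, fun t ht => ?_⟩
  have h := hg.dist_le ht (show (0 : ℝ) ∈ Set.Icc 0 T from ⟨le_rfl, hT.le⟩)
  rw [Real.dist_eq] at h
  have := abs_sub_abs_le_abs_sub (g t) (g 0)
  linarith

lemma aestronglyMeasurable_of_bv {g : ℝ → ℝ} (hg : BoundedVariationOn g (Set.Icc 0 T)) :
    AEStronglyMeasurable g (leb T) := by
  obtain ⟨p, q, hp, hq, hpq⟩ :=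
    hg.locallyBoundedVariationOn.exists_monotoneOn_sub_monotoneOn
  rw [hpq]
  exact ((aemeasurable_restrict_of_monotoneOn measurableSet_Icc hp).sub
    (aemeasurable_restrict_of_monotoneOn measurableSet_Icc hq)).aestronglyMeasurable

lemma memLp_of_bv (hT : 0 < T) {g : ℝ → ℝ} (hg : BoundedVariationOn g (Set.Icc 0 T))
    (p : ENNReal) : MemLp g p (leb T) := by
  obtain ⟨C, hC⟩ := exists_bound_of_bv hT hg
  refine MemLp.of_bound (aestronglyMeasurable_of_bv hg) C ?_
  filter_upwards [ae_restrict_mem measurableSet_Icc] with t ht using hC t ht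

lemma memLp_gridApprox (hT : 0 < T) {g : ℝ → ℝ} (hg : BoundedVariationOn g (Set.Icc 0 T))
    (n : ℕ) (p : ENNReal) : MemLp (gridApprox T g n) p (leb T) := by
  obtain ⟨C, hC⟩ := exists_bound_of_bv hT hg
  refine MemLp.of_bound (measurable_gridApprox g n).aestronglyMeasurable C ?_
  filter_upwards [ae_leb_mem_Ioc] with t ht using abs_gridApprox_le hT hC n ht

/-- The sums are integrals of step approximations of g². A function of bounded variation is bounded
and continuous off a countable set, so dominated convergence applies. -/
lemma tendsto_sum_grid_sq (hT : 0 < T) {g : ℝ → ℝ} (hg : BoundedVariationOn g (Set.Icc 0 T)) :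
    Tendsto (fun n : ℕ => ∑ k ∈ Finset.range n, g (k * T / n) ^ 2 * (T / n)) atTop
      (𝓝 (∫ t, g t ^ 2 ∂(leb T))) := by
  obtain ⟨C, hC⟩ := exists_bound_of_bv hT hg
  have h1 : ∀ n : ℕ, ∑ k ∈ Finset.range n, g (k * T / n) ^ 2 * (T / n) =
      ∫ t, gridApprox T (fun t => g t ^ 2) n t ∂(leb T) := by
    intro n
    simp only [gridApprox]
    rw [integral_finsetSum]
    · refine Finset.sum_congr rfl fun k hk => ?_
      have hk' := Finset.mem_range.1 hk
      have hn0 : (0 : ℝ) < n := Nat.cast_pos.2 (by omega)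
      rw [integral_indicator measurableSet_Ioc, setIntegral_const, smul_eq_mul, mul_comm]
      congr 1
      rw [measureReal_restrict_apply measurableSet_Ioc, Set.inter_eq_left.2, Real.volume_real_Ioc,
        max_eq_left]
      · ring
      · have : 0 < T / n := div_pos hT hn0
        have h3 : ((k : ℝ) + 1) * T / n - k * T / n = T / n := by ring
        rw [h3]; exact this.le
      · intro t ht
        exact ⟨(grid_mem hT hk'.le).1.trans ht.1.le, ht.2.trans (grid_succ_mem hT hk').2⟩
    · intro k _
      exact (integrable_const _).indicator measurableSet_Ioc
  simp_rw [h1]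
  refine tendsto_integral_of_dominated_convergence (fun _ => C ^ 2)
    (fun n => (measurable_gridApprox _ n).aestronglyMeasurable) (integrable_const _)
    (fun n => ?_) ?_
  · filter_upwards [ae_leb_mem_Ioc] with t ht
    refine abs_gridApprox_le hT (fun t ht => ?_) n ht
    rw [abs_pow]
    exact pow_le_pow_left₀ (abs_nonneg _) (hC t ht) 2
  · filter_upwards [ae_leb_mem_Ioc, ae_continuousWithinAt_of_bv hg] with t ht hc
    exact tendsto_gridApprox hT ht (hc.pow 2)

lemma exists_ae_bound {h : ℝ → ℝ} (hh : MemLp h ⊤ (leb T)) :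
    ∃ C, 0 ≤ C ∧ ∀ᵐ t ∂(leb T), |h t| ≤ C := by
  have hfin : eLpNormEssSup h (leb T) ≠ ⊤ := by
    rw [← eLpNorm_exponent_top]; exact hh.2.ne
  refine ⟨(eLpNormEssSup h (leb T)).toReal, ENNReal.toReal_nonneg, ?_⟩
  filter_upwards [ae_le_eLpNormEssSup (f := h) (μ := leb T)] with t ht
  have := ENNReal.toReal_mono hfin ht
  simpa using this

lemma tendsto_integral_mul_sub_gridApprox_sq (hT : 0 < T) {g : ℝ → ℝ}
    (hg : BoundedVariationOn g (Set.Icc 0 T)) {h : ℝ → ℝ} (hh : MemLp h ⊤ (leb T)) :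
    Tendsto (fun n : ℕ => ∫ t, (h t * gridApprox T g n t - h t * g t) ^ 2 ∂(leb T)) atTop
      (𝓝 0) := by
  obtain ⟨C, hC⟩ := exists_bound_of_bv hT hg
  obtain ⟨D, hD0, hD⟩ := exists_ae_bound hh
  have h0 : (0 : ℝ) = ∫ t, (h t * g t - h t * g t) ^ 2 ∂(leb T) := by simp
  rw [h0]
  refine tendsto_integral_of_dominated_convergence (fun _ => (D * C + D * C) ^ 2)
    (fun n => ?_) (integrable_const _) (fun n => ?_) ?_
  · exact (((hh.1.mul (measurable_gridApprox g n).aestronglyMeasurable).sub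
      (hh.1.mul (aestronglyMeasurable_of_bv hg))).pow 2)
  · filter_upwards [ae_leb_mem_Ioc, hD] with t ht hd
    rw [norm_pow]
    refine pow_le_pow_left₀ (norm_nonneg _) ((norm_sub_le _ _).trans (add_le_add ?_ ?_)) 2
    · rw [norm_mul]
      exact mul_le_mul hd (abs_gridApprox_le hT hC n ht) (abs_nonneg _) hD0
    · rw [norm_mul]
      exact mul_le_mul hd (hC t ⟨ht.1.le, ht.2⟩) (abs_nonneg _) hD0
  · filter_upwards [ae_leb_mem_Ioc, ae_continuousWithinAt_of_bv hg] with t ht hc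
    exact ((((tendsto_gridApprox hT ht hc).const_mul (h t)).sub_const _).pow 2)

end Grid

/-! ### Riemann-Stieltjes sums and integrals under Wiener measure. -/

section WienerSums

variable {T : ℝ} {W : Measure (C0 T)}

lemma IsWienerMeasure.memLp_pathAt (hW : IsWienerMeasure W) (t : ℝ) :
    MemLp (fun x : C0 T => pathAt x t) 2 W := by
  unfold pathAt
  split_ifs with ht
  · exact (hW.gaussian.hasGaussianLaw_eval ⟨t, ht⟩).memLp_two
  · exact MemLp.zero

lemma IsWienerMeasure.integral_pathAt (hW : IsWienerMeasure W) {t : ℝ} (ht : t ∈ Set.Icc 0 T) :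
    ∫ x : C0 T, pathAt x t ∂W = 0 := by
  simp_rw [fun x : C0 T => pathAt_of_mem x ht]
  exact hW.mean ⟨t, ht⟩

lemma IsWienerMeasure.integral_pathAt_mul (hW : IsWienerMeasure W) {s t : ℝ}
    (hs : s ∈ Set.Icc 0 T) (ht : t ∈ Set.Icc 0 T) :
    ∫ x : C0 T, pathAt x s * pathAt x t ∂W = min s t := by
  simp_rw [fun x : C0 T => pathAt_of_mem x ht, fun x : C0 T => pathAt_of_mem x hs]
  exact hW.cov ⟨s, hs⟩ ⟨t, ht⟩

lemma IsWienerMeasure.integral_increment_mul (hW : IsWienerMeasure W) {a b c d : ℝ}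
    (ha : a ∈ Set.Icc 0 T) (hb : b ∈ Set.Icc 0 T) (hc : c ∈ Set.Icc 0 T)
    (hd : d ∈ Set.Icc 0 T) :
    ∫ x : C0 T, (pathAt x b - pathAt x a) * (pathAt x d - pathAt x c) ∂W =
      min b d - min b c - min a d + min a c := by
  have hi : ∀ s t, Integrable (fun x : C0 T => pathAt x s * pathAt x t) W := fun s t =>
    (hW.memLp_pathAt s).integrable_mul (hW.memLp_pathAt t)
  have h1 : ∀ x : C0 T, (pathAt x b - pathAt x a) * (pathAt x d - pathAt x c) =
      pathAt x b * pathAt x d - pathAt x b * pathAt x c - pathAt x a * pathAt x d +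
        pathAt x a * pathAt x c := fun x => by ring
  simp_rw [h1]
  have hi2 : Integrable (fun x : C0 T => pathAt x b * pathAt x d - pathAt x b * pathAt x c) W :=
    (hi b d).sub (hi b c)
  have hi3 : Integrable (fun x : C0 T => pathAt x b * pathAt x d - pathAt x b * pathAt x c -
      pathAt x a * pathAt x d) W := hi2.sub (hi a d)
  rw [integral_add hi3 (hi a c), integral_sub hi2 (hi a d), integral_sub (hi b d) (hi b c),
    hW.integral_pathAt_mul hb hd, hW.integral_pathAt_mul hb hc, hW.integral_pathAt_mul ha hd,
    hW.integral_pathAt_mul ha hc]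

/-- The sum is a linear image of the Gaussian vector of increments, so mean and variance determine
its law. Increments over different cells are orthogonal, and only the diagonal terms contribute. -/
lemma IsWienerMeasure.centredNormal_rsSum (hW : IsWienerMeasure W) (hT : 0 < T) (g : ℝ → ℝ)
    (n : ℕ) : CentredNormal W (fun x => rsSum g x n)
      (∑ k ∈ Finset.range n, g (k * T / n) ^ 2 * (T / n)) := by
  have hprob := hW.prob
  have hL : MemLp (fun x : C0 T => rsSum g x n) 2 W := by
    refine memLp_finsetSum _ fun k _ => ?_
    exact ((hW.memLp_pathAt _).sub (hW.memLp_pathAt _)).const_mul _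
  have hG : HasGaussianLaw (fun x : C0 T => rsSum g x n) W := by
    have h1 := hW.gaussian.hasGaussianLaw_increments (n := n)
      (t := fun i => ⟨(i : ℕ) * T / n, grid_mem hT (Nat.lt_succ_iff.1 i.2)⟩)
    have h2 := h1.map_fun (∑ i : Fin n, (g ((i : ℕ) * T / n)) •
      (ContinuousLinearMap.proj (R := ℝ) (φ := fun _ : Fin n => ℝ) i))
    refine h2.congr (ae_of_all _ fun x => ?_)
    simp only [sum_apply, smul_apply,
      ContinuousLinearMap.proj_apply, smul_eq_mul, rsSum]
    rw [Finset.sum_range]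
    refine Finset.sum_congr rfl fun i _ => ?_
    have e1 := pathAt_of_mem x (grid_mem hT i.2.le)
    have e2 := pathAt_of_mem x (grid_succ_mem hT i.2)
    rw [e1, e2]
    congr 3
    simp
  have hmean : ∫ x : C0 T, rsSum g x n ∂W = 0 := by
    simp only [rsSum]
    rw [integral_finsetSum]
    · refine Finset.sum_eq_zero fun k hk => ?_
      have hk' := Finset.mem_range.1 hk
      rw [integral_const_mul, integral_sub ((hW.memLp_pathAt _).integrable one_le_two)
        ((hW.memLp_pathAt _).integrable one_le_two), hW.integral_pathAt (grid_mem hT hk'.le),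
        hW.integral_pathAt (grid_succ_mem hT hk')]
      simp
    · intro k _
      exact (((hW.memLp_pathAt _).sub (hW.memLp_pathAt _)).const_mul _).integrable one_le_two
  have hvar : ∫ x : C0 T, rsSum g x n ^ 2 ∂W =
      ∑ k ∈ Finset.range n, g (k * T / n) ^ 2 * (T / n) := by
    have hexp : ∀ x : C0 T, rsSum g x n ^ 2 = ∑ k ∈ Finset.range n, ∑ j ∈ Finset.range n,
        (g (k * T / n) * g (j * T / n)) *
          ((pathAt x ((k + 1) * T / n) - pathAt x (k * T / n)) *
          (pathAt x ((j + 1) * T / n) - pathAt x (j * T / n))) := by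
      intro x
      rw [sq, rsSum, Finset.sum_mul_sum]
      exact Finset.sum_congr rfl fun k _ => Finset.sum_congr rfl fun j _ => by ring
    have hi : ∀ k j : ℕ, Integrable (fun x : C0 T => (g (k * T / n) * g (j * T / n)) *
          ((pathAt x ((k + 1) * T / n) - pathAt x (k * T / n)) *
          (pathAt x ((j + 1) * T / n) - pathAt x (j * T / n)))) W := fun k j =>
      (((hW.memLp_pathAt _).sub (hW.memLp_pathAt _)).integrable_mul
        ((hW.memLp_pathAt _).sub (hW.memLp_pathAt _))).const_mul _
    simp_rw [hexp]
    rw [integral_finsetSum _ fun k _ => integrable_finsetSum _ fun j _ => hi k j]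
    refine Finset.sum_congr rfl fun k hk => ?_
    have hk' := Finset.mem_range.1 hk
    have hn0 : (0 : ℝ) < n := Nat.cast_pos.2 (by omega)
    rw [integral_finsetSum _ fun j _ => hi k j, Finset.sum_eq_single k]
    · rw [integral_const_mul, hW.integral_increment_mul (grid_mem hT hk'.le)
        (grid_succ_mem hT hk') (grid_mem hT hk'.le) (grid_succ_mem hT hk')]
      have h5 : (k : ℝ) * T / n ≤ (k + 1) * T / n := by gcongr; linarith
      rw [min_self, min_self, min_eq_right h5, min_eq_left h5]
      ring
    · intro j hj hjk
      have hj' := Finset.mem_range.1 hj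
      rw [integral_const_mul, hW.integral_increment_mul (grid_mem hT hk'.le)
        (grid_succ_mem hT hk') (grid_mem hT hj'.le) (grid_succ_mem hT hj')]
      have hmono : ∀ a b : ℕ, a < b → ((a : ℝ) + 1) * T / n ≤ b * T / n := fun a b hab => by
        have : (a : ℝ) + 1 ≤ b := by exact_mod_cast hab
        gcongr
      have h5 : (k : ℝ) * T / n ≤ (k + 1) * T / n := by gcongr; linarith
      have h6 : (j : ℝ) * T / n ≤ (j + 1) * T / n := by gcongr; linarith
      rcases lt_or_gt_of_ne hjk with h | h
      · have h7 := hmono j k h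
        rw [min_eq_right ((h7.trans h5)), min_eq_right (h6.trans (h7.trans h5)),
          min_eq_right h7, min_eq_right (h6.trans h7)]
        ring
      · have h7 := hmono k j h
        rw [min_eq_left (h7.trans h6), min_eq_left h7, min_eq_left (h5.trans (h7.trans h6)),
          min_eq_left (h5.trans h7)]
        ring
    · intro h; exact absurd hk h
  refine ⟨(measurable_rsSum g n).aemeasurable, ?_⟩
  rw [hG.map_eq_gaussianReal, hmean,
    variance_of_integral_eq_zero (measurable_rsSum g n).aemeasurable hmean, hvar]

lemma IsWienerMeasure.centredNormal_rsIntegral (hW : IsWienerMeasure W) (hT : 0 < T) {g : ℝ → ℝ}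
    (hg : BoundedVariationOn g (Set.Icc 0 T)) :
    CentredNormal W (fun x => rsIntegral g x) (∫ t, g t ^ 2 ∂(leb T)) := by
  have := hW.prob
  exact centredNormal_of_tendsto_ae
    (fun n => Finset.sum_nonneg fun k _ => by positivity)
    (fun n => hW.centredNormal_rsSum hT g n) (ae_of_all _ fun x => tendsto_rsSum hT hg x)
    (tendsto_sum_grid_sq hT hg)

end WienerSums

/-! ### The Paley-Wiener-Zygmund integral: convergence, law, linearity, joint measurability. -/

section PaleyWienerZygmund

variable {T : ℝ} {W : Measure (C0 T)} {φ : ℕ → ℝ → ℝ}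

lemma eVariationOn_add_le (f g : ℝ → ℝ) (s : Set ℝ) :
    eVariationOn (fun t => f t + g t) s ≤ eVariationOn f s + eVariationOn g s := by
  refine iSup_le fun p => ?_
  calc ∑ i ∈ Finset.range p.1, edist (f (p.2.1 (i + 1)) + g (p.2.1 (i + 1)))
        (f (p.2.1 i) + g (p.2.1 i))
      ≤ ∑ i ∈ Finset.range p.1, (edist (f (p.2.1 (i + 1))) (f (p.2.1 i)) +
          edist (g (p.2.1 (i + 1))) (g (p.2.1 i))) :=
        Finset.sum_le_sum fun i _ => edist_add_add_le _ _ _ _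
    _ ≤ _ := by
        rw [Finset.sum_add_distrib]
        exact add_le_add (eVariationOn.sum_le p.2.2.1 p.2.2.2)
          (eVariationOn.sum_le p.2.2.1 p.2.2.2)

lemma boundedVariationOn_sum {s : Set ℝ} (I : Finset ℕ) (c : ℕ → ℝ) {g : ℕ → ℝ → ℝ}
    (hg : ∀ j, BoundedVariationOn (g j) s) :
    BoundedVariationOn (fun t => ∑ j ∈ I, c j * g j t) s := by
  classical
  have hconst : ∀ a : ℝ, BoundedVariationOn (fun _ : ℝ => a) s := fun a => by
    have h : eVariationOn (fun _ : ℝ => a) s = 0 :=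
      eVariationOn.constant_on (by rintro _ ⟨x, _, rfl⟩ _ ⟨y, _, rfl⟩; rfl)
    simp [BoundedVariationOn, h]
  induction I using Finset.induction_on with
  | empty => simpa using hconst 0
  | insert j I hj ih =>
    simp only [Finset.sum_insert hj]
    exact ne_top_of_le_ne_top (ENNReal.add_ne_top.2 ⟨(hconst (c j)).mul (hg j), ih⟩)
      (eVariationOn_add_le _ _ _)

/-- The `j`-th Fourier coefficient of `u` in `L_2[0,T]`. -/
def coef (T : ℝ) (φ : ℕ → ℝ → ℝ) (u : ℝ → ℝ) (j : ℕ) : ℝ := ∫ t, u t * φ j t ∂(leb T)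

/-- The `n`-th partial sum of the Fourier expansion of `u`. -/
def proj (T : ℝ) (φ : ℕ → ℝ → ℝ) (u : ℝ → ℝ) (n : ℕ) (t : ℝ) : ℝ :=
  ∑ j ∈ Finset.range n, coef T φ u j * φ j t

lemma pwzSum_eq (u : ℝ → ℝ) (x : C0 T) (n : ℕ) :
    pwzSum φ u x n = ∑ j ∈ Finset.range n, coef T φ u j * rsIntegral (φ j) x := rfl

lemma integral_sum_sq (hT : 0 < T) (hφ : IsBVBasis T φ) (s : Finset ℕ) (c : ℕ → ℝ) :
    ∫ t, (∑ j ∈ s, c j * φ j t) ^ 2 ∂(leb T) = ∑ j ∈ s, c j ^ 2 := by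
  have hi : ∀ i j, Integrable (fun t => φ i t * φ j t) (leb T) := fun i j =>
    (memLp_of_bv hT (hφ.bv i) 2).integrable_mul (memLp_of_bv hT (hφ.bv j) 2)
  have h1 : ∀ t, (∑ j ∈ s, c j * φ j t) ^ 2 =
      ∑ i ∈ s, ∑ j ∈ s, (c i * c j) * (φ i t * φ j t) := fun t => by
    rw [sq, Finset.sum_mul_sum]
    exact Finset.sum_congr rfl fun i _ => Finset.sum_congr rfl fun j _ => by ring
  simp only [h1]
  rw [integral_finsetSum _ fun i _ => integrable_finsetSum _ fun j _ => (hi i j).const_mul _]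
  refine Finset.sum_congr rfl fun i hi' => ?_
  rw [integral_finsetSum _ fun j _ => (hi i j).const_mul _]
  simp only [integral_const_mul, hφ.orthonormal]
  simp [hi', sq]

/-- Parseval's identity: completeness of φ says that the orthogonal complement of its span is
trivial, so φ is a Hilbert basis. -/
lemma hasSum_coef_sq (hT : 0 < T) (hφ : IsBVBasis T φ) {u : ℝ → ℝ} (hu : MemLp u 2 (leb T)) :
    HasSum (fun j => coef T φ u j ^ 2) (∫ t, u t ^ 2 ∂(leb T)) := by
  let v : ℕ → L2 T := fun j => (memLp_of_bv hT (hφ.bv j) 2).toLp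
  have hin : ∀ {f g : ℝ → ℝ} (hf : MemLp f 2 (leb T)) (hg : MemLp g 2 (leb T)),
      inner ℝ (hf.toLp f) (hg.toLp g) = ∫ t, f t * g t ∂(leb T) := fun hf hg => by
    rw [L2.inner_def]
    refine integral_congr_ae ?_
    filter_upwards [hf.coeFn_toLp, hg.coeFn_toLp] with t h1 h2
    simp [h1, h2, mul_comm]
  have hv : Orthonormal ℝ v := by
    rw [orthonormal_iff_ite]
    intro i j
    rw [hin, hφ.orthonormal]
  have hbot : (Submodule.span ℝ (Set.range v))ᗮ = ⊥ := by
    rw [Submodule.eq_bot_iff]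
    intro w hw
    have hw' : ∀ j, ∫ t, w t * φ j t ∂(leb T) = 0 := fun j => by
      have h := hw (v j) (Submodule.subset_span ⟨j, rfl⟩)
      rw [← h, ← Lp.toLp_coeFn w (Lp.memLp w), hin]
      refine integral_congr_ae ?_
      filter_upwards [(Lp.memLp w).coeFn_toLp] with t ht
      rw [ht, mul_comm]
    exact (Lp.eq_zero_iff_ae_eq_zero).2 (hφ.complete w (Lp.memLp w) hw')
  let b := HilbertBasis.mkOfOrthogonalEqBot hv hbot
  have hb : ∀ j, b j = v j := fun j => by
    rw [HilbertBasis.coe_mkOfOrthogonalEqBot]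
  have h := b.hasSum_inner_mul_inner (hu.toLp u) (hu.toLp u)
  rw [hin] at h
  have hj : ∀ j, inner ℝ (hu.toLp u) (b j) * inner ℝ (b j) (hu.toLp u) = coef T φ u j ^ 2 := by
    intro j
    rw [hb, real_inner_comm, hin, coef, sq]
    simp only [mul_comm]
  simp only [hj] at h
  simpa only [sq] using h

lemma memLp_proj (hT : 0 < T) (hφ : IsBVBasis T φ) (u : ℝ → ℝ) (n : ℕ) (p : ENNReal) :
    MemLp (proj T φ u n) p (leb T) :=
  memLp_finsetSum _ fun j _ => (memLp_of_bv hT (hφ.bv j) p).const_mul _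

lemma integral_sub_proj_sq (hT : 0 < T) (hφ : IsBVBasis T φ) {u : ℝ → ℝ}
    (hu : MemLp u 2 (leb T)) (n : ℕ) :
    ∫ t, (u t - proj T φ u n t) ^ 2 ∂(leb T) =
      ∫ t, u t ^ 2 ∂(leb T) - ∑ j ∈ Finset.range n, coef T φ u j ^ 2 := by
  have hP := memLp_proj hT hφ u n 2
  have h1 : Integrable (fun t => u t ^ 2) (leb T) := hu.integrable_sq
  have h2 : Integrable (fun t => proj T φ u n t ^ 2) (leb T) := hP.integrable_sq
  have h3 : Integrable (fun t => 2 * (u t * proj T φ u n t)) (leb T) :=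
    (hu.integrable_mul hP).const_mul 2
  have h12 : Integrable (fun t => u t ^ 2 + proj T φ u n t ^ 2) (leb T) := h1.add h2
  have hE : ∀ t, (u t - proj T φ u n t) ^ 2 =
      (u t ^ 2 + proj T φ u n t ^ 2) - 2 * (u t * proj T φ u n t) := fun t => by ring
  have hc : ∫ t, u t * proj T φ u n t ∂(leb T) = ∑ j ∈ Finset.range n, coef T φ u j ^ 2 := by
    have : ∀ t, u t * proj T φ u n t =
        ∑ j ∈ Finset.range n, coef T φ u j * (u t * φ j t) := fun t => by
      rw [proj, Finset.mul_sum]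
      exact Finset.sum_congr rfl fun j _ => by ring
    simp only [this]
    have hi : ∀ j, Integrable (fun t => u t * φ j t) (leb T) := fun j =>
      hu.integrable_mul (memLp_of_bv hT (hφ.bv j) 2)
    rw [integral_finsetSum _ fun j _ => (hi j).const_mul _]
    simp only [integral_const_mul]
    exact Finset.sum_congr rfl fun j _ => by rw [sq]; rfl
  simp only [hE]
  rw [integral_sub h12 h3, integral_add h1 h2, integral_const_mul, hc]
  have := integral_sum_sq hT hφ (Finset.range n) (coef T φ u)
  simp only [proj]
  linarith

lemma tendsto_integral_sub_proj_sq (hT : 0 < T) (hφ : IsBVBasis T φ) {u : ℝ → ℝ}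
    (hu : MemLp u 2 (leb T)) :
    Tendsto (fun n => ∫ t, (u t - proj T φ u n t) ^ 2 ∂(leb T)) atTop (𝓝 0) := by
  simp only [integral_sub_proj_sq hT hφ hu]
  have h := (hasSum_coef_sq hT hφ hu).tendsto_sum_nat.const_sub (∫ t, u t ^ 2 ∂(leb T))
  rwa [sub_self] at h

lemma rsIntegral_sum (hT : 0 < T) (hφ : IsBVBasis T φ) (s : Finset ℕ) (c : ℕ → ℝ) (x : C0 T) :
    rsIntegral (fun t => ∑ j ∈ s, c j * φ j t) x = ∑ j ∈ s, c j * rsIntegral (φ j) x := by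
  refine tendsto_nhds_unique (tendsto_rsSum hT (boundedVariationOn_sum s c hφ.bv) x) ?_
  simp only [rsSum_sum_fun]
  exact tendsto_finsetSum _ fun j _ => (tendsto_rsSum hT (hφ.bv j) x).const_mul _

lemma centredNormal_sum_rsIntegral (hW : IsWienerMeasure W) (hT : 0 < T) (hφ : IsBVBasis T φ)
    (s : Finset ℕ) (c : ℕ → ℝ) :
    CentredNormal W (fun x => ∑ j ∈ s, c j * rsIntegral (φ j) x) (∑ j ∈ s, c j ^ 2) := by
  refine (hW.centredNormal_rsIntegral hT (boundedVariationOn_sum s c hφ.bv)).congr ?_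
    (integral_sum_sq hT hφ s c)
  exact ae_of_all _ fun x => (rsIntegral_sum hT hφ s c x).symm

/-- Convergence of the partial sums that define the Paley-Wiener-Zygmund integral. -/
def PwzConv (φ : ℕ → ℝ → ℝ) (u : ℝ → ℝ) (x : C0 T) : Prop :=
  ∃ l : ℝ, Tendsto (pwzSum φ u x) atTop (𝓝 l)

lemma PwzConv.tendsto {u : ℝ → ℝ} {x : C0 T} (h : PwzConv φ u x) :
    Tendsto (pwzSum φ u x) atTop (𝓝 (pwz φ u x)) := by
  have h' : pwz φ u x = h.choose := dif_pos h
  exact h' ▸ h.choose_spec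

lemma pwz_eq_of_tendsto {u : ℝ → ℝ} {x : C0 T} {l : ℝ} (h : Tendsto (pwzSum φ u x) atTop (𝓝 l)) :
    pwz φ u x = l :=
  tendsto_nhds_unique (PwzConv.tendsto ⟨l, h⟩) h

lemma coef_congr {u v : ℝ → ℝ} (h : u =ᵐ[leb T] v) : coef T φ u = coef T φ v := by
  ext j
  exact integral_congr_ae (h.mono fun t ht => by simp only [ht])

lemma pwzSum_congr {u v : ℝ → ℝ} (h : u =ᵐ[leb T] v) (x : C0 T) :
    pwzSum φ u x = pwzSum φ v x := by
  ext n
  rw [pwzSum_eq, pwzSum_eq, coef_congr h]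

lemma pwz_congr {u v : ℝ → ℝ} (h : u =ᵐ[leb T] v) (x : C0 T) : pwz φ u x = pwz φ v x := by
  unfold pwz
  rw [pwzSum_congr h x]

lemma measurable_pwzSum (u : ℝ → ℝ) (n : ℕ) : Measurable fun x : C0 T => pwzSum φ u x n :=
  Finset.measurable_fun_sum _ fun j _ => (measurable_rsIntegral (φ j)).const_mul _

lemma centredNormal_pwzSum_sub (hW : IsWienerMeasure W) (hT : 0 < T) (hφ : IsBVBasis T φ)
    (u : ℝ → ℝ) {n m : ℕ} (h : n ≤ m) :
    CentredNormal W (fun x => pwzSum φ u x m - pwzSum φ u x n)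
      (∑ j ∈ Finset.Ico n m, coef T φ u j ^ 2) := by
  refine (centredNormal_sum_rsIntegral hW hT hφ (Finset.Ico n m) (coef T φ u)).congr
    (ae_of_all _ fun x => ?_) rfl
  simp only [pwzSum_eq]
  rw [Finset.sum_Ico_eq_sub _ h]

/-- Differences of partial sums are normal with variance a block of the convergent series of squared
Fourier coefficients. -/
lemma ae_pwzConv (hW : IsWienerMeasure W) (hT : 0 < T) (hφ : IsBVBasis T φ) {u : ℝ → ℝ}
    (hu : MemLp u 2 (leb T)) : ∀ᵐ x ∂W, PwzConv φ u x := by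
  have := hW.prob
  exact ae_exists_tendsto_of_centredNormal (C := 1) (fun n => (measurable_pwzSum u n).aemeasurable)
    (fun n => sq_nonneg _) (hasSum_coef_sq hT hφ hu).summable
    (v := fun n m => ∑ j ∈ Finset.Ico n m, coef T φ u j ^ 2)
    (fun n m => Finset.sum_nonneg fun j _ => sq_nonneg _) (fun n m _ => by simp)
    fun n m h => centredNormal_pwzSum_sub hW hT hφ u h

lemma centredNormal_pwz (hW : IsWienerMeasure W) (hT : 0 < T) (hφ : IsBVBasis T φ) {u : ℝ → ℝ}
    (hu : MemLp u 2 (leb T)) : CentredNormal W (fun x => pwz φ u x) (∫ t, u t ^ 2 ∂(leb T)) := by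
  have := hW.prob
  refine centredNormal_of_tendsto_ae (v := fun n => ∑ j ∈ Finset.range n, coef T φ u j ^ 2)
    (Y := fun n x => pwzSum φ u x n)
    (fun n => Finset.sum_nonneg fun j _ => sq_nonneg _)
    (fun n => centredNormal_sum_rsIntegral hW hT hφ (Finset.range n) (coef T φ u)) ?_
    (hasSum_coef_sq hT hφ hu).tendsto_sum_nat
  filter_upwards [ae_pwzConv hW hT hφ hu] with x hx using hx.tendsto

lemma coef_add_mul (hT : 0 < T) (hφ : IsBVBasis T φ) {u v : ℝ → ℝ} (hu : MemLp u 2 (leb T))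
    (hv : MemLp v 2 (leb T)) (a b : ℝ) (j : ℕ) :
    coef T φ (fun t => a * u t + b * v t) j = a * coef T φ u j + b * coef T φ v j := by
  have hφj := memLp_of_bv hT (hφ.bv j) 2
  have h1 : Integrable (fun t => a * (u t * φ j t)) (leb T) := (hu.integrable_mul hφj).const_mul a
  have h2 : Integrable (fun t => b * (v t * φ j t)) (leb T) := (hv.integrable_mul hφj).const_mul b
  rw [coef, coef, coef, ← integral_const_mul, ← integral_const_mul, ← integral_add h1 h2]
  exact integral_congr_ae (ae_of_all _ fun t => by simp only []; ring)

lemma tendsto_pwzSum_add_mul (hT : 0 < T) (hφ : IsBVBasis T φ) {u v : ℝ → ℝ}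
    (hu : MemLp u 2 (leb T)) (hv : MemLp v 2 (leb T)) (a b : ℝ) {x : C0 T}
    (hux : PwzConv φ u x) (hvx : PwzConv φ v x) :
    Tendsto (pwzSum φ (fun t => a * u t + b * v t) x) atTop
      (𝓝 (a * pwz φ u x + b * pwz φ v x)) := by
  refine ((hux.tendsto.const_mul a).add (hvx.tendsto.const_mul b)).congr fun n => ?_
  simp only [pwzSum_eq, coef_add_mul hT hφ hu hv, Finset.mul_sum, ← Finset.sum_add_distrib]
  exact Finset.sum_congr rfl fun j _ => by ring

lemma ae_pwz_add_mul (hW : IsWienerMeasure W) (hT : 0 < T) (hφ : IsBVBasis T φ) {u v : ℝ → ℝ}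
    (hu : MemLp u 2 (leb T)) (hv : MemLp v 2 (leb T)) (a b : ℝ) :
    ∀ᵐ x ∂W, pwz φ (fun t => a * u t + b * v t) x = a * pwz φ u x + b * pwz φ v x := by
  filter_upwards [ae_pwzConv hW hT hφ hu, ae_pwzConv hW hT hφ hv] with x hux hvx
  exact pwz_eq_of_tendsto (tendsto_pwzSum_add_mul hT hφ hu hv a b hux hvx)

lemma pwzSum_add_smul (hT : 0 < T) (hφ : IsBVBasis T φ) (u : ℝ → ℝ) (s : ℝ) (y z : C0 T) (n : ℕ) :
    pwzSum φ u (y + s • z) n = pwzSum φ u y n + s * pwzSum φ u z n := by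
  simp only [pwzSum_eq, rsIntegral_add hT (hφ.bv _), rsIntegral_smul hT (hφ.bv _), Finset.mul_sum,
    ← Finset.sum_add_distrib]
  exact Finset.sum_congr rfl fun j _ => by ring

lemma PwzConv.tendsto_add_smul (hT : 0 < T) (hφ : IsBVBasis T φ) {u : ℝ → ℝ} {y z : C0 T}
    (hy : PwzConv φ u y) (hz : PwzConv φ u z) (s : ℝ) :
    Tendsto (pwzSum φ u (y + s • z)) atTop (𝓝 (pwz φ u y + s * pwz φ u z)) :=
  (hy.tendsto.add (hz.tendsto.const_mul s)).congr fun n => (pwzSum_add_smul hT hφ u s y z n).symm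

/-- The partial sums are linear in every path. The limit is linear where both series converge;
elsewhere the default value 0 can destroy linearity, which is why domains are carried along. -/
lemma PwzConv.pwz_add_smul (hT : 0 < T) (hφ : IsBVBasis T φ) {u : ℝ → ℝ} {y z : C0 T}
    (hy : PwzConv φ u y) (hz : PwzConv φ u z) (s : ℝ) :
    pwz φ u (y + s • z) = pwz φ u y + s * pwz φ u z :=
  pwz_eq_of_tendsto (hy.tendsto_add_smul hT hφ hz s)

lemma pwzSum_smul (hT : 0 < T) (hφ : IsBVBasis T φ) (u : ℝ → ℝ) (s : ℝ) (z : C0 T) (n : ℕ) :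
    pwzSum φ u (s • z) n = s * pwzSum φ u z n := by
  simp only [pwzSum_eq, rsIntegral_smul hT (hφ.bv _), Finset.mul_sum]
  exact Finset.sum_congr rfl fun j _ => by ring

lemma PwzConv.smul (hT : 0 < T) (hφ : IsBVBasis T φ) {u : ℝ → ℝ} {z : C0 T}
    (hz : PwzConv φ u z) (s : ℝ) : PwzConv φ u (s • z) :=
  ⟨_, (hz.tendsto.const_mul s).congr fun n => (pwzSum_smul hT hφ u s z n).symm⟩

lemma PwzConv.pwz_smul (hT : 0 < T) (hφ : IsBVBasis T φ) {u : ℝ → ℝ} {z : C0 T}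
    (hz : PwzConv φ u z) (s : ℝ) : pwz φ u (s • z) = s * pwz φ u z :=
  pwz_eq_of_tendsto ((hz.tendsto.const_mul s).congr fun n => (pwzSum_smul hT hφ u s z n).symm)

lemma measurable_coef (hT : 0 < T) (hφ : IsBVBasis T φ) (j : ℕ) :
    Measurable fun u : L2 T => coef T φ u j := by
  have h : (fun u : L2 T => coef T φ u j) =
      fun u => inner ℝ ((memLp_of_bv hT (hφ.bv j) 2).toLp (φ j)) u := by
    ext u
    rw [L2.inner_def]
    refine integral_congr_ae ?_
    filter_upwards [(memLp_of_bv hT (hφ.bv j) 2).coeFn_toLp] with t ht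
    simp [ht]
  rw [h]
  exact (continuous_const.inner continuous_id).measurable

lemma measurable_pwzSum_uncurry (hT : 0 < T) (hφ : IsBVBasis T φ) (n : ℕ) :
    Measurable fun p : L2 T × C0 T => pwzSum φ p.1 p.2 n :=
  Finset.measurable_fun_sum _ fun j _ => ((measurable_coef hT hφ j).comp measurable_fst).mul
    ((measurable_rsIntegral (φ j)).comp measurable_snd)

lemma measurableSet_pwzConv (hT : 0 < T) (hφ : IsBVBasis T φ) :
    MeasurableSet {p : L2 T × C0 T | PwzConv φ p.1 p.2} :=
  measurableSet_exists_tendsto fun n => measurable_pwzSum_uncurry hT hφ n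

/-- Joint measurability in (u, x) is what the later uses of Fubini need. Cutting the partial sums
off outside the measurable set of convergence reproduces the default value 0. -/
lemma measurable_pwz_uncurry (hT : 0 < T) (hφ : IsBVBasis T φ) :
    Measurable fun p : L2 T × C0 T => pwz φ p.1 p.2 := by
  classical
  have hD := measurableSet_pwzConv hT hφ
  refine measurable_of_tendsto_metrizable
    (f := fun n => {p : L2 T × C0 T | PwzConv φ p.1 p.2}.indicator
      fun p => pwzSum φ p.1 p.2 n)
    (fun n => (measurable_pwzSum_uncurry hT hφ n).indicator hD) ?_
  rw [tendsto_pi_nhds]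
  intro p
  by_cases hp : PwzConv φ p.1 p.2
  · simpa [Set.indicator, hp] using hp.tendsto
  · have : pwz φ p.1 p.2 = 0 := dif_neg hp
    simp [Set.indicator, hp, this]

end PaleyWienerZygmund

/-! ### The Borel structure of path space through evaluations. -/

section EvaluationMeasurability

variable {T : ℝ}

lemma C0.dist_le_iff {D : Set (Set.Icc (0 : ℝ) T)} (hD : Dense D) (y z : C0 T) {r : ℝ}
    (hr : 0 ≤ r) : dist y z ≤ r ↔ ∀ t ∈ D, |y.1 t - z.1 t| ≤ r := by
  have h1 : dist y z = dist y.1 z.1 := rfl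
  rw [h1, ContinuousMap.dist_le hr]
  refine ⟨fun h t _ => h t, fun h t => ?_⟩
  have hc : IsClosed {t | dist (y.1 t) (z.1 t) ≤ r} :=
    isClosed_le (by fun_prop) continuous_const
  have hsub : D ⊆ {t | dist (y.1 t) (z.1 t) ≤ r} := fun t ht => by
    simpa [Real.dist_eq] using h t ht
  exact hc.closure_subset_iff.2 hsub (hD t)

/-- By continuity of paths a closed ball is cut out by countably many evaluations, and by
separability every open set is a countable union of closed balls. -/
lemma measurable_of_eval {Ω : Type*} [MeasurableSpace Ω] {D : Set (Set.Icc (0 : ℝ) T)}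
    (hDc : D.Countable) (hD : Dense D) {Z : Ω → C0 T}
    (hZ : ∀ t ∈ D, Measurable fun ω => (Z ω).1 t) : Measurable Z := by
  have hball : ∀ (c : C0 T) (r : ℝ), 0 ≤ r → MeasurableSet (Z ⁻¹' Metric.closedBall c r) := by
    intro c r hr
    have : Z ⁻¹' Metric.closedBall c r = ⋂ t ∈ D, {ω | |(Z ω).1 t - c.1 t| ≤ r} := by
      ext ω
      simp only [Set.mem_preimage, Metric.mem_closedBall, Set.mem_iInter, Set.mem_ofPred_eq]
      exact C0.dist_le_iff hD _ _ hr
    rw [this]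
    refine MeasurableSet.biInter hDc fun t ht => measurableSet_le ?_ measurable_const
    exact ((hZ t ht).sub_const _).abs
  refine measurable_of_isOpen fun U hU => ?_
  have hUeq : U = ⋃ (p : ℕ × ℕ) (_ : Metric.closedBall (TopologicalSpace.denseSeq (C0 T) p.1)
      (1 / ((p.2 : ℝ) + 1)) ⊆ U),
      Metric.closedBall (TopologicalSpace.denseSeq (C0 T) p.1) (1 / ((p.2 : ℝ) + 1)) := by
    refine Set.Subset.antisymm (fun x hx => ?_) (Set.iUnion₂_subset fun p hp => hp)
    obtain ⟨ε, hε, hεU⟩ := Metric.isOpen_iff.1 hU x hx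
    obtain ⟨k, hk⟩ := exists_nat_one_div_lt (half_pos hε)
    obtain ⟨n, hn⟩ := (TopologicalSpace.denseRange_denseSeq (C0 T)).exists_dist_lt x
      (Nat.one_div_pos_of_nat (α := ℝ) (n := k))
    refine Set.mem_iUnion₂.2 ⟨(n, k), fun y hy => hεU ?_, ?_⟩
    · rw [Metric.mem_closedBall] at hy
      rw [Metric.mem_ball]
      have := dist_triangle_right y x (TopologicalSpace.denseSeq (C0 T) n)
      simp only at hy
      linarith
    · exact Metric.mem_closedBall.2 hn.le
  rw [hUeq, Set.preimage_iUnion₂]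
  exact MeasurableSet.iUnion fun p => MeasurableSet.iUnion fun _ =>
    hball _ _ Nat.one_div_pos_of_nat.le

end EvaluationMeasurability

/-! ### Limits of Paley-Wiener-Zygmund integrals and variance bounds. -/

section PaleyWienerZygmundLimits

variable {T : ℝ} {W : Measure (C0 T)} {φ : ℕ → ℝ → ℝ}

lemma memLp_two_mul {h g : ℝ → ℝ} (hh : MemLp h ⊤ (leb T)) (hg : MemLp g 2 (leb T)) :
    MemLp (fun t => h t * g t) 2 (leb T) :=
  hg.mul' hh

lemma memLp_two_of_top {h : ℝ → ℝ} (hh : MemLp h ⊤ (leb T)) : MemLp h 2 (leb T) :=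
  hh.mono_exponent le_top

lemma centredNormal_pwz_sub (hW : IsWienerMeasure W) (hT : 0 < T) (hφ : IsBVBasis T φ)
    {u v : ℝ → ℝ} (hu : MemLp u 2 (leb T)) (hv : MemLp v 2 (leb T)) :
    CentredNormal W (fun x => pwz φ u x - pwz φ v x) (∫ t, (u t - v t) ^ 2 ∂(leb T)) := by
  refine (centredNormal_pwz hW hT hφ (hu.sub hv)).congr ?_ rfl
  filter_upwards [ae_pwz_add_mul hW hT hφ hu hv 1 (-1)] with x hx
  have h1 : u - v = fun t => 1 * u t + -1 * v t := by
    ext t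
    simp only [Pi.sub_apply]
    ring
  rw [h1, hx]
  ring

/-- The pointwise limit Z and the mean-square limit ⟨u,·⟩ are both limits in measure of the same
sequence, hence agree almost surely. -/
lemma ae_eq_pwz_of_tendsto (hW : IsWienerMeasure W) (hT : 0 < T) (hφ : IsBVBasis T φ)
    {g : ℕ → ℝ → ℝ} {u : ℝ → ℝ} (hg : ∀ n, MemLp (g n) 2 (leb T)) (hu : MemLp u 2 (leb T))
    (h0 : Tendsto (fun n => ∫ t, (g n t - u t) ^ 2 ∂(leb T)) atTop (𝓝 0))
    {Y : ℕ → C0 T → ℝ} {Z : C0 T → ℝ} (hY : ∀ n, ∀ᵐ x ∂W, Y n x = pwz φ (g n) x)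
    (hYZ : ∀ᵐ x ∂W, Tendsto (fun n => Y n x) atTop (𝓝 (Z x))) :
    ∀ᵐ x ∂W, Z x = pwz φ u x := by
  have := hW.prob
  have hm : ∀ n, AEStronglyMeasurable (Y n) W := fun n =>
    (centredNormal_pwz hW hT hφ (hg n)).aemeasurable.aestronglyMeasurable.congr
      ((hY n).mono fun x hx => hx.symm)
  refine tendstoInMeasure_ae_unique (tendstoInMeasure_of_tendsto_ae hm hYZ)
    (tendstoInMeasure_of_centredNormal (v := fun n => ∫ t, (g n t - u t) ^ 2 ∂(leb T))
      (fun n => integral_nonneg fun t => sq_nonneg _) (fun n => ?_) h0 hm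
      (centredNormal_pwz hW hT hφ hu).aemeasurable.aestronglyMeasurable)
  exact (centredNormal_pwz_sub hW hT hφ (hg n) hu).congr
    ((hY n).mono fun x hx => by simp only [hx]) rfl

lemma pwz_zero_fun (x : C0 T) : pwz φ (fun _ => 0) x = 0 := by
  refine pwz_eq_of_tendsto (tendsto_const_nhds.congr fun n => ?_)
  simp [pwzSum]

lemma ae_pwz_sum (hW : IsWienerMeasure W) (hT : 0 < T) (hφ : IsBVBasis T φ) (s : Finset ℕ)
    (c : ℕ → ℝ) {g : ℕ → ℝ → ℝ} (hg : ∀ j, MemLp (g j) 2 (leb T)) :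
    ∀ᵐ x ∂W, pwz φ (fun t => ∑ j ∈ s, c j * g j t) x = ∑ j ∈ s, c j * pwz φ (g j) x := by
  classical
  induction s using Finset.induction_on with
  | empty => simp [pwz_zero_fun]
  | insert j s hj ih =>
    have hs : MemLp (fun t => ∑ j ∈ s, c j * g j t) 2 (leb T) :=
      memLp_finsetSum _ fun j _ => (hg j).const_mul _
    filter_upwards [ih, ae_pwz_add_mul hW hT hφ (hg j) hs (c j) 1] with x hx hx'
    simp only [Finset.sum_insert hj]
    simp only [one_mul] at hx'
    rw [hx', hx]

lemma integral_mul_sq_le {h g : ℝ → ℝ} {C : ℝ} (hh : MemLp h ⊤ (leb T))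
    (hC : ∀ᵐ t ∂(leb T), |h t| ≤ C) (hg : MemLp g 2 (leb T)) :
    ∫ t, (h t * g t) ^ 2 ∂(leb T) ≤ C ^ 2 * ∫ t, g t ^ 2 ∂(leb T) := by
  rw [← integral_const_mul]
  refine integral_mono_ae (memLp_two_mul hh hg).integrable_sq (hg.integrable_sq.const_mul _) ?_
  filter_upwards [hC] with t ht
  simp only [mul_pow]
  exact mul_le_mul_of_nonneg_right (sq_le_sq.2 (ht.trans (le_abs_self C))) (sq_nonneg _)

lemma integral_indicator_Ioc_sq_le {h : ℝ → ℝ} {C : ℝ} (hh : MemLp h ⊤ (leb T))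
    (hC : ∀ᵐ t ∂(leb T), |h t| ≤ C) {a b : ℝ} (hab : a ≤ b) :
    ∫ t, ((Set.Ioc a b).indicator h t) ^ 2 ∂(leb T) ≤ C ^ 2 * (b - a) := by
  have h1 : ∀ t, (Set.Ioc a b).indicator h t = h t * (Set.Ioc a b).indicator (fun _ => 1) t :=
    fun t => by by_cases ht : t ∈ Set.Ioc a b <;> simp [ht]
  have hI : MemLp ((Set.Ioc a b).indicator fun _ : ℝ => (1 : ℝ)) 2 (leb T) :=
    (memLp_const 1).indicator measurableSet_Ioc
  simp only [h1]
  refine (integral_mul_sq_le hh hC hI).trans (mul_le_mul_of_nonneg_left ?_ (sq_nonneg C))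
  have h2 : ∀ t, ((Set.Ioc a b).indicator (fun _ : ℝ => (1 : ℝ)) t) ^ 2 =
      (Set.Ioc a b).indicator (fun _ => 1) t :=
    fun t => by by_cases ht : t ∈ Set.Ioc a b <;> simp [ht]
  simp only [h2]
  rw [integral_indicator measurableSet_Ioc]
  simp only [integral_const, smul_eq_mul, mul_one, measureReal_def, Measure.restrict_apply_univ]
  refine ENNReal.toReal_le_of_le_ofReal (sub_nonneg.2 hab) ?_
  calc leb T (Set.Ioc a b) ≤ volume (Set.Ioc a b) := Measure.restrict_apply_le _ _
    _ = _ := Real.volume_Ioc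

lemma indicator_Ioc_eq (h : ℝ → ℝ) {a b : ℝ} (ha : 0 ≤ a) (hab : a ≤ b) (t : ℝ) :
    (Set.Ioc a b).indicator h t =
      1 * (Set.Icc 0 b).indicator h t + -1 * (Set.Icc 0 a).indicator h t := by
  simp only [Set.indicator, Set.mem_Ioc, Set.mem_Icc]
  split_ifs <;> grind

lemma memLp_indicator {h : ℝ → ℝ} (hh : MemLp h ⊤ (leb T)) {s : Set ℝ} (hs : MeasurableSet s) :
    MemLp (s.indicator h) 2 (leb T) :=
  (memLp_two_of_top hh).indicator hs

lemma integral_indicator_Icc_sub_sq_le {h : ℝ → ℝ} {C : ℝ} (hh : MemLp h ⊤ (leb T))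
    (hC : ∀ᵐ t ∂(leb T), |h t| ≤ C) {a b : ℝ} (ha : 0 ≤ a) (hb : 0 ≤ b) :
    ∫ t, ((Set.Icc 0 a).indicator h t - (Set.Icc 0 b).indicator h t) ^ 2 ∂(leb T) ≤
      C ^ 2 * |a - b| := by
  rcases le_total a b with hab | hab
  · have h1 : ∀ t, ((Set.Icc 0 a).indicator h t - (Set.Icc 0 b).indicator h t) ^ 2 =
        ((Set.Ioc a b).indicator h t) ^ 2 := fun t => by rw [indicator_Ioc_eq h ha hab]; ring
    simp only [h1]
    rw [abs_sub_comm, abs_of_nonneg (sub_nonneg.2 hab)]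
    exact integral_indicator_Ioc_sq_le hh hC hab
  · have h1 : ∀ t, ((Set.Icc 0 a).indicator h t - (Set.Icc 0 b).indicator h t) ^ 2 =
        ((Set.Ioc b a).indicator h t) ^ 2 := fun t => by rw [indicator_Ioc_eq h hb hab]; ring
    simp only [h1]
    rw [abs_of_nonneg (sub_nonneg.2 hab)]
    exact integral_indicator_Ioc_sq_le hh hC hab

end PaleyWienerZygmundLimits

/-! ### The process Z_h and integrals along its paths. -/

section GaussianPaths

variable {T : ℝ} {W : Measure (C0 T)} {φ : ℕ → ℝ → ℝ}

lemma exists_path_of_modulus (hT : 0 < T) {D : Set (Set.Icc (0 : ℝ) T)} (hD : Dense D)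
    (h0 : (⟨0, le_rfl, hT.le⟩ : Set.Icc (0 : ℝ) T) ∈ D) {y : D → ℝ}
    (hy0 : y ⟨_, h0⟩ = 0)
    (hy : ∀ ε > 0, ∃ δ > 0, ∀ i j : D, |(i.1.1 / T) - (j.1.1 / T)| < δ → |y i - y j| < ε) :
    ∃ z : C0 T, ∀ i : D, z.1 i = y i := by
  have huc : UniformContinuous y := by
    rw [Metric.uniformContinuous_iff]
    intro ε hε
    obtain ⟨δ, hδ, h⟩ := hy ε hε
    refine ⟨δ * T, mul_pos hδ hT, fun a b hab => ?_⟩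
    rw [Real.dist_eq]
    refine h a b ?_
    rw [← sub_div, abs_div, abs_of_pos hT, div_lt_iff₀ hT]
    exact hab
  have hext : ∀ i : D, hD.extend y i = y i := fun i => hD.extend_eq huc.continuous i
  refine ⟨⟨⟨hD.extend y, (hD.uniformContinuous_extend huc).continuous⟩, fun t ht => ?_⟩, hext⟩
  have : t = (⟨0, le_rfl, hT.le⟩ : Set.Icc (0 : ℝ) T) := Subtype.ext ht
  rw [this]
  exact (hext ⟨_, h0⟩).trans hy0

/-- The increment of t ↦ ⟨h 1_[0,t], x⟩ between s and t is normal with variance at most C²|s - t|,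
so chaining gives uniform continuity on a countable dense set of times. The continuous extension is
a version at every other time because pointwise and mean-square limits agree. -/
theorem exists_isGaussianPath (hW : IsWienerMeasure W) (hT : 0 < T) (hφ : IsBVBasis T φ)
    {h : ℝ → ℝ} (hh : MemLp h ⊤ (leb T)) : ∃ Z, IsGaussianPath W φ h Z := by
  classical
  have := hW.prob
  obtain ⟨C, hC0, hC⟩ := exists_ae_bound hh
  obtain ⟨D', hD'c, hD'⟩ := TopologicalSpace.exists_countable_dense (Set.Icc (0 : ℝ) T)
  set o : Set.Icc (0 : ℝ) T := ⟨0, le_rfl, hT.le⟩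
  -- Time 0 is included so that the extended path visibly starts at 0.
  set D : Set (Set.Icc (0 : ℝ) T) := insert o D'
  have hDc : D.Countable := hD'c.insert o
  have hD : Dense D := hD'.mono (Set.subset_insert _ _)
  have hoD : o ∈ D := Set.mem_insert _ _
  have : Countable D := hDc.to_subtype
  set g : Set.Icc (0 : ℝ) T → ℝ → ℝ := fun t => (Set.Icc 0 (t : ℝ)).indicator h with hg_def
  have hg : ∀ t, MemLp (g t) 2 (leb T) := fun t => memLp_indicator hh measurableSet_Icc
  have hgm : ∀ t, AEMeasurable (fun x => pwz φ (g t) x) W := fun t =>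
    (centredNormal_pwz hW hT hφ (hg t)).aemeasurable
  have hvar : ∀ s t, ∫ r, (g s r - g t r) ^ 2 ∂(leb T) ≤ C ^ 2 * |(s : ℝ) - t| := fun s t =>
    integral_indicator_Icc_sub_sq_le hh hC s.2.1 t.2.1
  -- Rescaling time to [0,1] turns C²|s - t| into C²T times the clock distance, and a fourth moment
  -- is `fourthMoment` times the squared variance.
  have hmod := ae_exists_modulus (P := W) (ι := D) (τ := fun i => i.1.1 / T)
    (Y := fun i x => pwz φ (g i) x) (K := fourthMoment * (C ^ 2 * T) ^ 2)
    (fun i => ⟨div_nonneg i.1.2.1 hT.le, (div_le_one hT).2 i.1.2.2⟩) (fun i => hgm i)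
    (fun i j => by
      rw [(centredNormal_pwz_sub hW hT hφ (hg i) (hg j)).lintegral_pow_four
        (integral_nonneg fun t => sq_nonneg _)]
      refine ENNReal.ofReal_le_ofReal ?_
      rw [mul_assoc]
      refine mul_le_mul_of_nonneg_left ?_ (by unfold fourthMoment; positivity)
      calc (∫ r, (g i r - g j r) ^ 2 ∂(leb T)) ^ 2 ≤ (C ^ 2 * |(i.1.1 : ℝ) - j.1.1|) ^ 2 :=
            pow_le_pow_left₀ (integral_nonneg fun t => sq_nonneg _) (hvar i j) 2
        _ = (C ^ 2 * T) ^ 2 * (i.1.1 / T - j.1.1 / T) ^ 2 := by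
            rw [← sub_div, mul_pow, mul_pow, sq_abs]
            field_simp)
  have hg0 : ∀ x, pwz φ (g o) x = 0 := fun x => by
    have h1 : g o =ᵐ[leb T] fun _ => 0 := by
      filter_upwards [ae_leb_mem_Ioc] with t ht
      simp only [hg_def, o, Set.Icc_self]
      exact Set.indicator_of_notMem (fun h0 : t ∈ ({0} : Set ℝ) => ht.1.ne' h0) h
    rw [pwz_congr h1, pwz_zero_fun]
  have hmk : ∀ᵐ x ∂W, ∀ i : D, pwz φ (g i) x = (hgm i).mk _ x :=
    ae_all_iff.2 fun i => (hgm i).ae_eq_mk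
  -- S is a measurable set of full measure on which the extension exists and the integrals agree
  -- with measurable versions. Setting Z = 0 off S makes Z Borel measurable, not merely almost
  -- everywhere measurable.
  obtain ⟨S, hSsub, hSm, hS⟩ : ∃ S : Set (C0 T), (∀ x ∈ S, (∃ z : C0 T, ∀ i : D, z.1 i =
      pwz φ (g i) x) ∧ ∀ i : D, pwz φ (g i) x = (hgm i).mk _ x) ∧ MeasurableSet S ∧
      ∀ᵐ x ∂W, x ∈ S := by
    have hae : ∀ᵐ x ∂W, (∃ z : C0 T, ∀ i : D, z.1 i = pwz φ (g i) x) ∧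
        ∀ i : D, pwz φ (g i) x = (hgm i).mk _ x := by
      filter_upwards [hmod, hmk] with x hx hx'
      exact ⟨exists_path_of_modulus hT hD hoD (y := fun i : D => pwz φ (g i) x) (hg0 x) hx, hx'⟩
    obtain ⟨N, h1, h2, h3⟩ := exists_measurable_superset_of_null (ae_iff.1 hae)
    refine ⟨Nᶜ, fun x hx => not_not.1 fun hn => hx (h1 hn), h2.compl, ?_⟩
    rw [ae_iff]
    simpa using h3
  choose! z hz using fun x hx => (hSsub x hx).1
  set Z : C0 T → C0 T := fun x => if x ∈ S then z x else 0 with hZ_def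
  have hZD : ∀ x ∈ S, ∀ i : D, (Z x).1 i = pwz φ (g i) x := fun x hx i => by
    simp only [hZ_def, if_pos hx]
    exact hz x hx i
  refine ⟨Z, measurable_of_eval hDc hD fun t ht => ?_, fun t => ?_⟩
  · have : (fun x => (Z x).1 t) = S.indicator ((hgm (⟨t, ht⟩ : D)).mk _) := by
      ext x
      by_cases hx : x ∈ S
      · rw [Set.indicator_of_mem hx, ← (hSsub x hx).2 ⟨t, ht⟩, ← hZD x hx ⟨t, ht⟩]
      · rw [Set.indicator_of_notMem hx]
        simp [hZ_def, hx]
    rw [this]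
    exact ((hgm _).measurable_mk).indicator hSm
  · obtain ⟨r, hrD, hr⟩ := mem_closure_iff_seq_limit.1 (hD t)
    refine ae_eq_pwz_of_tendsto hW hT hφ (g := fun n => g (r n)) (Y := fun n x => (Z x).1 (r n))
      (fun n => hg _) (hg t) ?_ (fun n => ?_) (ae_of_all _ fun x => ?_)
    · refine squeeze_zero (fun n => integral_nonneg fun t => sq_nonneg _)
        (fun n => hvar (r n) t) ?_
      have h1 : Tendsto (fun n => (r n : ℝ) - t) atTop (𝓝 ((t : ℝ) - t)) :=
        ((continuous_subtype_val.tendsto t).comp hr).sub_const _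
      simpa using h1.abs.const_mul (C ^ 2)
    · filter_upwards [hS] with x hx using hZD x hx ⟨r n, hrD n⟩
    · exact ((Z x).1.continuous.tendsto t).comp hr

lemma isGaussianPath_gaussianPath (hW : IsWienerMeasure W) (hT : 0 < T) (hφ : IsBVBasis T φ)
    {h : ℝ → ℝ} (hh : MemLp h ⊤ (leb T)) : IsGaussianPath W φ h (gaussianPath W φ h) := by
  have H := exists_isGaussianPath hW hT hφ hh
  have h1 : gaussianPath W φ h = H.choose := dif_pos H
  rw [h1]
  exact H.choose_spec

/-- The increment of Z_h over a cell is ⟨h 1_cell, x⟩, so the sum is the integral of h times a step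
function. -/
lemma ae_rsSum_gaussianPath (hW : IsWienerMeasure W) (hT : 0 < T) (hφ : IsBVBasis T φ)
    {h : ℝ → ℝ} (hh : MemLp h ⊤ (leb T)) (g : ℝ → ℝ) (n : ℕ) :
    ∀ᵐ x ∂W, rsSum g (gaussianPath W φ h x) n =
      pwz φ (fun t => h t * gridApprox T g n t) x := by
  have hZ := isGaussianPath_gaussianPath hW hT hφ hh
  set I : ℝ → ℝ → ℝ := fun a => (Set.Icc 0 a).indicator h
  have hI : ∀ a, MemLp (I a) 2 (leb T) := fun a => memLp_indicator hh measurableSet_Icc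
  set J : ℕ → ℝ → ℝ := fun k =>
    (Set.Ioc (k * T / n : ℝ) ((k + 1) * T / n)).indicator h
  have hJ : ∀ k, MemLp (J k) 2 (leb T) := fun k => memLp_indicator hh measurableSet_Ioc
  have hp : ∀ a ∈ Set.Icc 0 T, ∀ᵐ x ∂W, pathAt (gaussianPath W φ h x) a = pwz φ (I a) x :=
    fun a ha => by
      filter_upwards [hZ.2 ⟨a, ha⟩] with x hx
      rw [pathAt_of_mem _ ha, hx]
  have hinc : ∀ᵐ x ∂W, ∀ k : ℕ, k < n →
      pathAt (gaussianPath W φ h x) ((k + 1) * T / n) - pathAt (gaussianPath W φ h x) (k * T / n)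
        = pwz φ (J k) x := by
    refine ae_all_iff.2 fun k => ?_
    by_cases hk : k < n
    · have h1 := grid_mem hT hk.le
      have h2 := grid_succ_mem hT hk
      filter_upwards [hp _ h1, hp _ h2,
        ae_pwz_add_mul hW hT hφ (hI ((k + 1) * T / n)) (hI (k * T / n)) 1 (-1)] with _ e1 e2 e3 _
      have e4 : J k = fun t => 1 * I ((k + 1) * T / n) t + -1 * I (k * T / n) t := by
        ext t
        refine indicator_Ioc_eq h h1.1 ?_ t
        gcongr
        linarith
      rw [e1, e2, e4, e3]
      ring
    · exact ae_of_all _ fun _ hk' => absurd hk' hk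
  filter_upwards [hinc, ae_pwz_sum hW hT hφ (Finset.range n) (fun k => g (k * T / n)) hJ]
    with x hx hx'
  have e5 : (fun t => h t * gridApprox T g n t) =
      fun t => ∑ k ∈ Finset.range n, g (k * T / n) * J k t := by
    ext t
    rw [gridApprox, Finset.mul_sum]
    refine Finset.sum_congr rfl fun k _ => ?_
    simp only [J, Set.indicator]
    split_ifs <;> ring
  rw [e5, hx', rsSum]
  exact Finset.sum_congr rfl fun k hk => by rw [hx k (Finset.mem_range.1 hk)]

lemma ae_rsIntegral_gaussianPath (hW : IsWienerMeasure W) (hT : 0 < T) (hφ : IsBVBasis T φ)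
    {h : ℝ → ℝ} (hh : MemLp h ⊤ (leb T)) {g : ℝ → ℝ} (hg : BoundedVariationOn g (Set.Icc 0 T)) :
    ∀ᵐ x ∂W, rsIntegral g (gaussianPath W φ h x) = pwz φ (fun t => h t * g t) x :=
  ae_eq_pwz_of_tendsto hW hT hφ (fun n => memLp_two_mul hh (memLp_gridApprox hT hg n 2))
    (memLp_two_mul hh (memLp_of_bv hT hg 2)) (tendsto_integral_mul_sub_gridApprox_sq hT hg hh)
    (fun n => ae_rsSum_gaussianPath hW hT hφ hh g n) (ae_of_all _ fun _ => tendsto_rsSum hT hg _)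

/-- Almost surely the Paley-Wiener-Zygmund integral of `u` along the path `Z_h(x, ·)` converges,
and it is the integral of `h u` along `x`. -/
theorem ae_pwz_gaussianPath (hW : IsWienerMeasure W) (hT : 0 < T) (hφ : IsBVBasis T φ)
    {h : ℝ → ℝ} (hh : MemLp h ⊤ (leb T)) {u : ℝ → ℝ} (hu : MemLp u 2 (leb T)) :
    ∀ᵐ x ∂W, PwzConv φ u (gaussianPath W φ h x) ∧
      pwz φ u (gaussianPath W φ h x) = pwz φ (fun t => h t * u t) x := by
  have := hW.prob
  obtain ⟨C, hC0, hC⟩ := exists_ae_bound hh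
  have hφh : ∀ j, MemLp (fun t => h t * φ j t) 2 (leb T) := fun j =>
    memLp_two_mul hh (memLp_of_bv hT (hφ.bv j) 2)
  have hP : ∀ s : Finset ℕ, MemLp (fun t => ∑ j ∈ s, coef T φ u j * φ j t) 2 (leb T) := fun s =>
    memLp_finsetSum _ fun j _ => (memLp_of_bv hT (hφ.bv j) 2).const_mul _
  have hrs : ∀ᵐ x ∂W, ∀ j, rsIntegral (φ j) (gaussianPath W φ h x) =
      pwz φ (fun t => h t * φ j t) x :=
    ae_all_iff.2 fun j => ae_rsIntegral_gaussianPath hW hT hφ hh (hφ.bv j)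
  have hsum : ∀ s : Finset ℕ, ∀ᵐ x ∂W,
      ∑ j ∈ s, coef T φ u j * rsIntegral (φ j) (gaussianPath W φ h x) =
        pwz φ (fun t => h t * ∑ j ∈ s, coef T φ u j * φ j t) x := fun s => by
    filter_upwards [hrs, ae_pwz_sum hW hT hφ s (coef T φ u) hφh] with x hx hx'
    have e : (fun t => h t * ∑ j ∈ s, coef T φ u j * φ j t) =
        fun t => ∑ j ∈ s, coef T φ u j * (h t * φ j t) := by
      ext t
      rw [Finset.mul_sum]
      exact Finset.sum_congr rfl fun j _ => by ring
    rw [e, hx']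
    exact Finset.sum_congr rfl fun j _ => by rw [hx j]
  have hmeas : ∀ n, AEMeasurable (fun x => pwzSum φ u (gaussianPath W φ h x) n) W := fun n =>
    ((measurable_pwzSum u n).comp (isGaussianPath_gaussianPath hW hT hφ hh).1).aemeasurable
  -- Along Z_h the increments of the partial sums have variance ‖h · block‖², at most C² times the
  -- corresponding block of squared coefficients.
  have hconv : ∀ᵐ x ∂W, PwzConv φ u (gaussianPath W φ h x) := by
    refine ae_exists_tendsto_of_centredNormal (C := C ^ 2) hmeas
      (fun n => sq_nonneg _) (hasSum_coef_sq hT hφ hu).summable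
      (v := fun n m => ∫ t, (h t * ∑ j ∈ Finset.Ico n m, coef T φ u j * φ j t) ^ 2 ∂(leb T))
      (fun n m => integral_nonneg fun t => sq_nonneg _) (fun n m _ => ?_) fun n m hnm => ?_
    · rw [← integral_sum_sq hT hφ]
      exact integral_mul_sq_le hh hC (hP _)
    · refine (centredNormal_pwz hW hT hφ (memLp_two_mul hh (hP (Finset.Ico n m)))).congr ?_ rfl
      filter_upwards [hsum (Finset.Ico n m)] with x hx
      rw [← hx]
      simp only [pwzSum_eq]
      rw [Finset.sum_Ico_eq_sub _ hnm]
  have hlim : Tendsto (fun n => ∫ t, (h t * proj T φ u n t - h t * u t) ^ 2 ∂(leb T)) atTop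
      (𝓝 0) := by
    have h1 := (tendsto_integral_sub_proj_sq hT hφ hu).const_mul (C ^ 2)
    rw [mul_zero] at h1
    refine squeeze_zero (fun n => integral_nonneg fun t => sq_nonneg _) (fun n => ?_) h1
    have h2 : ∀ t, (h t * proj T φ u n t - h t * u t) ^ 2 = (h t * (u t - proj T φ u n t)) ^ 2 :=
      fun t => by ring
    simp only [h2]
    exact integral_mul_sq_le hh hC (hu.sub (memLp_proj hT hφ u n 2))
  have heq := ae_eq_pwz_of_tendsto hW hT hφ
    (fun n => memLp_two_mul hh (memLp_proj hT hφ u n 2)) (memLp_two_mul hh hu) hlim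
    (Y := fun n x => pwzSum φ u (gaussianPath W φ h x) n)
    (fun n => hsum (Finset.range n)) (hconv.mono fun x hx => hx.tendsto)
  filter_upwards [hconv, heq] with x h1 h2 using ⟨h1, h2⟩

end GaussianPaths

/-! ### The factor exp(-v/(2λ)) on the right half-plane and its Feynman limit. -/

section FeynmanLimit

lemma isOpen_rightHalf : IsOpen rightHalf := isOpen_lt continuous_const Complex.continuous_re

lemma isPreconnected_rightHalf : IsPreconnected rightHalf :=
  (convex_halfSpace_re_gt 0).isPreconnected

lemma ofReal_mem_rightHalf {l : ℝ} (hl : 0 < l) : (l : ℂ) ∈ rightHalf := by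
  simpa [rightHalf] using hl

lemma ne_zero_of_mem_rightHalf {z : ℂ} (hz : z ∈ rightHalf) : z ≠ 0 := by
  rintro rfl
  simp [rightHalf] at hz

instance feynmanFilter_neBot (q : ℝ) : (feynmanFilter q).NeBot := by
  refine mem_closure_iff_nhdsWithin_neBot.1 ?_
  have h : closure rightHalf = {z : ℂ | 0 ≤ z.re} := Complex.closure_setOfPred_lt_re 0
  rw [h]
  simp

/-- Dominated convergence along a filter requires countable generation. -/
instance feynmanFilter_isCountablyGenerated (q : ℝ) : (feynmanFilter q).IsCountablyGenerated := by
  unfold feynmanFilter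
  infer_instance

lemma eventually_mem_rightHalf (q : ℝ) : ∀ᶠ l in feynmanFilter q, l ∈ rightHalf :=
  self_mem_nhdsWithin

lemma tendsto_neg_div_feynmanFilter {q : ℝ} (hq : q ≠ 0) (v : ℝ) :
    Tendsto (fun l : ℂ => -(v : ℂ) / (2 * l)) (feynmanFilter q)
      (𝓝 (((-(v / (2 * q)) : ℝ) : ℂ) * Complex.I)) := by
  have hq' : (q : ℂ) ≠ 0 := Complex.ofReal_ne_zero.2 hq
  have h0 : (2 : ℂ) * -(Complex.I * q) ≠ 0 := by simp [hq]
  have h1 : Tendsto (fun l : ℂ => -(v : ℂ) / (2 * l)) (feynmanFilter q)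
      (𝓝 (-(v : ℂ) / (2 * -(Complex.I * q)))) :=
    (tendsto_const_nhds.div ((continuous_const.mul continuous_id).tendsto _) h0).mono_left
      nhdsWithin_le_nhds
  convert h1 using 2
  push_cast
  field_simp
  rw [Complex.I_sq]
  ring

/-- Re(1/λ) ≥ 0 on the half-plane. This uniform bound gives the domination both for analyticity and
for the limit λ → -iq. -/
lemma norm_exp_neg_div_le {v : ℝ} (hv : 0 ≤ v) {l : ℂ} (hl : l ∈ rightHalf) :
    ‖Complex.exp (-(v : ℂ) / (2 * l))‖ ≤ 1 := by
  have h0 : -(v : ℂ) / (2 * l) = ((-(v / 2) : ℝ) : ℂ) * l⁻¹ := by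
    have := ne_zero_of_mem_rightHalf hl
    push_cast
    field_simp
  rw [Complex.norm_exp, Real.exp_le_one_iff, h0, Complex.re_ofReal_mul, Complex.inv_re]
  have : 0 ≤ l.re / Complex.normSq l :=
    div_nonneg (le_of_lt hl) (Complex.normSq_nonneg l)
  nlinarith

variable {E : Type*} [MeasurableSpace E] {μ : Measure E} {κ : E → ℂ} {σ2 : E → ℝ}

lemma differentiableOn_integral_exp_neg_div (hκ : Integrable κ μ) (hσ : Measurable σ2)
    (hσ0 : ∀ w, 0 ≤ σ2 w) :
    DifferentiableOn ℂ (fun l => ∫ w, κ w * Complex.exp (-(σ2 w : ℂ) / (2 * l)) ∂μ) rightHalf := by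
  refine differentiableOn_integral_of_bound (bound := fun w => ‖κ w‖) isOpen_rightHalf hκ.norm
    (fun z _ => hκ.1.mul (Measurable.aestronglyMeasurable (by fun_prop))) (fun w => ?_)
    fun w z hz => ?_
  · refine (DifferentiableOn.cexp ?_).const_mul _
    exact (differentiableOn_const _).div (differentiableOn_id.const_mul 2)
      fun z hz => mul_ne_zero two_ne_zero (ne_zero_of_mem_rightHalf hz)
  · rw [norm_mul]
    exact mul_le_of_le_one_right (norm_nonneg _) (norm_exp_neg_div_le (hσ0 w) hz)

lemma tendsto_integral_exp_neg_div (hκ : Integrable κ μ) (hσ : Measurable σ2)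
    (hσ0 : ∀ w, 0 ≤ σ2 w) {q : ℝ} (hq : q ≠ 0) :
    Tendsto (fun l => ∫ w, κ w * Complex.exp (-(σ2 w : ℂ) / (2 * l)) ∂μ) (feynmanFilter q)
      (𝓝 (∫ w, κ w * Complex.exp (((-(σ2 w / (2 * q)) : ℝ) : ℂ) * Complex.I) ∂μ)) := by
  refine tendsto_integral_filter_of_dominated_convergence (fun w => ‖κ w‖)
    (Eventually.of_forall fun l => hκ.1.mul (Measurable.aestronglyMeasurable (by fun_prop))) ?_
    hκ.norm (ae_of_all _ fun w => ?_)
  · filter_upwards [eventually_mem_rightHalf q] with l hl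
    refine ae_of_all _ fun w => ?_
    rw [norm_mul]
    exact mul_le_of_le_one_right (norm_nonneg _) (norm_exp_neg_div_le (hσ0 w) hl)
  · exact ((Complex.continuous_exp.tendsto _).comp
      (tendsto_neg_div_feynmanFilter hq (σ2 w))).const_mul _

end FeynmanLimit

/-! ### Analytic Wiener integrals: explicit continuation and uniqueness. -/

section AnalyticWienerIntegral

variable {T : ℝ} {W : Measure (C0 T)}

/-- The variance is the second moment, measurable in the parameter by Tonelli. -/
lemma measurable_of_centredNormal {E Ω : Type*} [MeasurableSpace E] [MeasurableSpace Ω]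
    {P : Measure Ω} [SFinite P] {b : E → Ω → ℝ} {σ2 : E → ℝ}
    (hb : Measurable fun p : E × Ω => b p.1 p.2) (hσ0 : ∀ w, 0 ≤ σ2 w)
    (h : ∀ w, CentredNormal P (b w) (σ2 w)) : Measurable σ2 := by
  have h1 : σ2 = fun w => (∫⁻ x, ENNReal.ofReal (b w x ^ 2) ∂P).toReal := by
    ext w
    rw [(h w).lintegral_sq (hσ0 w), ENNReal.toReal_ofReal (hσ0 w)]
  rw [h1]
  exact (Measurable.lintegral_prod_right' (f := fun p : E × Ω => ENNReal.ofReal (b p.1 p.2 ^ 2))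
    (by fun_prop)).ennreal_toReal

/-- The Wiener integral of a superposition of exponentials of centred Gaussian variables has an
explicit analytic continuation. -/
theorem isAnalyticWienerIntegral_of_centredNormal [IsProbabilityMeasure W] {E : Type*}
    [MeasurableSpace E] {μ : Measure E} [IsFiniteMeasure μ] {κ : E → ℂ} (hκ : Integrable κ μ)
    {b : E → C0 T → ℝ} (hb : Measurable fun p : E × C0 T => b p.1 p.2) {σ2 : E → ℝ}
    (hσ0 : ∀ w, 0 ≤ σ2 w) (hN : ∀ w, CentredNormal W (b w) (σ2 w)) {Φ : ℝ → C0 T → ℂ}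
    (hΦ : ∀ s, ∀ᵐ x ∂W, Φ s x =
      ∫ w, κ w * Complex.exp (Complex.I * ((s * b w x : ℝ) : ℂ)) ∂μ) :
    IsAnalyticWienerIntegral W Φ
      (fun l => ∫ w, κ w * Complex.exp (-(σ2 w : ℂ) / (2 * l)) ∂μ) := by
  have hσ := measurable_of_centredNormal hb hσ0 hN
  refine ⟨differentiableOn_integral_exp_neg_div hκ hσ hσ0, fun l hl => ?_⟩
  set s : ℝ := (√l)⁻¹ with hs
  have hint : Integrable (fun p : E × C0 T => κ p.1 *
      Complex.exp (Complex.I * ((s * b p.1 p.2 : ℝ) : ℂ))) (μ.prod W) := by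
    refine (hκ.comp_fst W).mul_bdd (c := 1)
      (Measurable.aestronglyMeasurable (by fun_prop)) (ae_of_all _ fun p => ?_)
    rw [mul_comm Complex.I, Complex.norm_exp_ofReal_mul_I]
  have hint' := hint.integral_prod_right
  refine ⟨hint'.congr ?_, ?_⟩
  · filter_upwards [hΦ s] with x hx
    rw [hx]
  -- Fubini puts the path integral inside, where it is a normal characteristic function at s =
  -- l^{-1/2}.
  · rw [integral_congr_ae (hΦ s), ← integral_integral_swap hint]
    refine integral_congr_ae (ae_of_all _ fun w => ?_)
    simp only
    rw [integral_const_mul, (hN w).integral_exp (hσ0 w) s]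
    congr 2
    have h2 : s ^ 2 = l⁻¹ := by rw [hs, inv_pow, Real.sq_sqrt hl.le]
    rw [h2]
    push_cast
    have : (l : ℂ) ≠ 0 := Complex.ofReal_ne_zero.2 hl.ne'
    field_simp

/-- Both functions equal the same integral on the positive axis, whose points accumulate at 1; the
identity theorem does the rest. -/
lemma IsAnalyticWienerIntegral.eqOn {Φ : ℝ → C0 T → ℂ} {J₁ J₂ : ℂ → ℂ}
    (h₁ : IsAnalyticWienerIntegral W Φ J₁) (h₂ : IsAnalyticWienerIntegral W Φ J₂) :
    Set.EqOn J₁ J₂ rightHalf := by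
  refine (h₁.1.analyticOnNhd isOpen_rightHalf).eqOn_of_preconnected_of_frequently_eq
    (h₂.1.analyticOnNhd isOpen_rightHalf) isPreconnected_rightHalf (z₀ := ((1 : ℝ) : ℂ))
    (ofReal_mem_rightHalf one_pos) ?_
  have ht : Tendsto (fun l : ℝ => (l : ℂ)) (𝓝[>] 1) (𝓝[≠] ((1 : ℝ) : ℂ)) := by
    refine tendsto_nhdsWithin_iff.2 ⟨(Complex.continuous_ofReal.tendsto 1).mono_left
      nhdsWithin_le_nhds, ?_⟩
    filter_upwards [self_mem_nhdsWithin] with l hl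
    exact fun h => (ne_of_gt hl) (Complex.ofReal_injective h)
  refine ht.frequently (Eventually.frequently ?_)
  filter_upwards [self_mem_nhdsWithin] with l hl
  have hl0 : (0 : ℝ) < l := one_pos.trans hl
  rw [(h₁.2 l hl0).2, (h₂.2 l hl0).2]

end AnalyticWienerIntegral

/-! ### Fourier-type functionals with a general phase. -/

section Phases

variable {T : ℝ} {W : Measure (C0 T)} {E : Type*} [MeasurableSpace E]

/-- A measurable family of functionals `N w` on path space, each almost surely defined and linear
on its domain `D w`. -/
structure IsPhase (W : Measure (C0 T)) (N : E → C0 T → ℝ) (D : E → C0 T → Prop) : Prop where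
  measurable : Measurable fun p : E × C0 T => N p.1 p.2
  measurableSet : MeasurableSet {p : E × C0 T | D p.1 p.2}
  ae : ∀ w, ∀ᵐ x ∂W, D w x
  smul : ∀ w x (s : ℝ), D w x → D w (s • x)
  add_smul : ∀ w y z (s : ℝ), D w y → D w z → N w (y + s • z) = N w y + s * N w z

/-- Along the random path `Z` the functionals `N w` are centred normal with variances `σ2 w`. -/
structure IsNormalAlong (W : Measure (C0 T)) (N : E → C0 T → ℝ) (D : E → C0 T → Prop)
    (Z : C0 T → C0 T) (σ2 : E → ℝ) : Prop where
  measurable : Measurable Z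
  ae : ∀ w, ∀ᵐ x ∂W, D w (Z x)
  nonneg : ∀ w, 0 ≤ σ2 w
  normal : ∀ w, CentredNormal W (fun x => N w (Z x)) (σ2 w)

/-- The Fourier-type functional with phase `N` and density `κ` with respect to `μ`. -/
def phaseInt (N : E → C0 T → ℝ) (μ : Measure E) (κ : E → ℂ) (y : C0 T) : ℂ :=
  ∫ w, κ w * Complex.exp (Complex.I * (N w y : ℂ)) ∂μ

variable {N : E → C0 T → ℝ} {D : E → C0 T → Prop} {Z : C0 T → C0 T} {σ2 : E → ℝ}
  {μ : Measure E} {κ : E → ℂ}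

lemma norm_mul_exp_I (a : ℂ) (r : ℝ) : ‖a * Complex.exp (Complex.I * (r : ℂ))‖ = ‖a‖ := by
  rw [norm_mul, mul_comm Complex.I, Complex.norm_exp_ofReal_mul_I, mul_one]

lemma norm_mul_exp_ofReal_mul_I (a : ℂ) (r : ℝ) : ‖a * Complex.exp ((r : ℂ) * Complex.I)‖ = ‖a‖ := by
  rw [norm_mul, Complex.norm_exp_ofReal_mul_I, mul_one]

lemma integrable_mul_exp_I (hκ : Integrable κ μ) {r : E → ℝ} (hr : Measurable r) :
    Integrable (fun w => κ w * Complex.exp (Complex.I * (r w : ℂ))) μ :=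
  hκ.mul_bdd (c := 1) (Measurable.aestronglyMeasurable (by fun_prop))
    (ae_of_all _ fun w => by rw [mul_comm Complex.I, Complex.norm_exp_ofReal_mul_I])

lemma integrable_mul_exp_ofReal_mul_I (hκ : Integrable κ μ) {r : E → ℝ} (hr : Measurable r) :
    Integrable (fun w => κ w * Complex.exp ((r w : ℂ) * Complex.I)) μ := by
  simpa only [mul_comm] using integrable_mul_exp_I hκ hr

lemma norm_phaseInt_le (y : C0 T) : ‖phaseInt N μ κ y‖ ≤ ∫ w, ‖κ w‖ ∂μ := by
  refine (norm_integral_le_integral_norm _).trans (le_of_eq ?_)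
  simp only [norm_mul_exp_I]

lemma IsPhase.measurable_right (hN : IsPhase W N D) (w : E) : Measurable (N w) :=
  hN.measurable.comp measurable_prodMk_left

lemma IsPhase.measurable_left (hN : IsPhase W N D) (y : C0 T) : Measurable fun w => N w y :=
  hN.measurable.comp measurable_prodMk_right

lemma IsPhase.stronglyMeasurable_phaseInt [SFinite μ] (hN : IsPhase W N D) (hκ : Measurable κ) :
    StronglyMeasurable (phaseInt N μ κ) := by
  refine StronglyMeasurable.integral_prod_right' (f := fun p : C0 T × E =>
    κ p.2 * Complex.exp (Complex.I * (N p.2 p.1 : ℂ))) (Measurable.stronglyMeasurable ?_)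
  have h : Measurable fun p : C0 T × E => N p.2 p.1 := hN.measurable.comp measurable_swap
  exact (hκ.comp measurable_snd).mul
    ((Complex.measurable_ofReal.comp h).const_mul Complex.I).cexp

lemma measurable_const_smul_C0 (ρ : ℝ) : Measurable fun y : C0 T => ρ • y :=
  (continuous_const_smul ρ).measurable

lemma IsPhase.scaleInvMeasurable_phaseInt [SFinite μ] (hN : IsPhase W N D) (hκ : Measurable κ) :
    ScaleInvMeasurable W (phaseInt N μ κ) := fun ρ _ =>
  ((hN.stronglyMeasurable_phaseInt hκ).comp_measurable
    (measurable_const_smul_C0 ρ)).aestronglyMeasurable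

/-- The exceptional set of paths depends on w. Fubini exchanges the quantifiers, so that one typical
path serves almost every w. -/
lemma IsPhase.ae_ae [SFinite μ] [SFinite W] (hN : IsPhase W N D) : ∀ᵐ y ∂W, ∀ᵐ w ∂μ, D w y :=
  (Measure.ae_ae_comm hN.measurableSet).1 (ae_of_all _ hN.ae)

lemma IsPhase.sae_ae [SFinite μ] [SFinite W] (hN : IsPhase W N D) :
    SAE W fun y => ∀ᵐ w ∂μ, D w y := fun ρ _ => by
  filter_upwards [hN.ae_ae (μ := μ)] with y hy
  filter_upwards [hy] with w hw using hN.smul w y ρ hw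

lemma IsNormalAlong.ae_ae [SFinite μ] [SFinite W] (hN : IsPhase W N D)
    (hZ : IsNormalAlong W N D Z σ2) : ∀ᵐ x ∂W, ∀ᵐ w ∂μ, D w (Z x) := by
  have h : MeasurableSet {p : E × C0 T | D p.1 (Z p.2)} :=
    (measurable_fst.prodMk (hZ.measurable.comp measurable_snd)) hN.measurableSet
  exact (Measure.ae_ae_comm h).1 (ae_of_all _ hZ.ae)

lemma IsNormalAlong.measurable_uncurry (hN : IsPhase W N D) (hZ : IsNormalAlong W N D Z σ2) :
    Measurable fun p : E × C0 T => N p.1 (Z p.2) :=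
  hN.measurable.comp (measurable_fst.prodMk (hZ.measurable.comp measurable_snd))

lemma IsNormalAlong.measurable_variance [SFinite W] (hN : IsPhase W N D)
    (hZ : IsNormalAlong W N D Z σ2) : Measurable σ2 :=
  measurable_of_centredNormal (hZ.measurable_uncurry hN) hZ.nonneg hZ.normal

end Phases

/-! ### Existence and uniqueness of the transform of a Fourier-type functional. -/

section Transform

variable {T : ℝ} {W : Measure (C0 T)} {φ : ℕ → ℝ → ℝ} {E : Type*} [MeasurableSpace E]
  {N : E → C0 T → ℝ} {D : E → C0 T → Prop} {h : ℝ → ℝ} {σ2 : E → ℝ}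
  {μ : Measure E} {κ : E → ℂ}

/-- The analytically continued transform `T_{λ,h}` of the functional `phaseInt N μ κ`. -/
def continuedTransform (N : E → C0 T → ℝ) (μ : Measure E) (κ : E → ℂ) (σ2 : E → ℝ) (l : ℂ)
    (y : C0 T) : ℂ :=
  phaseInt N μ (fun w => κ w * Complex.exp (-(σ2 w : ℂ) / (2 * l))) y

/-- The density of the transform with parameter `q`. -/
def rotate (q : ℝ) (σ2 : E → ℝ) (κ : E → ℂ) (w : E) : ℂ :=
  κ w * Complex.exp (((-(σ2 w / (2 * q)) : ℝ) : ℂ) * Complex.I)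

lemma measurable_rotate (q : ℝ) (hσ : Measurable σ2) (hκ : Measurable κ) :
    Measurable (rotate q σ2 κ) := by
  unfold rotate
  fun_prop

lemma integrable_rotate (q : ℝ) (hσ : Measurable σ2) (hκ : Integrable κ μ) :
    Integrable (rotate q σ2 κ) μ :=
  integrable_mul_exp_ofReal_mul_I hκ (r := fun w => -(σ2 w / (2 * q))) (by fun_prop)

lemma continuedTransform_eq (l : ℂ) (y : C0 T) :
    continuedTransform N μ κ σ2 l y = ∫ w, (κ w * Complex.exp (Complex.I * (N w y : ℂ))) *
      Complex.exp (-(σ2 w : ℂ) / (2 * l)) ∂μ :=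
  integral_congr_ae (ae_of_all _ fun w => by simp only []; ring)

lemma sae_isAnalyticWienerIntegral_phaseInt [IsProbabilityMeasure W] [IsFiniteMeasure μ]
    (hN : IsPhase W N D) (hZ : IsNormalAlong W N D (gaussianPath W φ h) σ2)
    (hκ : Integrable κ μ) :
    SAE W fun y => IsAnalyticWienerIntegral W
      (fun s x => phaseInt N μ κ (y + s • gaussianPath W φ h x))
      (fun l => continuedTransform N μ κ σ2 l y) := fun ρ hρ => by
  filter_upwards [hN.sae_ae (μ := μ) ρ hρ] with y hy
  simp only [continuedTransform_eq]
  refine isAnalyticWienerIntegral_of_centredNormal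
    (integrable_mul_exp_I hκ (hN.measurable_left _)) (hZ.measurable_uncurry hN) hZ.nonneg
    hZ.normal fun s => ?_
  filter_upwards [hZ.ae_ae hN (μ := μ)] with x hx
  refine integral_congr_ae ?_
  filter_upwards [hx, hy] with w hwx hwy
  rw [hN.add_smul w _ _ s hwy hwx, mul_assoc, ← Complex.exp_add, ← mul_add, Complex.ofReal_add]

lemma tendsto_continuedTransform [SFinite W] (hN : IsPhase W N D)
    (hZ : IsNormalAlong W N D (gaussianPath W φ h) σ2) (hκ : Integrable κ μ) {q : ℝ} (hq : q ≠ 0)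
    (y : C0 T) :
    Tendsto (fun l => continuedTransform N μ κ σ2 l y) (feynmanFilter q)
      (𝓝 (phaseInt N μ (rotate q σ2 κ) y)) := by
  simp only [continuedTransform_eq]
  have e : phaseInt N μ (rotate q σ2 κ) y =
      ∫ w, (κ w * Complex.exp (Complex.I * (N w y : ℂ))) *
        Complex.exp (((-(σ2 w / (2 * q)) : ℝ) : ℂ) * Complex.I) ∂μ :=
    integral_congr_ae (ae_of_all _ fun w => by simp only [rotate]; ring)
  rw [e]
  exact tendsto_integral_exp_neg_div (integrable_mul_exp_I hκ (hN.measurable_left _))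
    (hZ.measurable_variance hN) hZ.nonneg hq

lemma norm_continuedTransform_le (hσ0 : ∀ w, 0 ≤ σ2 w) (hκ : Integrable κ μ) {l : ℂ}
    (hl : l ∈ rightHalf) (y : C0 T) : ‖continuedTransform N μ κ σ2 l y‖ ≤ ∫ w, ‖κ w‖ ∂μ := by
  refine (norm_phaseInt_le y).trans (integral_mono_of_nonneg (ae_of_all _ fun w => norm_nonneg _)
    hκ.norm (ae_of_all _ fun w => ?_))
  simp only [norm_mul]
  exact mul_le_of_le_one_right (norm_nonneg _) (norm_exp_neg_div_le (hσ0 w) hl)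

/-- Pointwise convergence suffices, since the difference is bounded by the constant 2∫‖κ‖ and W is a
probability measure. -/
lemma tendsto_lintegral_continuedTransform [IsProbabilityMeasure W] [SFinite μ]
    (hN : IsPhase W N D) (hZ : IsNormalAlong W N D (gaussianPath W φ h) σ2) (hκm : Measurable κ)
    (hκ : Integrable κ μ) {q : ℝ} (hq : q ≠ 0) {r : ℝ} (hr : 0 < r) (ρ : ℝ) :
    Tendsto (fun l => ∫⁻ y, ‖continuedTransform N μ κ σ2 l (ρ • y) -
      phaseInt N μ (rotate q σ2 κ) (ρ • y)‖ₑ ^ r ∂W) (feynmanFilter q) (𝓝 0) := by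
  have hσ := hZ.measurable_variance hN
  have hmG : Measurable fun y => phaseInt N μ (rotate q σ2 κ) (ρ • y) :=
    (hN.stronglyMeasurable_phaseInt (measurable_rotate q hσ hκm)).measurable.comp
      (measurable_const_smul_C0 ρ)
  have hmT : ∀ l, Measurable fun y => continuedTransform N μ κ σ2 l (ρ • y) := fun l =>
    (hN.stronglyMeasurable_phaseInt (by fun_prop)).measurable.comp (measurable_const_smul_C0 ρ)
  have h0 : (0 : ENNReal) = ∫⁻ _ : C0 T, 0 ∂W := by simp
  rw [h0]
  refine tendsto_lintegral_filter_of_dominated_convergence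
    (fun _ => ENNReal.ofReal (2 * ∫ w, ‖κ w‖ ∂μ) ^ r)
    (Eventually.of_forall fun l => ((hmT l).sub hmG).enorm.pow_const r) ?_ ?_
    (ae_of_all _ fun y => ?_)
  · filter_upwards [eventually_mem_rightHalf q] with l hl
    refine ae_of_all _ fun y => ENNReal.rpow_le_rpow ?_ hr.le
    rw [← ofReal_norm]
    refine ENNReal.ofReal_le_ofReal ((norm_sub_le _ _).trans ?_)
    rw [two_mul]
    refine add_le_add (norm_continuedTransform_le hZ.nonneg hκ hl _)
      ((norm_phaseInt_le _).trans (le_of_eq ?_))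
    simp only [rotate, norm_mul_exp_ofReal_mul_I]
  · rw [lintegral_const, measure_univ, mul_one]
    exact ENNReal.rpow_ne_top_of_nonneg hr.le ENNReal.ofReal_ne_top
  · have h1 := (tendsto_continuedTransform hN hZ hκ hq (ρ • y)).sub_const
      (phaseInt N μ (rotate q σ2 κ) (ρ • y))
    rw [sub_self] at h1
    have h2 := (ENNReal.continuous_rpow_const (y := r)).tendsto 0 |>.comp
      ((continuous_enorm.tendsto (0 : ℂ)).comp h1 |>.trans (by rw [enorm_zero]))
    rw [ENNReal.zero_rpow_of_pos hr] at h2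
    exact h2

lemma conjugate_exponent_one_le {p : ℝ} (hp : p ∈ Set.Icc (1 : ℝ) 2) (hp1 : p ≠ 1) :
    1 ≤ p / (p - 1) := by
  have : 0 < p - 1 := sub_pos.2 (lt_of_le_of_ne hp.1 (Ne.symm hp1))
  rw [le_div_iff₀ this]
  linarith

/-- The transform of `phaseInt N μ κ` exists and has density `rotate q σ2 κ`. -/
theorem isGFFT_phaseInt [IsProbabilityMeasure W] [IsFiniteMeasure μ] (hN : IsPhase W N D)
    (hZ : IsNormalAlong W N D (gaussianPath W φ h) σ2) (hκm : Measurable κ)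
    (hκ : Integrable κ μ) {q : ℝ} (hq : q ≠ 0) {p : ℝ} (hp : p ∈ Set.Icc (1 : ℝ) 2) :
    IsGFFT W φ p q h (phaseInt N μ κ) (phaseInt N μ (rotate q σ2 κ)) :=
  ⟨hN.scaleInvMeasurable_phaseInt hκm,
    hN.scaleInvMeasurable_phaseInt (measurable_rotate q (hZ.measurable_variance hN) hκm),
    continuedTransform N μ κ σ2, sae_isAnalyticWienerIntegral_phaseInt hN hZ hκ,
    fun _ _ _ => ae_of_all _ fun _ => tendsto_continuedTransform hN hZ hκ hq _,
    fun hp1 ρ _ => tendsto_lintegral_continuedTransform hN hZ hκm hκ hq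
      (one_pos.trans_le (conjugate_exponent_one_le hp hp1)) ρ⟩

/-- Every version of the transform of `phaseInt N μ κ` is s-a.e. the one with density
`rotate q σ2 κ`. -/
theorem IsGFFT.sae_eq_phaseInt [IsProbabilityMeasure W] [IsFiniteMeasure μ] (hN : IsPhase W N D)
    (hZ : IsNormalAlong W N D (gaussianPath W φ h) σ2) (hκm : Measurable κ)
    (hκ : Integrable κ μ) {q : ℝ} (hq : q ≠ 0) {p : ℝ} (hp : p ∈ Set.Icc (1 : ℝ) 2)
    {G : C0 T → ℂ} (hG : IsGFFT W φ p q h (phaseInt N μ κ) G) :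
    SAE W fun y => G y = phaseInt N μ (rotate q σ2 κ) y := by
  obtain ⟨-, hGm, Tl, hTl, h1, h2⟩ := hG
  intro ρ hρ
  -- Any continuation in the definition coincides with the explicit one, so only the limits remain
  -- to be compared.
  have heq : ∀ᵐ y ∂W, Set.EqOn (fun l => Tl l (ρ • y))
      (fun l => continuedTransform N μ κ σ2 l (ρ • y)) rightHalf := by
    filter_upwards [hTl ρ hρ, sae_isAnalyticWienerIntegral_phaseInt hN hZ hκ ρ hρ] with y ha hb
    exact ha.eqOn hb
  by_cases hp1 : p = 1
  · filter_upwards [heq, h1 hp1 ρ hρ] with y ha hb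
    refine tendsto_nhds_unique hb
      ((tendsto_continuedTransform hN hZ hκ hq (ρ • y)).congr' ?_)
    filter_upwards [eventually_mem_rightHalf q] with l hl using (ha hl).symm
  · have hr := conjugate_exponent_one_le hp hp1
    set r := p / (p - 1)
    have hσ := hZ.measurable_variance hN
    set G₀ := phaseInt N μ (rotate q σ2 κ)
    have hmG : Measurable fun y => G₀ (ρ • y) :=
      (hN.stronglyMeasurable_phaseInt (measurable_rotate q hσ hκm)).measurable.comp
        (measurable_const_smul_C0 ρ)
    have hmT : ∀ l, Measurable fun y => continuedTransform N μ κ σ2 l (ρ • y) := fun l =>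
      (hN.stronglyMeasurable_phaseInt (by fun_prop)).measurable.comp (measurable_const_smul_C0 ρ)
    have h2top : (2 : ENNReal) ^ (r - 1) ≠ ⊤ :=
      ENNReal.rpow_ne_top_of_nonneg (by linarith) (by simp)
    have hlim := ENNReal.Tendsto.const_mul (a := (2 : ENNReal) ^ (r - 1))
      ((tendsto_lintegral_continuedTransform hN hZ hκm hκ hq (one_pos.trans_le hr) ρ).add
        (h2 hp1 ρ hρ)) (Or.inr h2top)
    -- Convexity of t ↦ t^r for r ≥ 1 gives (a + b)^r ≤ 2^{r-1}(a^r + b^r); both integrals on the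
    -- right tend to 0 while the left side does not depend on λ.
    have hle : ∀ᶠ l in feynmanFilter q, ∫⁻ y, ‖G (ρ • y) - G₀ (ρ • y)‖ₑ ^ r ∂W ≤
        (2 : ENNReal) ^ (r - 1) * (∫⁻ y, ‖continuedTransform N μ κ σ2 l (ρ • y) -
          G₀ (ρ • y)‖ₑ ^ r ∂W + ∫⁻ y, ‖Tl l (ρ • y) - G (ρ • y)‖ₑ ^ r ∂W) := by
      filter_upwards [eventually_mem_rightHalf q] with l hl
      have hm : Measurable fun y => ‖continuedTransform N μ κ σ2 l (ρ • y) - G₀ (ρ • y)‖ₑ ^ r :=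
        ((hmT l).sub hmG).enorm.pow_const r
      rw [← lintegral_add_left hm, ← lintegral_const_mul' _ _ h2top]
      refine lintegral_mono_ae ?_
      filter_upwards [heq] with y hy
      refine le_trans (ENNReal.rpow_le_rpow ?_ (zero_le_one.trans hr))
        (ENNReal.rpow_add_le_mul_rpow_add_rpow _ _ hr)
      have e : G (ρ • y) - G₀ (ρ • y) = (continuedTransform N μ κ σ2 l (ρ • y) - G₀ (ρ • y)) -
          (Tl l (ρ • y) - G (ρ • y)) := by
        have := hy hl
        simp only at this
        rw [this]
        ring
      rw [e]
      exact enorm_sub_le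
    have hzero : ∫⁻ y, ‖G (ρ • y) - G₀ (ρ • y)‖ₑ ^ r ∂W = 0 := by
      refine le_antisymm (ge_of_tendsto ?_ hle) zero_le
      simpa using hlim
    have hmeas : AEMeasurable (fun y => ‖G (ρ • y) - G₀ (ρ • y)‖ₑ ^ r) W :=
      ((hGm ρ hρ).aemeasurable.sub hmG.aemeasurable).enorm.pow_const r
    filter_upwards [(lintegral_eq_zero_iff' hmeas).1 hzero] with y hy
    have h3 : ‖G (ρ • y) - G₀ (ρ • y)‖ₑ = 0 := by
      simpa [(zero_lt_one.trans_le hr).not_gt, (zero_lt_one.trans_le hr)] using hy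
    exact sub_eq_zero.1 (enorm_eq_zero.1 h3)

end Transform

/-! ### Finiteness instances and measurability of compositions. -/

section MeasureInstances

lemma sFinite_of_isFiniteMeasure {X : Type*} [MeasurableSpace X] (μ : Measure X)
    [IsFiniteMeasure μ] : SFinite μ := inferInstance

lemma isFiniteMeasure_of_isProbabilityMeasure {X : Type*} [MeasurableSpace X] (μ : Measure X)
    [IsProbabilityMeasure μ] : IsFiniteMeasure μ := inferInstance

lemma isFiniteMeasure_prod {X Y : Type*} [MeasurableSpace X] [MeasurableSpace Y] (μ : Measure X)
    (ν : Measure Y) [IsFiniteMeasure μ] [IsFiniteMeasure ν] : IsFiniteMeasure (μ.prod ν) :=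
  inferInstance

instance instSFiniteC0 {T : ℝ} (W : Measure (C0 T)) [IsFiniteMeasure W] : SFinite W :=
  sFinite_of_isFiniteMeasure W

instance instIsFiniteMeasureC0 {T : ℝ} (W : Measure (C0 T)) [IsProbabilityMeasure W] :
    IsFiniteMeasure W :=
  isFiniteMeasure_of_isProbabilityMeasure W

instance instSFiniteL2 {T : ℝ} (μ : Measure (L2 T)) [IsFiniteMeasure μ] : SFinite μ :=
  sFinite_of_isFiniteMeasure μ

instance instIsFiniteMeasureProdL2 {T : ℝ} (μ ν : Measure (L2 T)) [IsFiniteMeasure μ]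
    [IsFiniteMeasure ν] : IsFiniteMeasure (μ.prod ν) :=
  isFiniteMeasure_prod μ ν

instance instSFiniteProdL2 {T : ℝ} (μ : Measure (L2 T × L2 T)) [IsFiniteMeasure μ] : SFinite μ :=
  sFinite_of_isFiniteMeasure μ

lemma measurable_uncurry_comp {A E X Y : Type*} [MeasurableSpace A] [MeasurableSpace E]
    [MeasurableSpace X] [MeasurableSpace Y] {f : E → X → Y}
    (hf : Measurable fun p : E × X => f p.1 p.2) {a : A → E} {b : A → X} (ha : Measurable a)
    (hb : Measurable b) : Measurable fun z => f (a z) (b z) :=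
  hf.comp (ha.prodMk hb)

lemma measurableSet_uncurry_comp {A E X : Type*} [MeasurableSpace A] [MeasurableSpace E]
    [MeasurableSpace X] {D : E → X → Prop} (hD : MeasurableSet {p : E × X | D p.1 p.2})
    {a : A → E} {b : A → X} (ha : Measurable a) (hb : Measurable b) :
    MeasurableSet {z | D (a z) (b z)} :=
  (ha.prodMk hb) hD

end MeasureInstances

/-! ### The class 𝒮: densities, uniqueness, iterated transforms. -/

section ClassS

variable {T : ℝ} {W : Measure (C0 T)} {φ : ℕ → ℝ → ℝ} {h : ℝ → ℝ}

instance instSecondCountableTopologyL2 (T : ℝ) : SecondCountableTopology (L2 T) := by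
  have : Fact ((2 : ENNReal) ≠ ⊤) := ⟨by simp⟩
  infer_instance

/-- The variance of the integral of `h u` against a Wiener path. -/
def gvar (T : ℝ) (h u : ℝ → ℝ) : ℝ := ∫ t, (h t * u t) ^ 2 ∂(leb T)

/-- The phase of the functionals in `𝒮(L_2[0,T])`. -/
def pwzPhase (φ : ℕ → ℝ → ℝ) (u : L2 T) (x : C0 T) : ℝ := pwz φ u x

/-- The natural domain of `pwzPhase`. -/
def pwzDomain (φ : ℕ → ℝ → ℝ) (u : L2 T) (x : C0 T) : Prop := PwzConv φ u x

lemma isPhase_pwzPhase (hW : IsWienerMeasure W) (hT : 0 < T) (hφ : IsBVBasis T φ) :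
    IsPhase W (pwzPhase φ) (pwzDomain φ) where
  measurable := measurable_pwz_uncurry hT hφ
  measurableSet := measurableSet_pwzConv hT hφ
  ae u := ae_pwzConv hW hT hφ (Lp.memLp u)
  smul _ _ s hx := hx.smul hT hφ s
  add_smul _ _ _ s hy hz := hy.pwz_add_smul hT hφ hz s

lemma isNormalAlong_pwzPhase (hW : IsWienerMeasure W) (hT : 0 < T) (hφ : IsBVBasis T φ)
    (hh : MemLp h ⊤ (leb T)) :
    IsNormalAlong W (pwzPhase φ) (pwzDomain φ) (gaussianPath W φ h)
      (fun u : L2 T => gvar T h u) where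
  measurable := (isGaussianPath_gaussianPath hW hT hφ hh).1
  ae u := (ae_pwz_gaussianPath hW hT hφ hh (Lp.memLp u)).mono fun _ hx => hx.1
  nonneg _ := integral_nonneg fun _ => sq_nonneg _
  normal u := (centredNormal_pwz hW hT hφ (memLp_two_mul hh (Lp.memLp u))).congr
    ((ae_pwz_gaussianPath hW hT hφ hh (Lp.memLp u)).mono fun _ hx => hx.2) rfl

lemma measurable_pwzPhase_left (hT : 0 < T) (hφ : IsBVBasis T φ) (x : C0 T) :
    Measurable fun u : L2 T => pwzPhase φ u x :=
  measurable_uncurry_comp (f := pwzPhase φ) (measurable_pwz_uncurry hT hφ) measurable_id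
    measurable_const

lemma integral_withDensity_phase (hT : 0 < T) (hφ : IsBVBasis T φ) {μ : Measure (L2 T)}
    [IsFiniteMeasure μ] {κ : L2 T → ℂ} (hκ : Integrable κ μ) (x : C0 T) :
    VectorMeasure.integral (μ.withDensityᵥ κ)
      (fun u : L2 T => Complex.exp (Complex.I * (pwz φ u x : ℂ)))
      (ContinuousLinearMap.mul ℝ ℂ) = phaseInt (pwzPhase φ) μ κ x := by
  have hm' : Measurable fun u : L2 T => Complex.exp (Complex.I * (pwzPhase φ u x : ℂ)) :=
    ((Complex.measurable_ofReal.comp (measurable_pwzPhase_left hT hφ x)).const_mul Complex.I).cexp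
  refine integral_withDensityᵥ hκ hm' (C := 1) fun u => ?_
  rw [mul_comm Complex.I, Complex.norm_exp_ofReal_mul_I]

lemma inS_phaseInt (hT : 0 < T) (hφ : IsBVBasis T φ) {μ : Measure (L2 T)}
    [IsFiniteMeasure μ] {κ : L2 T → ℂ} (hκ : Integrable κ μ) :
    InS φ (phaseInt (pwzPhase φ) μ κ) :=
  ⟨μ.withDensityᵥ κ, fun x => (integral_withDensity_phase hT hφ hκ x).symm⟩

lemma InS.exists_phaseInt_eq (hT : 0 < T) (hφ : IsBVBasis T φ) {F : C0 T → ℂ} (hF : InS φ F) :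
    ∃ (μ : Measure (L2 T)) (κ : L2 T → ℂ), IsFiniteMeasure μ ∧ Measurable κ ∧ Integrable κ μ ∧
      F = phaseInt (pwzPhase φ) μ κ := by
  obtain ⟨f, hf⟩ := hF
  obtain ⟨μ, κ, hμ, hκ, rfl⟩ := exists_withDensity_eq f
  refine ⟨μ, hκ.1.mk κ, hμ, hκ.1.stronglyMeasurable_mk.measurable, hκ.congr hκ.1.ae_eq_mk, ?_⟩
  ext x
  rw [hf x, integral_withDensity_phase hT hφ hκ x]
  refine integral_congr_ae ?_
  filter_upwards [hκ.1.ae_eq_mk] with u hu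
  simp only [← hu]

/-- Placing both densities over μ + ν makes the difference of two functionals a single Fourier
integral. -/
lemma exists_common_density {X : Type*} [MeasurableSpace X] (μ ν : Measure X) [IsFiniteMeasure μ]
    [IsFiniteMeasure ν] {κ κ' : X → ℂ} (hκ : Integrable κ μ) (hκ' : Integrable κ' ν) :
    ∃ k k' : X → ℂ, Integrable k (μ + ν) ∧ Integrable k' (μ + ν) ∧
      (∀ g : X → ℂ, ∫ x, k x * g x ∂(μ + ν) = ∫ x, κ x * g x ∂μ) ∧
      ∀ g : X → ℂ, ∫ x, k' x * g x ∂(μ + ν) = ∫ x, κ' x * g x ∂ν := by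
  have h1 : μ ≪ μ + ν := Measure.absolutelyContinuous_of_le (Measure.le_add_right le_rfl)
  have h2 : ν ≪ μ + ν := Measure.absolutelyContinuous_of_le (Measure.le_add_left le_rfl)
  refine ⟨fun x => (μ.rnDeriv (μ + ν) x).toReal • κ x, fun x => (ν.rnDeriv (μ + ν) x).toReal • κ' x,
    (integrable_rnDeriv_smul_iff h1).2 hκ, (integrable_rnDeriv_smul_iff h2).2 hκ',
    fun g => ?_, fun g => ?_⟩
  · simp only [smul_mul_assoc]
    exact integral_rnDeriv_smul h1
  · simp only [smul_mul_assoc]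
    exact integral_rnDeriv_smul h2

lemma integral_sub_sq_eq_norm_sq (u v : L2 T) :
    ∫ t, (u t - v t) ^ 2 ∂(leb T) = ‖u - v‖ ^ 2 := by
  rw [← real_inner_self_eq_norm_sq, L2.inner_def]
  refine integral_congr_ae ?_
  filter_upwards [Lp.coeFn_sub u v] with t ht
  have ht' : (u - v : L2 T) t = u t - v t := ht
  rw [ht']
  simp [sq]

/-- A functional in `𝒮(L_2[0,T])` is determined by its values almost everywhere. -/
theorem phaseInt_eq_of_ae_eq (hW : IsWienerMeasure W) (hT : 0 < T) (hφ : IsBVBasis T φ)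
    {μ ν : Measure (L2 T)} [IsFiniteMeasure μ] [IsFiniteMeasure ν] {κ κ' : L2 T → ℂ}
    (hκ : Integrable κ μ) (hκ' : Integrable κ' ν)
    (h : ∀ᵐ x ∂W, phaseInt (pwzPhase φ) μ κ x = phaseInt (pwzPhase φ) ν κ' x) :
    phaseInt (pwzPhase φ) μ κ = phaseInt (pwzPhase φ) ν κ' := by
  have := hW.prob
  obtain ⟨k, k', hk, hk', e, e'⟩ := exists_common_density μ ν hκ hκ'
  have hN := isPhase_pwzPhase hW hT hφ
  have hK : Integrable (fun u => k u - k' u) (μ + ν) := hk.sub hk'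
  have hsub : ∀ x : C0 T, ∫ u, (k u - k' u) * Complex.exp (Complex.I * (pwzPhase φ u x : ℂ)) ∂(μ + ν)
      = phaseInt (pwzPhase φ) μ κ x - phaseInt (pwzPhase φ) ν κ' x := fun x => by
    have i1 := integrable_mul_exp_I hk (hN.measurable_left x)
    have i2 := integrable_mul_exp_I hk' (hN.measurable_left x)
    simp only [sub_mul]
    rw [integral_sub i1 i2, e, e']
    rfl
  -- The difference is multiplied by exp(-i⟨v,x⟩) and integrated over x. Since ⟨u,x⟩ - ⟨v,x⟩ has
  -- variance ‖u - v‖², Fubini yields the Gaussian average of k - k' around v.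
  have hzero : (fun u => k u - k' u) =ᵐ[μ + ν] 0 := by
    refine ae_eq_zero_of_integral_gaussian_eq_zero hK fun v => ?_
    have hm : Measurable fun p : L2 T × C0 T => pwzPhase φ p.1 p.2 - pwzPhase φ v p.2 :=
      hN.measurable.sub ((hN.measurable_right v).comp measurable_snd)
    have hint : Integrable (fun p : L2 T × C0 T => (k p.1 - k' p.1) *
        Complex.exp (Complex.I * ((1 * (pwzPhase φ p.1 p.2 - pwzPhase φ v p.2) : ℝ) : ℂ)))
        ((μ + ν).prod W) :=
      integrable_mul_exp_I (hK.comp_fst W) (by simpa only [one_mul] using hm)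
    have h1 : ∀ u : L2 T, (k u - k' u) * Complex.exp ((-(‖u - v‖ ^ 2 / 2) : ℝ) : ℂ) =
        ∫ x, (k u - k' u) *
          Complex.exp (Complex.I * ((1 * (pwzPhase φ u x - pwzPhase φ v x) : ℝ) : ℂ)) ∂W := by
      intro u
      rw [integral_const_mul]
      have h2 := (centredNormal_pwz_sub hW hT hφ (Lp.memLp u) (Lp.memLp v)).integral_exp
        (integral_nonneg fun t => sq_nonneg _) 1
      rw [integral_sub_sq_eq_norm_sq, one_pow, one_mul] at h2
      rw [← h2]
      rfl
    simp only [h1]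
    rw [integral_integral_swap hint]
    refine integral_eq_zero_of_ae ?_
    filter_upwards [h] with x hx
    have h3 : ∀ u : L2 T, (k u - k' u) *
        Complex.exp (Complex.I * ((1 * (pwzPhase φ u x - pwzPhase φ v x) : ℝ) : ℂ)) =
        ((k u - k' u) * Complex.exp (Complex.I * (pwzPhase φ u x : ℂ))) *
          Complex.exp (-(Complex.I * (pwzPhase φ v x : ℂ))) := fun u => by
      rw [mul_assoc, ← Complex.exp_add]
      congr 2
      push_cast
      ring
    simp only [h3]
    rw [integral_mul_const, hsub, hx, sub_self, zero_mul]
    rfl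
  -- The densities agree almost everywhere, so the functionals agree at every path.
  ext x
  rw [← sub_eq_zero, ← hsub]
  refine integral_eq_zero_of_ae ?_
  filter_upwards [hzero] with u hu
  simp only [Pi.zero_apply] at hu ⊢
  rw [hu, zero_mul]

/-- The quadratic form attached to a list of transforms. -/
def listVar (L : List (ℝ × (ℝ → ℝ))) (u : L2 T) : ℝ :=
  (L.map fun P => gvar T P.2 u / P.1).sum

/-- The density obtained from `κ` by the successive transforms along a list. -/
def rotateList (L : List (ℝ × (ℝ → ℝ))) (κ : L2 T → ℂ) (u : L2 T) : ℂ :=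
  κ u * Complex.exp (((-(listVar L u / 2) : ℝ) : ℂ) * Complex.I)

lemma rotateList_nil (κ : L2 T → ℂ) : rotateList [] κ = κ := by
  ext u
  simp [rotateList, listVar]

lemma rotateList_cons (q : ℝ) (h : ℝ → ℝ) (L : List (ℝ × (ℝ → ℝ))) (κ : L2 T → ℂ) :
    rotateList ((q, h) :: L) κ = rotateList L (rotate q (fun u : L2 T => gvar T h u) κ) := by
  ext u
  simp only [rotateList, rotate, listVar, List.map_cons, List.sum_cons]
  rw [mul_assoc, ← Complex.exp_add]
  congr 2
  push_cast
  ring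

variable {μ : Measure (L2 T)}

lemma measurable_rotateList (hW : IsWienerMeasure W) (hT : 0 < T) (hφ : IsBVBasis T φ)
    {L : List (ℝ × (ℝ → ℝ))} (hL : ∀ P ∈ L, MemLp P.2 ⊤ (leb T)) {κ : L2 T → ℂ}
    (hκ : Measurable κ) : Measurable (rotateList L κ) := by
  have := hW.prob
  induction L generalizing κ with
  | nil => rwa [rotateList_nil]
  | cons P L ih =>
    obtain ⟨q, h⟩ := P
    rw [rotateList_cons]
    refine ih (fun P hP => hL P (List.mem_cons_of_mem _ hP)) (measurable_rotate q ?_ hκ)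
    exact (isNormalAlong_pwzPhase hW hT hφ
      (hL (q, h) List.mem_cons_self)).measurable_variance (isPhase_pwzPhase hW hT hφ)

lemma integrable_rotateList (hW : IsWienerMeasure W) (hT : 0 < T) (hφ : IsBVBasis T φ)
    {L : List (ℝ × (ℝ → ℝ))} (hL : ∀ P ∈ L, MemLp P.2 ⊤ (leb T)) {κ : L2 T → ℂ}
    (hκm : Measurable κ) (hκ : Integrable κ μ) : Integrable (rotateList L κ) μ :=
  hκ.mono (measurable_rotateList hW hT hφ hL hκm).aestronglyMeasurable
    (ae_of_all _ fun _ => (norm_mul_exp_ofReal_mul_I _ _).le)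

variable [IsFiniteMeasure μ]

theorem isIterGFFT_phaseInt (hW : IsWienerMeasure W) (hT : 0 < T) (hφ : IsBVBasis T φ) {p : ℝ}
    (hp : p ∈ Set.Icc (1 : ℝ) 2) {L : List (ℝ × (ℝ → ℝ))}
    (hL : ∀ P ∈ L, P.1 ≠ 0 ∧ MemLp P.2 ⊤ (leb T)) {κ : L2 T → ℂ} (hκm : Measurable κ)
    (hκ : Integrable κ μ) :
    IsIterGFFT W φ p L (phaseInt (pwzPhase φ) μ κ)
      (phaseInt (pwzPhase φ) μ (rotateList L κ)) := by
  have := hW.prob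
  induction L generalizing κ with
  | nil =>
    rw [rotateList_nil]
    rfl
  | cons P L ih =>
    obtain ⟨q, h⟩ := P
    obtain ⟨hq, hh⟩ := hL (q, h) List.mem_cons_self
    have hN := isPhase_pwzPhase hW hT hφ
    have hZ := isNormalAlong_pwzPhase hW hT hφ hh
    have hσ := hZ.measurable_variance hN
    have hκ1m := measurable_rotate q hσ hκm
    have hκ1 := integrable_rotate q hσ hκ
    rw [rotateList_cons]
    exact ⟨_, inS_phaseInt hT hφ hκ1, isGFFT_phaseInt hN hZ hκm hκ hq hp,
      ih (fun P hP => hL P (List.mem_cons_of_mem _ hP)) hκ1m hκ1⟩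

/-- Each intermediate functional is s-a.e. the explicit one, and both belong to the class, so they
are equal everywhere. Hence the induction continues with an identity of functionals. -/
theorem IsIterGFFT.eq_phaseInt (hW : IsWienerMeasure W) (hT : 0 < T) (hφ : IsBVBasis T φ) {p : ℝ}
    (hp : p ∈ Set.Icc (1 : ℝ) 2) {L : List (ℝ × (ℝ → ℝ))}
    (hL : ∀ P ∈ L, P.1 ≠ 0 ∧ MemLp P.2 ⊤ (leb T)) {κ : L2 T → ℂ} (hκm : Measurable κ)
    (hκ : Integrable κ μ) {A : C0 T → ℂ}
    (hA : IsIterGFFT W φ p L (phaseInt (pwzPhase φ) μ κ) A) :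
    A = phaseInt (pwzPhase φ) μ (rotateList L κ) := by
  have := hW.prob
  induction L generalizing κ with
  | nil =>
    rw [rotateList_nil]
    exact hA
  | cons P L ih =>
    obtain ⟨q, h⟩ := P
    obtain ⟨hq, hh⟩ := hL (q, h) List.mem_cons_self
    have hN := isPhase_pwzPhase hW hT hφ
    have hZ := isNormalAlong_pwzPhase hW hT hφ hh
    have hσ := hZ.measurable_variance hN
    have hκ1m := measurable_rotate q hσ hκm
    have hκ1 := integrable_rotate q hσ hκ
    obtain ⟨F', hF', hG, hA'⟩ := hA
    obtain ⟨ν, κ', hν, -, hκ', rfl⟩ := hF'.exists_phaseInt_eq hT hφ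
    -- Scale 1 already suffices for the uniqueness theorem.
    have hae := hG.sae_eq_phaseInt hN hZ hκm hκ hq hp 1 one_pos
    simp only [one_smul] at hae
    rw [phaseInt_eq_of_ae_eq hW hT hφ hκ' hκ1 hae] at hA'
    rw [rotateList_cons]
    exact ih (fun P hP => hL P (List.mem_cons_of_mem _ hP)) hκ1m hκ1 hA'

end ClassS

/-! ### Products and generalized convolution products in 𝒮. -/

section Convolution

variable {T : ℝ} {W : Measure (C0 T)} {φ : ℕ → ℝ → ℝ}

/-- The phase of a product `F(·/√2) G(·/√2)`. -/
def prodPhase (φ : ℕ → ℝ → ℝ) (w : L2 T × L2 T) (y : C0 T) : ℝ :=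
  pwzPhase φ w.1 ((√2)⁻¹ • y) + pwzPhase φ w.2 ((√2)⁻¹ • y)

/-- The natural domain of `prodPhase`. -/
def prodDomain (φ : ℕ → ℝ → ℝ) (w : L2 T × L2 T) (y : C0 T) : Prop :=
  pwzDomain φ w.1 y ∧ pwzDomain φ w.2 y

lemma isPhase_prodPhase (hW : IsWienerMeasure W) (hT : 0 < T) (hφ : IsBVBasis T φ) :
    IsPhase W (prodPhase φ) (prodDomain φ) where
  measurable := by
    have hm := (isPhase_pwzPhase hW hT hφ).measurable
    have h1 : Measurable fun p : (L2 T × L2 T) × C0 T => (√2)⁻¹ • p.2 :=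
      (measurable_const_smul_C0 _).comp measurable_snd
    exact (measurable_uncurry_comp hm (measurable_fst.comp measurable_fst) h1).add
      (measurable_uncurry_comp hm (measurable_snd.comp measurable_fst) h1)
  measurableSet := by
    have hm := (isPhase_pwzPhase hW hT hφ).measurableSet
    exact (measurableSet_uncurry_comp hm (measurable_fst.comp measurable_fst)
      measurable_snd).inter
      (measurableSet_uncurry_comp hm (measurable_snd.comp measurable_fst) measurable_snd)
  ae w := ((isPhase_pwzPhase hW hT hφ).ae w.1).and ((isPhase_pwzPhase hW hT hφ).ae w.2)
  smul _ _ s hx := ⟨(isPhase_pwzPhase hW hT hφ).smul _ _ s hx.1,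
    (isPhase_pwzPhase hW hT hφ).smul _ _ s hx.2⟩
  add_smul w y z s hy hz := by
    have hN := isPhase_pwzPhase hW hT hφ
    simp only [prodPhase, smul_add, smul_comm _ s]
    rw [hN.add_smul _ _ _ s (hN.smul _ _ _ hy.1) (hN.smul _ _ _ hz.1),
      hN.add_smul _ _ _ s (hN.smul _ _ _ hy.2) (hN.smul _ _ _ hz.2)]
    ring

/-- The variance of `prodPhase` along `Z_h`. -/
def prodVar (h : ℝ → ℝ) (w : L2 T × L2 T) : ℝ :=
  (∫ t, (h t * w.1 t + h t * w.2 t) ^ 2 ∂(leb T)) / 2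

/-- The variance of `2^{-1/2}(⟨u, Z_{k₁}⟩ - ⟨v, Z_{k₂}⟩)`. -/
def convVar (k₁ k₂ : ℝ → ℝ) (w : L2 T × L2 T) : ℝ :=
  (∫ t, (k₁ t * w.1 t - k₂ t * w.2 t) ^ 2 ∂(leb T)) / 2

lemma inv_sqrt_two_sq : (√2 : ℝ)⁻¹ ^ 2 = 2⁻¹ := by
  rw [inv_pow, Real.sq_sqrt zero_le_two]

lemma isNormalAlong_prodPhase (hW : IsWienerMeasure W) (hT : 0 < T) (hφ : IsBVBasis T φ)
    {h : ℝ → ℝ} (hh : MemLp h ⊤ (leb T)) :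
    IsNormalAlong W (prodPhase φ) (prodDomain φ) (gaussianPath W φ h)
      (fun w : L2 T × L2 T => prodVar h w) where
  measurable := (isGaussianPath_gaussianPath hW hT hφ hh).1
  ae w := by
    filter_upwards [ae_pwz_gaussianPath hW hT hφ hh (Lp.memLp w.1),
      ae_pwz_gaussianPath hW hT hφ hh (Lp.memLp w.2)] with x h1 h2 using ⟨h1.1, h2.1⟩
  nonneg _ := div_nonneg (integral_nonneg fun _ => sq_nonneg _) zero_le_two
  normal w := by
    have m1 := memLp_two_mul hh (Lp.memLp w.1)
    have m2 := memLp_two_mul hh (Lp.memLp w.2)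
    refine ((centredNormal_pwz hW hT hφ (m1.add m2)).const_mul (√2)⁻¹).congr ?_ ?_
    · filter_upwards [ae_pwz_gaussianPath hW hT hφ hh (Lp.memLp w.1),
        ae_pwz_gaussianPath hW hT hφ hh (Lp.memLp w.2), ae_pwz_add_mul hW hT hφ m1 m2 1 1]
        with x h1 h2 h3
      simp only [one_mul] at h3
      rw [prodPhase, pwzPhase, pwzPhase, h1.1.pwz_smul hT hφ, h2.1.pwz_smul hT hφ, h1.2, h2.2, ← mul_add, ← h3]
      rfl
    · rw [inv_sqrt_two_sq, prodVar, div_eq_inv_mul]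
      rfl

lemma centredNormal_convolution (hW : IsWienerMeasure W) (hT : 0 < T) (hφ : IsBVBasis T φ)
    {k₁ k₂ : ℝ → ℝ} (hk₁ : MemLp k₁ ⊤ (leb T)) (hk₂ : MemLp k₂ ⊤ (leb T)) (w : L2 T × L2 T) :
    CentredNormal W (fun x => (√2)⁻¹ * (pwz φ w.1 (gaussianPath W φ k₁ x) -
      pwz φ w.2 (gaussianPath W φ k₂ x))) (convVar k₁ k₂ w) := by
  refine ((centredNormal_pwz_sub hW hT hφ (memLp_two_mul hk₁ (Lp.memLp w.1))
    (memLp_two_mul hk₂ (Lp.memLp w.2))).const_mul (√2)⁻¹).congr ?_ ?_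
  · filter_upwards [ae_pwz_gaussianPath hW hT hφ hk₁ (Lp.memLp w.1),
      ae_pwz_gaussianPath hW hT hφ hk₂ (Lp.memLp w.2)] with x h1 h2
    rw [h1.2, h2.2]
  · rw [inv_sqrt_two_sq, convVar, div_eq_inv_mul]

variable {μ ν : Measure (L2 T)} [IsFiniteMeasure μ] [IsFiniteMeasure ν] {κ κ' : L2 T → ℂ}

lemma phaseInt_mul_phaseInt (z z' : C0 T) :
    phaseInt (pwzPhase φ) μ κ z * phaseInt (pwzPhase φ) ν κ' z' =
      ∫ w : L2 T × L2 T, (κ w.1 * κ' w.2) *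
        Complex.exp (Complex.I * ((pwz φ w.1 z + pwz φ w.2 z' : ℝ) : ℂ)) ∂(μ.prod ν) := by
  rw [phaseInt, phaseInt, ← integral_prod_mul]
  refine integral_congr_ae (ae_of_all _ fun w => ?_)
  simp only [pwzPhase]
  rw [Complex.ofReal_add, mul_add, Complex.exp_add]
  ring

lemma phaseInt_mul_phaseInt_smul :
    (fun y => phaseInt (pwzPhase φ) μ κ ((√2)⁻¹ • y) * phaseInt (pwzPhase φ) ν κ' ((√2)⁻¹ • y)) =
      phaseInt (prodPhase φ) (μ.prod ν) (fun w => κ w.1 * κ' w.2) :=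
  funext fun _ => phaseInt_mul_phaseInt _ _

/-- The generalized convolution product of two functionals in `𝒮(L_2[0,T])`. -/
theorem sae_isGCPAt_phaseInt (hW : IsWienerMeasure W) (hT : 0 < T) (hφ : IsBVBasis T φ)
    {k₁ k₂ : ℝ → ℝ} (hk₁ : MemLp k₁ ⊤ (leb T)) (hk₂ : MemLp k₂ ⊤ (leb T))
    (hκ : Integrable κ μ) (hκ' : Integrable κ' ν) {q : ℝ} (hq : q ≠ 0) :
    SAE W fun y => IsGCPAt W φ q k₁ k₂ (phaseInt (pwzPhase φ) μ κ) (phaseInt (pwzPhase φ) ν κ') y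
      (phaseInt (prodPhase φ) (μ.prod ν)
        (rotate q (convVar k₁ k₂) (fun w : L2 T × L2 T => κ w.1 * κ' w.2)) y) := by
  have := hW.prob
  have hN := isPhase_pwzPhase hW hT hφ
  have hP := isPhase_prodPhase hW hT hφ
  have hZ₁ := isNormalAlong_pwzPhase hW hT hφ hk₁
  have hZ₂ := isNormalAlong_pwzPhase hW hT hφ hk₂
  have hκκ : Integrable (fun w : L2 T × L2 T => κ w.1 * κ' w.2) (μ.prod ν) := hκ.mul_prod hκ'
  have hσ0 : ∀ w : L2 T × L2 T, 0 ≤ convVar k₁ k₂ w := fun _ =>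
    div_nonneg (integral_nonneg fun _ => sq_nonneg _) zero_le_two
  set b : L2 T × L2 T → C0 T → ℝ := fun w x =>
    (√2)⁻¹ * (pwz φ w.1 (gaussianPath W φ k₁ x) - pwz φ w.2 (gaussianPath W φ k₂ x)) with hb_def
  have hb : Measurable fun p : (L2 T × L2 T) × C0 T => b p.1 p.2 :=
    (((hZ₁.measurable_uncurry hN).comp
      ((measurable_fst.comp measurable_fst).prodMk measurable_snd)).sub
      ((hZ₂.measurable_uncurry hN).comp
        ((measurable_snd.comp measurable_fst).prodMk measurable_snd))).const_mul _
  have hbN : ∀ w, CentredNormal W (b w) (convVar k₁ k₂ w) :=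
    centredNormal_convolution hW hT hφ hk₁ hk₂
  have hσ := measurable_of_centredNormal hb hσ0 hbN
  have hgood : ∀ᵐ x ∂W, ∀ᵐ w ∂(μ.prod ν), PwzConv φ w.1 (gaussianPath W φ k₁ x) ∧
      PwzConv φ w.2 (gaussianPath W φ k₂ x) := by
    filter_upwards [hZ₁.ae_ae hN (μ := μ), hZ₂.ae_ae hN (μ := ν)] with x h1 h2
    filter_upwards [Measure.quasiMeasurePreserving_fst.ae h1,
      Measure.quasiMeasurePreserving_snd.ae h2] with w h3 h4 using ⟨h3, h4⟩
  intro ρ hρ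
  filter_upwards [hP.sae_ae (μ := μ.prod ν) ρ hρ] with y hy
  -- The phase at y is absorbed into the density; only the normal variable `b w`, which combines the
  -- two processes, is averaged.
  have hK := integrable_mul_exp_I hκκ (hP.measurable_left (ρ • y))
  refine ⟨_, isAnalyticWienerIntegral_of_centredNormal hK hb hσ0 hbN fun s => ?_, ?_⟩
  · filter_upwards [hgood] with x hx
    rw [phaseInt_mul_phaseInt]
    refine integral_congr_ae ?_
    filter_upwards [hx, hy] with w hwx hwy
    have e1 : (√2)⁻¹ • (ρ • y + s • gaussianPath W φ k₁ x) =
        (√2)⁻¹ • ρ • y + ((√2)⁻¹ * s) • gaussianPath W φ k₁ x := by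
      rw [smul_add, mul_smul]
    have e2 : (√2)⁻¹ • (ρ • y - s • gaussianPath W φ k₂ x) =
        (√2)⁻¹ • ρ • y + (-((√2)⁻¹ * s)) • gaussianPath W φ k₂ x := by
      rw [smul_sub, sub_eq_add_neg]
      congr 1
      rw [← mul_smul]
      module
    rw [e1, e2, (hwy.1.smul hT hφ _).pwz_add_smul hT hφ hwx.1,
      (hwy.2.smul hT hφ _).pwz_add_smul hT hφ hwx.2, mul_assoc _ (Complex.exp _) (Complex.exp _),
      ← Complex.exp_add, ← mul_add, ← Complex.ofReal_add]
    congr 4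
    simp only [prodPhase, pwzPhase, hb_def]
    ring
  · have e : phaseInt (prodPhase φ) (μ.prod ν)
        (rotate q (convVar k₁ k₂) (fun w : L2 T × L2 T => κ w.1 * κ' w.2)) (ρ • y) =
        ∫ w : L2 T × L2 T, ((κ w.1 * κ' w.2) *
          Complex.exp (Complex.I * (prodPhase φ w (ρ • y) : ℂ))) *
          Complex.exp (((-(convVar k₁ k₂ w / (2 * q)) : ℝ) : ℂ) * Complex.I) ∂(μ.prod ν) :=
      integral_congr_ae (ae_of_all _ fun w => by simp only [rotate]; ring)
    rw [e]
    exact tendsto_integral_exp_neg_div hK hσ hσ0 hq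

end Convolution

/-! ### Algebra of the variances and cancellation of the phases. -/

section QuadraticForms

variable {T : ℝ}

lemma integral_add_mul_sq {f g : ℝ → ℝ} (hf : MemLp f 2 (leb T)) (hg : MemLp g 2 (leb T))
    (c : ℝ) :
    ∫ t, (f t + c * g t) ^ 2 ∂(leb T) = ∫ t, f t ^ 2 ∂(leb T) +
      2 * c * ∫ t, f t * g t ∂(leb T) + c ^ 2 * ∫ t, g t ^ 2 ∂(leb T) := by
  have h1 : Integrable (fun t => f t ^ 2) (leb T) := hf.integrable_sq
  have h2 : Integrable (fun t => 2 * c * (f t * g t)) (leb T) := (hf.integrable_mul hg).const_mul _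
  have h3 : Integrable (fun t => c ^ 2 * g t ^ 2) (leb T) := hg.integrable_sq.const_mul _
  have h12 : Integrable (fun t => f t ^ 2 + 2 * c * (f t * g t)) (leb T) := h1.add h2
  have e : ∀ t, (f t + c * g t) ^ 2 = f t ^ 2 + 2 * c * (f t * g t) + c ^ 2 * g t ^ 2 :=
    fun t => by ring
  simp only [e]
  rw [integral_add h12 h3, integral_add h1 h2, integral_const_mul, integral_const_mul]

lemma convVar_eq {k₁ k₂ : ℝ → ℝ} (hk₁ : MemLp k₁ ⊤ (leb T)) (hk₂ : MemLp k₂ ⊤ (leb T))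
    (w : L2 T × L2 T) :
    convVar k₁ k₂ w = (gvar T k₁ w.1 + gvar T k₂ w.2) / 2 -
      ∫ t, (k₁ t * w.1 t) * (k₂ t * w.2 t) ∂(leb T) := by
  have h1 := integral_add_mul_sq (memLp_two_mul hk₁ (Lp.memLp w.1))
    (memLp_two_mul hk₂ (Lp.memLp w.2)) (-1)
  have e : ∀ t, k₁ t * w.1 t - k₂ t * w.2 t = k₁ t * w.1 t + -1 * (k₂ t * w.2 t) :=
    fun t => by ring
  simp only [convVar, e]
  rw [h1, gvar, gvar]
  ring

lemma prodVar_eq {h : ℝ → ℝ} (hh : MemLp h ⊤ (leb T)) (w : L2 T × L2 T) :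
    prodVar h w = (gvar T h w.1 + gvar T h w.2) / 2 +
      ∫ t, (h t * w.1 t) * (h t * w.2 t) ∂(leb T) := by
  have h1 := integral_add_mul_sq (memLp_two_mul hh (Lp.memLp w.1))
    (memLp_two_mul hh (Lp.memLp w.2)) 1
  simp only [one_mul] at h1
  rw [prodVar, h1, gvar, gvar]
  ring

lemma gvar_sqrt_smul (h u : ℝ → ℝ) {c : ℝ} (hc : 0 ≤ c) :
    gvar T (√c • h) u = c * gvar T h u := by
  rw [gvar, gvar, ← integral_const_mul]
  refine integral_congr_ae (ae_of_all _ fun t => ?_)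
  simp only [Pi.smul_apply, smul_eq_mul, mul_pow, Real.sq_sqrt hc]
  ring

lemma gvar_eq_sum {n : ℕ} {s : ℝ → ℝ} {k : Fin n → ℝ → ℝ} (hk : ∀ j, MemLp (k j) ⊤ (leb T))
    {c : Fin n → ℝ} (hc : ∀ j, 0 ≤ c j)
    (hs : ∀ᵐ t ∂(leb T), s t ^ 2 = ∑ j, (√(c j) * k j t) ^ 2) {u : ℝ → ℝ}
    (hu : MemLp u 2 (leb T)) : gvar T s u = ∑ j, c j * gvar T (k j) u := by
  have h1 : gvar T s u = ∫ t, ∑ j, c j * (k j t * u t) ^ 2 ∂(leb T) := by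
    refine integral_congr_ae ?_
    filter_upwards [hs] with t ht
    rw [mul_pow, ht, Finset.sum_mul]
    refine Finset.sum_congr rfl fun j _ => ?_
    rw [mul_pow, Real.sq_sqrt (hc j)]
    ring
  rw [h1, integral_finsetSum _ fun j _ => (memLp_two_mul (hk j) hu).integrable_sq.const_mul _]
  exact Finset.sum_congr rfl fun j _ => integral_const_mul _ _

lemma gvar_eq_add {v h s : ℝ → ℝ} (hh : MemLp h ⊤ (leb T)) (hs : MemLp s ⊤ (leb T))
    (hv : ∀ᵐ t ∂(leb T), v t ^ 2 = h t ^ 2 + s t ^ 2) {u : ℝ → ℝ} (hu : MemLp u 2 (leb T)) :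
    gvar T v u = gvar T h u + gvar T s u := by
  have h1 : gvar T v u = ∫ t, ((h t * u t) ^ 2 + (s t * u t) ^ 2) ∂(leb T) := by
    refine integral_congr_ae ?_
    filter_upwards [hv] with t ht
    rw [mul_pow, ht]
    ring
  rw [h1]
  exact integral_add (memLp_two_mul hh hu).integrable_sq (memLp_two_mul hs hu).integrable_sq

/-- The oscillating factors of the convolution product combine with those of its two factors to
the oscillating factor of a single transform. -/
lemma rotate_convVar_rotateList {s₁ s₂ h : ℝ → ℝ} (hs₁ : MemLp s₁ ⊤ (leb T))
    (hs₂ : MemLp s₂ ⊤ (leb T)) (hh : MemLp h ⊤ (leb T))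
    (h_sq : ∀ᵐ t ∂(leb T), h t ^ 2 = s₁ t * s₂ t) {q : ℝ} {L₁ L₂ : List (ℝ × (ℝ → ℝ))}
    (hL₁ : ∀ u : L2 T, listVar L₁ u = (gvar T s₁ u + gvar T h u) / (2 * q))
    (hL₂ : ∀ u : L2 T, listVar L₂ u = (gvar T s₂ u + gvar T h u) / (2 * q)) (κ κ' : L2 T → ℂ) :
    rotate (-q) (convVar s₁ s₂)
        (fun w : L2 T × L2 T => rotateList L₁ κ w.1 * rotateList L₂ κ' w.2) =
      rotate q (prodVar h) fun w : L2 T × L2 T => κ w.1 * κ' w.2 := by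
  ext w
  have hX : ∫ t, (s₁ t * w.1 t) * (s₂ t * w.2 t) ∂(leb T) =
      ∫ t, (h t * w.1 t) * (h t * w.2 t) ∂(leb T) := by
    refine integral_congr_ae ?_
    filter_upwards [h_sq] with t ht
    linear_combination (-(w.1 t * w.2 t)) * ht
  -- Because of the parameter -q the convolution variance enters with a plus sign: its squares
  -- cancel those of s₁ and s₂, and by `hX` its cross term becomes that of h.
  have e : -(listVar L₁ w.1 / 2) + -(listVar L₂ w.2 / 2) + -(convVar s₁ s₂ w / (2 * -q)) =
      -(prodVar h w / (2 * q)) := by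
    rw [hL₁, hL₂, convVar_eq hs₁ hs₂, prodVar_eq hh, hX]
    rcases eq_or_ne q 0 with rfl | hq
    · simp
    · field_simp
      ring
  simp only [rotate, rotateList]
  rw [← e]
  push_cast
  simp only [add_mul, Complex.exp_add]
  ring

end QuadraticForms

/-! ### Signs of the parameters and the quadratic forms of the three lists. -/

section Parameters

variable {T q : ℝ}

/-- The common sign is used through positivity of the ratios to q, which makes the square roots in
the kernels genuine. -/
lemma div_pos_of_sign_eq {a : ℝ} (hq : q ≠ 0) (h : SignType.sign a = SignType.sign q) :
    0 < a / q := by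
  rcases lt_or_gt_of_ne hq with h0 | h0
  · rw [sign_neg h0, sign_eq_neg_one_iff] at h
    exact div_pos_of_neg_of_neg h h0
  · rw [sign_pos h0, sign_eq_one_iff] at h
    exact div_pos h h0

lemma ne_zero_of_div_pos {a : ℝ} (h : 0 < a / q) : a ≠ 0 := by
  rintro rfl
  simp at h

lemma one_div_sum_div_pos {n : ℕ} (hn : 1 ≤ n) {r : Fin n → ℝ} (hr : ∀ j, 0 < r j / q) :
    0 < (∑ j, 1 / r j) * q := by
  have : Nonempty (Fin n) := ⟨⟨0, hn⟩⟩
  rw [Finset.sum_mul]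
  refine Finset.sum_pos (fun j _ => ?_) Finset.univ_nonempty
  have := inv_pos.2 (hr j)
  rw [inv_div] at this
  rwa [one_div_mul_eq_div]

lemma one_div_div_pos {S : ℝ} (hS : 0 < S * q) : 0 < 1 / S / q := by
  rw [div_div]
  exact one_div_pos.2 hS

lemma div_two_mul_nonneg {a : ℝ} (h : 0 < a / q) : 0 ≤ a / (2 * q) := by
  rw [mul_comm, ← div_div]
  linarith

variable {h s v : ℝ → ℝ}

/-- The term for j is (a/(2q))‖k_j u‖²/r_j, that is, the weight a/r_j of k_j² in s² divided by 2q.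
-/
lemma listVar_ofFn_append {n : ℕ} {k : Fin n → ℝ → ℝ} (hk : ∀ j, MemLp (k j) ⊤ (leb T))
    {r : Fin n → ℝ} (hr : ∀ j, 0 < r j / q) {a b : ℝ} (ha : 0 < a / q) (hb : 0 < b / q)
    (hs : ∀ᵐ t ∂(leb T), s t ^ 2 = ∑ j, (√(a / r j) * k j t) ^ 2) (u : L2 T) :
    listVar (List.ofFn (fun j => (r j, √(a / (2 * q)) • k j)) ++ [(b, √(b / (2 * q)) • h)]) u =
      (gvar T s u + gvar T h u) / (2 * q) := by
  have hc : ∀ j, 0 ≤ a / r j := fun j => by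
    have hq : q ≠ 0 := fun hq => by simp [hq] at ha
    rw [← div_div_div_cancel_right₀ hq]
    exact (div_pos ha (hr j)).le
  have hb0 : b ≠ 0 := ne_zero_of_div_pos hb
  have h1 : gvar T h u / (2 * q) = b / (2 * q) * gvar T h u / b := by
    field_simp
  rw [gvar_eq_sum hk hc hs (Lp.memLp u), listVar, List.map_append, List.sum_append, List.map_ofFn,
    List.sum_ofFn, add_div, h1, Finset.sum_div]
  simp only [Function.comp_apply, List.map_cons, List.map_nil, List.sum_cons, List.sum_nil,
    add_zero, gvar_sqrt_smul _ _ (div_two_mul_nonneg ha), gvar_sqrt_smul _ _ (div_two_mul_nonneg hb)]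
  congr 1
  exact Finset.sum_congr rfl fun j _ => by ring

/-- A kernel scaled by √(b/(2q)) and used with parameter b contributes its quadratic form divided by
2q, whatever b is. -/
lemma listVar_pair {a b : ℝ} (ha : 0 < a / q) (hb : 0 < b / q) (u : L2 T) :
    listVar [(a, √(a / (2 * q)) • s), (b, √(b / (2 * q)) • h)] u =
      (gvar T s u + gvar T h u) / (2 * q) := by
  have ha0 : a ≠ 0 := ne_zero_of_div_pos ha
  have hb0 : b ≠ 0 := ne_zero_of_div_pos hb
  have hq : q ≠ 0 := fun hq => by simp [hq] at ha
  simp only [listVar, List.map_cons, List.map_nil, List.sum_cons, List.sum_nil,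
    add_zero, gvar_sqrt_smul _ _ (div_two_mul_nonneg ha), gvar_sqrt_smul _ _ (div_two_mul_nonneg hb)]
  field_simp

lemma listVar_singleton (hh : MemLp h ⊤ (leb T)) (hs : MemLp s ⊤ (leb T))
    (hv : ∀ᵐ t ∂(leb T), v t ^ 2 = h t ^ 2 + s t ^ 2) {b : ℝ} (hb : 0 < b / q) (u : L2 T) :
    listVar [(b, √(b / (2 * q)) • v)] u = (gvar T s u + gvar T h u) / (2 * q) := by
  have hb0 : b ≠ 0 := ne_zero_of_div_pos hb
  have hq : q ≠ 0 := fun hq => by simp [hq] at hb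
  simp only [listVar, List.map_cons, List.map_nil, List.sum_cons, List.sum_nil,
    add_zero, gvar_sqrt_smul _ _ (div_two_mul_nonneg hb), gvar_eq_add hh hs hv (Lp.memLp u)]
  field_simp
  ring

lemma admissible_ofFn_append {n : ℕ} {k : Fin n → ℝ → ℝ} (hk : ∀ j, MemLp (k j) ⊤ (leb T))
    (hh : MemLp h ⊤ (leb T)) {r : Fin n → ℝ} (hr : ∀ j, 0 < r j / q) {b : ℝ} (hb : 0 < b / q)
    (c d : ℝ) : ∀ P ∈ List.ofFn (fun j => (r j, c • k j)) ++ [(b, d • h)],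
      P.1 ≠ 0 ∧ MemLp P.2 ⊤ (leb T) := by
  intro P hP
  rcases List.mem_append.1 hP with hP | hP
  · obtain ⟨j, rfl⟩ := List.mem_ofFn.1 hP
    exact ⟨ne_zero_of_div_pos (hr j), (hk j).const_smul c⟩
  · rw [List.mem_singleton.1 hP]
    exact ⟨ne_zero_of_div_pos hb, hh.const_smul d⟩

lemma admissible_pair (hs : MemLp s ⊤ (leb T)) (hh : MemLp h ⊤ (leb T)) {a b : ℝ}
    (ha : 0 < a / q) (hb : 0 < b / q) (c d : ℝ) :
    ∀ P ∈ [(a, c • s), (b, d • h)], P.1 ≠ 0 ∧ MemLp P.2 ⊤ (leb T) := by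
  intro P hP
  simp only [List.mem_cons, List.not_mem_nil, or_false] at hP
  rcases hP with rfl | rfl
  · exact ⟨ne_zero_of_div_pos ha, hs.const_smul c⟩
  · exact ⟨ne_zero_of_div_pos hb, hh.const_smul d⟩

lemma admissible_singleton (hv : MemLp v ⊤ (leb T)) {b : ℝ} (hb : 0 < b / q) (c : ℝ) :
    ∀ P ∈ [(b, c • v)], P.1 ≠ 0 ∧ MemLp P.2 ⊤ (leb T) := by
  intro P hP
  rw [List.mem_singleton.1 hP]
  exact ⟨ne_zero_of_div_pos hb, hv.const_smul c⟩

end Parameters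

/-! ### Convolution products of iterated transforms, and the theorem. -/

section ConvolutionOfTransforms

variable {T : ℝ} {W : Measure (C0 T)} {φ : ℕ → ℝ → ℝ}

/-- The convolution product of iterated transforms is a single transform of a product. -/
theorem sae_isGCPAt_rotateList (hW : IsWienerMeasure W) (hT : 0 < T) (hφ : IsBVBasis T φ)
    {μ ν : Measure (L2 T)} [IsFiniteMeasure μ] [IsFiniteMeasure ν] {κ κ' : L2 T → ℂ}
    (hκm : Measurable κ) (hκ : Integrable κ μ) (hκm' : Measurable κ') (hκ' : Integrable κ' ν)
    {s₁ s₂ h : ℝ → ℝ} (hs₁ : MemLp s₁ ⊤ (leb T)) (hs₂ : MemLp s₂ ⊤ (leb T))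
    (hh : MemLp h ⊤ (leb T)) (h_sq : ∀ᵐ t ∂(leb T), h t ^ 2 = s₁ t * s₂ t) {q : ℝ} (hq : q ≠ 0)
    {L₁ L₂ : List (ℝ × (ℝ → ℝ))} (hL₁ : ∀ P ∈ L₁, P.1 ≠ 0 ∧ MemLp P.2 ⊤ (leb T))
    (hL₂ : ∀ P ∈ L₂, P.1 ≠ 0 ∧ MemLp P.2 ⊤ (leb T))
    (hV₁ : ∀ u : L2 T, listVar L₁ u = (gvar T s₁ u + gvar T h u) / (2 * q))
    (hV₂ : ∀ u : L2 T, listVar L₂ u = (gvar T s₂ u + gvar T h u) / (2 * q)) :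
    SAE W fun y => IsGCPAt W φ (-q) s₁ s₂ (phaseInt (pwzPhase φ) μ (rotateList L₁ κ))
      (phaseInt (pwzPhase φ) ν (rotateList L₂ κ')) y
      (phaseInt (prodPhase φ) (μ.prod ν)
        (rotate q (prodVar h) (fun w : L2 T × L2 T => κ w.1 * κ' w.2)) y) := by
  rw [← rotate_convVar_rotateList hs₁ hs₂ hh h_sq hV₁ hV₂]
  exact sae_isGCPAt_phaseInt hW hT hφ hs₁ hs₂
    (integrable_rotateList hW hT hφ (fun P hP => (hL₁ P hP).2) hκm hκ)
    (integrable_rotateList hW hT hφ (fun P hP => (hL₂ P hP).2) hκm' hκ') (neg_ne_zero.2 hq)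

end ConvolutionOfTransforms

end WienerFeynman

end

open WienerFeynman

theorem theorem6p3 {T : ℝ} (hT : 0 < T)
    (W : Measure (C0 T)) (hW : IsWienerMeasure W)
    (φ : ℕ → ℝ → ℝ) (hφ : IsBVBasis T φ)
    (F G : C0 T → ℂ) (hF : InS φ F) (hG : InS φ G)
    (h : ℝ → ℝ) (hh : IsKernel T h)
    {n m : ℕ} (hn : 1 ≤ n) (hm : 1 ≤ m)
    (h₁ : Fin n → ℝ → ℝ) (hh₁ : ∀ j, IsKernel T (h₁ j))
    (h₂ : Fin m → ℝ → ℝ) (hh₂ : ∀ l, IsKernel T (h₂ l))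
    (q q₁ q₂ : ℝ) (r₁ : Fin n → ℝ) (r₂ : Fin m → ℝ) (hq : q ≠ 0)
    (hq₁ : SignType.sign q₁ = SignType.sign q) (hq₂ : SignType.sign q₂ = SignType.sign q)
    (hr₁ : ∀ j, SignType.sign (r₁ j) = SignType.sign q)
    (hr₂ : ∀ l, SignType.sign (r₂ l) = SignType.sign q)
    (α₁ α₂ β₁ β₂ : ℝ)
    (hα₁ : α₁ = 1 / ∑ j, 1 / r₁ j) (hα₂ : α₂ = 1 / ∑ l, 1 / r₂ l)
    (hβ₁ : β₁ = 1 / (1 / q₁ + ∑ j, 1 / r₁ j)) (hβ₂ : β₂ = 1 / (1 / q₂ + ∑ l, 1 / r₂ l))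
    (s₁ s₂ : ℝ → ℝ) (hs₁ : MemLp s₁ ⊤ (leb T)) (hs₂ : MemLp s₂ ⊤ (leb T))
    (hs₁_sq : ∀ᵐ t ∂(leb T), s₁ t ^ 2 = ∑ j, (√(α₁ / r₁ j) * h₁ j t) ^ 2)
    (hs₂_sq : ∀ᵐ t ∂(leb T), s₂ t ^ 2 = ∑ l, (√(α₂ / r₂ l) * h₂ l t) ^ 2)
    (h_sq : ∀ᵐ t ∂(leb T), h t ^ 2 = s₁ t * s₂ t)
    (v₁ v₂ : ℝ → ℝ) (hv₁ : MemLp v₁ ⊤ (leb T)) (hv₂ : MemLp v₂ ⊤ (leb T))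
    (hv₁_sq : ∀ᵐ t ∂(leb T), v₁ t ^ 2 = h t ^ 2 + s₁ t ^ 2)
    (hv₂_sq : ∀ᵐ t ∂(leb T), v₂ t ^ 2 = h t ^ 2 + s₂ t ^ 2)
    (p : ℝ) (hp : p ∈ Set.Icc (1 : ℝ) 2)
    (LA₁ LA₂ LB₁ LB₂ LC₁ LC₂ : List (ℝ × (ℝ → ℝ)))
    (hLA₁ : LA₁ = List.ofFn (fun j => (r₁ j, √(α₁ / (2 * q)) • h₁ j)) ++
      [(q₁, √(q₁ / (2 * q)) • h)])
    (hLA₂ : LA₂ = List.ofFn (fun l => (r₂ l, √(α₂ / (2 * q)) • h₂ l)) ++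
      [(q₂, √(q₂ / (2 * q)) • h)])
    (hLB₁ : LB₁ = [(α₁, √(α₁ / (2 * q)) • s₁), (q₁, √(q₁ / (2 * q)) • h)])
    (hLB₂ : LB₂ = [(α₂, √(α₂ / (2 * q)) • s₂), (q₂, √(q₂ / (2 * q)) • h)])
    (hLC₁ : LC₁ = [(β₁, √(β₁ / (2 * q)) • v₁)])
    (hLC₂ : LC₂ = [(β₂, √(β₂ / (2 * q)) • v₂)]) :
    -- all the iterated transforms exist, and so does the transform of `F(·/√2) G(·/√2)`
    ((∃ A₁, IsIterGFFT W φ p LA₁ F A₁) ∧ (∃ A₂, IsIterGFFT W φ p LA₂ G A₂) ∧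
      (∃ B₁, IsIterGFFT W φ p LB₁ F B₁) ∧ (∃ B₂, IsIterGFFT W φ p LB₂ G B₂) ∧
      (∃ C₁, IsIterGFFT W φ p LC₁ F C₁) ∧ (∃ C₂, IsIterGFFT W φ p LC₂ G C₂) ∧
      (∃ D, IsGFFT W φ p q h (fun y => F ((√2)⁻¹ • y) * G ((√2)⁻¹ • y)) D)) ∧
    -- the three convolution products exist s-a.e. and are s-a.e. equal to that transform
    (∀ A₁ A₂ B₁ B₂ C₁ C₂ D : C0 T → ℂ,
      IsIterGFFT W φ p LA₁ F A₁ → IsIterGFFT W φ p LA₂ G A₂ →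
      IsIterGFFT W φ p LB₁ F B₁ → IsIterGFFT W φ p LB₂ G B₂ →
      IsIterGFFT W φ p LC₁ F C₁ → IsIterGFFT W φ p LC₂ G C₂ →
      IsGFFT W φ p q h (fun y => F ((√2)⁻¹ • y) * G ((√2)⁻¹ • y)) D →
      SAE W (fun y =>
        IsGCPAt W φ (-q) s₁ s₂ A₁ A₂ y (D y) ∧
        IsGCPAt W φ (-q) s₁ s₂ B₁ B₂ y (D y) ∧
        IsGCPAt W φ (-q) s₁ s₂ C₁ C₂ y (D y))) := by
  have := hW.prob
  obtain ⟨μ, κ, hμ, hκm, hκ, rfl⟩ := hF.exists_phaseInt_eq hT hφ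
  obtain ⟨ν, κ', hν, hκm', hκ', rfl⟩ := hG.exists_phaseInt_eq hT hφ
  have hr₁' : ∀ j, 0 < r₁ j / q := fun j => div_pos_of_sign_eq hq (hr₁ j)
  have hr₂' : ∀ l, 0 < r₂ l / q := fun l => div_pos_of_sign_eq hq (hr₂ l)
  have hq₁' := div_pos_of_sign_eq hq hq₁
  have hq₂' := div_pos_of_sign_eq hq hq₂
  have hS₁ := one_div_sum_div_pos hn hr₁'
  have hS₂ := one_div_sum_div_pos hm hr₂'
  have hα₁' : 0 < α₁ / q := hα₁ ▸ one_div_div_pos hS₁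
  have hα₂' : 0 < α₂ / q := hα₂ ▸ one_div_div_pos hS₂
  have hβ : ∀ {a S : ℝ}, 0 < a / q → 0 < S * q → 0 < (1 / a + S) * q := fun {a S} ha hS => by
    have h1 := inv_pos.2 ha
    rw [inv_div, div_eq_mul_one_div, mul_comm] at h1
    rw [add_mul]
    exact add_pos h1 hS
  have hβ₁' : 0 < β₁ / q := hβ₁ ▸ one_div_div_pos (hβ hq₁' hS₁)
  have hβ₂' : 0 < β₂ / q := hβ₂ ▸ one_div_div_pos (hβ hq₂' hS₂)
  have hk₁ := fun j => (hh₁ j).1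
  have hk₂ := fun l => (hh₂ l).1
  subst hLA₁ hLA₂ hLB₁ hLB₂ hLC₁ hLC₂
  have aA₁ := admissible_ofFn_append hk₁ hh.1 hr₁' hq₁' √(α₁ / (2 * q)) √(q₁ / (2 * q))
  have aA₂ := admissible_ofFn_append hk₂ hh.1 hr₂' hq₂' √(α₂ / (2 * q)) √(q₂ / (2 * q))
  have aB₁ := admissible_pair hs₁ hh.1 hα₁' hq₁' √(α₁ / (2 * q)) √(q₁ / (2 * q))
  have aB₂ := admissible_pair hs₂ hh.1 hα₂' hq₂' √(α₂ / (2 * q)) √(q₂ / (2 * q))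
  have aC₁ := admissible_singleton hv₁ hβ₁' √(β₁ / (2 * q))
  have aC₂ := admissible_singleton hv₂ hβ₂' √(β₂ / (2 * q))
  have hP := isPhase_prodPhase hW hT hφ
  have hZ := isNormalAlong_prodPhase hW hT hφ hh.1
  have hκκm : Measurable fun w : L2 T × L2 T => κ w.1 * κ' w.2 :=
    (hκm.comp measurable_fst).mul (hκm'.comp measurable_snd)
  have hκκ : Integrable (fun w : L2 T × L2 T => κ w.1 * κ' w.2) (μ.prod ν) := hκ.mul_prod hκ'
  -- The product is a Fourier-type functional over pairs (u, v), so the general transform theorems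
  -- apply to it directly.
  rw [phaseInt_mul_phaseInt_smul]
  refine ⟨⟨⟨_, isIterGFFT_phaseInt hW hT hφ hp aA₁ hκm hκ⟩,
    ⟨_, isIterGFFT_phaseInt hW hT hφ hp aA₂ hκm' hκ'⟩,
    ⟨_, isIterGFFT_phaseInt hW hT hφ hp aB₁ hκm hκ⟩,
    ⟨_, isIterGFFT_phaseInt hW hT hφ hp aB₂ hκm' hκ'⟩,
    ⟨_, isIterGFFT_phaseInt hW hT hφ hp aC₁ hκm hκ⟩,
    ⟨_, isIterGFFT_phaseInt hW hT hφ hp aC₂ hκm' hκ'⟩,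
    ⟨_, isGFFT_phaseInt hP hZ hκκm hκκ hq hp⟩⟩, ?_⟩
  intro A₁ A₂ B₁ B₂ C₁ C₂ D hA₁ hA₂ hB₁ hB₂ hC₁ hC₂ hD
  rw [hA₁.eq_phaseInt hW hT hφ hp aA₁ hκm hκ, hA₂.eq_phaseInt hW hT hφ hp aA₂ hκm' hκ',
    hB₁.eq_phaseInt hW hT hφ hp aB₁ hκm hκ, hB₂.eq_phaseInt hW hT hφ hp aB₂ hκm' hκ',
    hC₁.eq_phaseInt hW hT hφ hp aC₁ hκm hκ, hC₂.eq_phaseInt hW hT hφ hp aC₂ hκm' hκ']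
  -- D is not required to lie in the class, so it is identified only s-a.e.; the conclusion asks for
  -- no more.
  have hDeq := hD.sae_eq_phaseInt hP hZ hκκm hκκ hq hp
  have gA := sae_isGCPAt_rotateList hW hT hφ hκm hκ hκm' hκ' hs₁ hs₂ hh.1 h_sq hq aA₁ aA₂
    (listVar_ofFn_append hk₁ hr₁' hα₁' hq₁' hs₁_sq) (listVar_ofFn_append hk₂ hr₂' hα₂' hq₂' hs₂_sq)
  have gB := sae_isGCPAt_rotateList hW hT hφ hκm hκ hκm' hκ' hs₁ hs₂ hh.1 h_sq hq aB₁ aB₂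
    (listVar_pair hα₁' hq₁') (listVar_pair hα₂' hq₂')
  have gC := sae_isGCPAt_rotateList hW hT hφ hκm hκ hκm' hκ' hs₁ hs₂ hh.1 h_sq hq aC₁ aC₂
    (listVar_singleton hh.1 hs₁ hv₁_sq hβ₁') (listVar_singleton hh.1 hs₂ hv₂_sq hβ₂')
  intro ρ hρ
  filter_upwards [hDeq ρ hρ, gA ρ hρ, gB ρ hρ, gC ρ hρ] with y hy hA hB hC
  rw [hy]
  exact ⟨hA, hB, hC⟩
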